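/- Let $a=1.1$ and $A_o=aI_2\in\mathbb{R}^{2\times 2}$. Let $\eta_1,\eta_2,\dots$ be i.i.d. standard Gaussian vectors in $\mathbb{R}^2$, let $X_0=0$ and $X_{t+1}=A_oX_t+\eta_{t+1}$ for $t\ge 0$, and for each $T$ let $\hat A_o=\hat A_o(T)$ be an ordinary least squares (OLS) estimate, i.e. a minimizer of $\sum_{t=0}^{T}\|X_{t+1}-BX_t\|_2^2$ over $B\in\mathbb{R}^{2\times2}$. Write $\gamma_T=\|\hat A_o(T)-A_o\|$ for the operator-norm error and $\sigma_1\ge\sigma_2$ for the singular values of a $2\times 2$ matrix. Then: 1. For every $T\ge 2$ with $T^2\le a^T$, the OLS estimate is almost surely unique, and $\gamma_T$ is a random variable whose law has a continuous density on $\mathbb{R}$ with respect to Lebesgue measure. 2. $\gamma_T$ does not decay to zero as $T\to\infty$: there is $\varepsilon>0$ with $\lim_{T\to\infty}\mathbb{P}(\gamma_T\ge\varepsilon)=1$. In particular $\gamma_T$ does not converge to $0$ in probability, that is, OLS is inconsistent for $A_o$. 3. With high probability $\sigma_1\big(\sum_{t=1}^TX_tX_t^\top\big)=\Theta(a^{2T})$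 and $\sigma_2\big(\sum_{t=1}^TX_tX_t^\top\big)=O(\sqrt T\,a^T)$: for every $\delta\in(0,1)$ there are constants $c,C>0$ such that, with probability at least $1-\delta$, simultaneously for all $T\ge 1$ with $T^2\le a^T$, $$c\,a^{2T}\le\sigma_1\Big(\sum_{t=1}^TX_tX_t^\top\Big)\le C\,a^{2T},\qquad \sigma_2\Big(\sum_{t=1}^TX_tX_t^\top\Big)\le C\sqrt T\,a^T .$$ -/

import Mathlib

open MeasureTheory ProbabilityTheory Filter Topology

/-- The trajectory `X₀ = 0`, `X_{t+1} = A X_t + η_{t+1}` of a linear time-invariant system. -/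
noncomputable def ltiState {d : ℕ} (A : Matrix (Fin d) (Fin d) ℝ)
    (η : ℕ → EuclideanSpace ℝ (Fin d)) : ℕ → EuclideanSpace ℝ (Fin d)
  | 0 => 0
  | t + 1 => Matrix.toEuclideanCLM (𝕜 := ℝ) A (ltiState A η t) + η (t + 1)

/-- `B` is an ordinary least squares estimate from the trajectory `X₀, …, X_{T+1}`: it minimizes
`∑_{t=0}^{T} ‖X_{t+1} - B X_t‖²` over all square matrices. -/
def IsOLS {d : ℕ} (X : ℕ → EuclideanSpace ℝ (Fin d)) (T : ℕ)
    (B : Matrix (Fin d) (Fin d) ℝ) : Prop :=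
  IsMinOn (fun M : Matrix (Fin d) (Fin d) ℝ =>
    ∑ t ∈ Finset.range (T + 1), ‖X (t + 1) - Matrix.toEuclideanCLM (𝕜 := ℝ) M (X t)‖ ^ 2)
    Set.univ B

/-- The operator norm of a square matrix for the Euclidean norm. -/
noncomputable def opNorm2 {d : ℕ} (M : Matrix (Fin d) (Fin d) ℝ) : ℝ :=
  ‖Matrix.toEuclideanCLM (𝕜 := ℝ) M‖

/-- The sample covariance matrix `∑_{t=1}^{T} X_t X_tᵀ` (unnormalized). -/
def sampleCov {d : ℕ} (X : ℕ → EuclideanSpace ℝ (Fin d)) (T : ℕ) : Matrix (Fin d) (Fin d) ℝ :=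
  ∑ t ∈ Finset.Icc 1 T, Matrix.vecMulVec (fun i => X t i) (fun i => X t i)

/-- The `i`-th largest singular value of a square matrix, counted with multiplicity and starting
from `i = 0`. -/
noncomputable def matSingularValue {d : ℕ} (M : Matrix (Fin d) (Fin d) ℝ) (i : ℕ) : ℝ :=
  (Matrix.toEuclideanLin M).singularValues i

/-- The growth rate `a = 1.1`. -/
noncomputable def aRate : ℝ := 11 / 10

/-- The irregular matrix `A_o = a I`, with `a = 1.1`. -/
noncomputable def Ao : Matrix (Fin 2) (Fin 2) ℝ := !![aRate, 0; 0, aRate]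

/-!
The system is `X_{t+1} = a X_t + η_{t+1}` in the plane with `a = 1.1`. The whole state grows along
one random direction `Z = ∑ a⁻ʲ η_j`, so the Gram matrix `S = ∑ X_t X_tᵀ` is badly conditioned;
this is what makes least squares fail.

**Continuous density.** The error matrix `E` solves `E S = C` with `C = ∑ (X_{t+1} - a X_t) X_tᵀ`.
A random solution of a linear equation `L Y = C` has the density `p(B) = (2π)⁻⁴ ∫ 𝔼[|det L|
exp(i⟪Ξ, C - L B⟫)] dΞ`, which is continuous as soon as the expectation is dominated by an
integrable function of `Ξ` (`exists_continuous_density_of_linear_equation`). Here `|det L| = (det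
S)²` is a sum of monomials in four states, and the phase is a sum over `t` of quadratic functions
of consecutive states. Rotating each pair `(η_{2j+1}, η_{2j+2})` by the angle `arctan a` gives
independent Gaussians `(α_j, β_j)` such that `α_j` enters only the state `X_{2j+1}`. Integrating
out `α_j` and then `β_j` gains a factor `(1 + c‖Ξ‖²)^(-1/4)` from each block that a monomial does
not involve (`norm_integral_weighted_phase_le`); ten blocks yield a bound of order `‖Ξ‖⁻⁵`,
integrable in dimension four. Polar coordinates pass from the matrix to its operator norm
(`exists_continuous_density_norm`).

**Inconsistency.** Write `[u, v]` for the planar determinant. The normal equations give `tr B ·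
det S = ∑_{s,t} [X_s, X_t][X_s, X_{t+1}]`, and the terms `t < s` telescope to at most `det S`,
whereas the terms `s < t` equal `a det S` up to the interaction `∑_{s<t} [X_s, η_{t+1}]²` of the
noise with the past. Hence `tr (B - a I) ≤ 1 - a + o(1)` (`IsOLS.trace_sub_mul_det_le`): the
estimate is off by a fixed amount. The interaction is negligible since it is `o(T) a^{2T}`,
whereas `det S` is at least a multiple of `∑_s [η_s, X_T]²`, which by the law of large numbers is
of order `T a^{2T}` (`eventually_noiseEnergy_le`). Both facts use `Z ≠ 0`, which holds almost
surely since the first noise vector is an independent Gaussian summand of `Z`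
(`ae_limit_ne_zero`).

**Singular values.** The largest singular value of `S` lies between `‖X_T‖²` and `∑ ‖X_t‖²`, and
the smallest one is at most the quadratic form of `S` in the direction orthogonal to `Z`, where
`X_t - aᵗ Z` grows strictly slower than `a^{t/2}` (`exists_matSingularValue_bounds`).
-/

local notation "𝔼₂" => EuclideanSpace ℝ (Fin 2)
local notation "𝕍₄" => EuclideanSpace ℝ (Fin 2 × Fin 2)

/-! ### Gaussian integrals of quadratic phases -/

section GaussianPhase

variable {E : Type*} [NormedAddCommGroup E] [InnerProductSpace ℝ E] [FiniteDimensional ℝ E]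
  [MeasurableSpace E] [BorelSpace E]

/-- The characteristic function of the standard Gaussian measure, as a real exponential. -/
lemma integral_cexp_inner_stdGaussian (t : E) :
    ∫ x, Complex.exp (((inner ℝ x t : ℝ) : ℂ) * Complex.I) ∂(stdGaussian E)
      = ((Real.exp (-‖t‖ ^ 2 / 2) : ℝ) : ℂ) := by
  rw [← charFun_apply, charFun_stdGaussian]
  push_cast
  ring_nf

/-- The Gaussian average of `exp (-⟪x, u⟫² / 2)`. -/
lemma integral_exp_neg_inner_sq_stdGaussian (u : E) :
    ∫ x, Real.exp (-(inner ℝ x u : ℝ) ^ 2 / 2) ∂(stdGaussian E) = (1 + ‖u‖ ^ 2) ^ (-(1 / 2) : ℝ) := by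
  -- write the integrand as a characteristic function of a real Gaussian and exchange integrals
  have h1 : ∀ x : E, ((Real.exp (-(inner ℝ x u : ℝ) ^ 2 / 2) : ℝ) : ℂ)
      = ∫ y, Complex.exp (((inner ℝ x (y • u) : ℝ) : ℂ) * Complex.I) ∂(gaussianReal 0 1) := by
    intro x
    have := charFun_gaussianReal (μ := 0) (v := 1) (t := (inner ℝ x u : ℝ))
    rw [charFun_apply] at this
    simp only [inner_smul_right]
    rw [show (fun y : ℝ => Complex.exp (((y * inner ℝ x u : ℝ) : ℂ) * Complex.I))
      = fun y : ℝ => Complex.exp (((inner ℝ y (inner ℝ x u : ℝ) : ℝ) : ℂ) * Complex.I) by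
        ext y; simp [mul_comm], this]
    push_cast
    congr 1
    simp
    ring
  have h2 : ∀ y : ℝ, ∫ x, Complex.exp (((inner ℝ x (y • u) : ℝ) : ℂ) * Complex.I) ∂(stdGaussian E)
      = ((Real.exp (-(‖u‖ ^ 2 / 2) * y ^ 2) : ℝ) : ℂ) := by
    intro y
    rw [integral_cexp_inner_stdGaussian, norm_smul, mul_pow, Real.norm_eq_abs, sq_abs]
    congr 2
    ring
  have hint : Integrable (Function.uncurry fun (x : E) (y : ℝ) =>
      Complex.exp (((inner ℝ x (y • u) : ℝ) : ℂ) * Complex.I))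
      ((stdGaussian E).prod (gaussianReal 0 1)) := by
    refine Integrable.of_bound (C := 1) ?_ (ae_of_all _ fun p => ?_)
    · exact Continuous.aestronglyMeasurable (by simp only [Function.uncurry_def]; fun_prop)
    · simp [Function.uncurry_def, Complex.norm_exp_ofReal_mul_I]
  have h3 : ((∫ x, Real.exp (-(inner ℝ x u : ℝ) ^ 2 / 2) ∂(stdGaussian E) : ℝ) : ℂ)
      = ((∫ y, Real.exp (-(‖u‖ ^ 2 / 2) * y ^ 2) ∂(gaussianReal 0 1) : ℝ) : ℂ) := by
    rw [← integral_complex_ofReal, ← integral_complex_ofReal]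
    simp_rw [h1]
    rw [integral_integral_swap hint]
    simp_rw [h2]
  rw [Complex.ofReal_inj.1 h3, integral_gaussianReal_eq_integral_smul one_ne_zero]
  have hpos : (0 : ℝ) < 1 + ‖u‖ ^ 2 := by positivity
  have h4 : ∀ y : ℝ, gaussianPDFReal 0 1 y • Real.exp (-(‖u‖ ^ 2 / 2) * y ^ 2)
      = (√(2 * Real.pi))⁻¹ * Real.exp (-((1 + ‖u‖ ^ 2) / 2) * y ^ 2) := by
    intro y
    rw [gaussianPDFReal, smul_eq_mul, mul_assoc, ← Real.exp_add]
    simp only [NNReal.coe_one, mul_one, sub_zero]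
    congr 2
    ring
  simp_rw [h4]
  rw [integral_const_mul, integral_gaussian, Real.rpow_neg hpos.le, ← Real.sqrt_eq_rpow,
    ← Real.sqrt_inv, ← Real.sqrt_mul (by positivity), ← Real.sqrt_inv]
  congr 1
  field_simp

/-- A Gaussian affine image `P x + Q y + v` is at least as spread out as its projection to
`P e` or `Q e`, for every unit vector `e`: this bounds its Gaussian average. -/
lemma integral_exp_neg_norm_sq_affine_le {F : Type*} [NormedAddCommGroup F]
    [InnerProductSpace ℝ F] [FiniteDimensional ℝ F] [MeasurableSpace F] [BorelSpace F]
    (P : E →L[ℝ] F) (Q : E →L[ℝ] F) (v : F) (e : E) (he : ‖e‖ ≤ 1) (u : F)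
    (hu : u = P e ∨ u = Q e) :
    ∫ x, ∫ y, Real.exp (-‖P x + Q y + v‖ ^ 2 / 2) ∂(stdGaussian E) ∂(stdGaussian E)
      ≤ (1 + ‖u‖ ^ 2) ^ (-(1 / 2) : ℝ) := by
  set g := stdGaussian E
  -- the Gaussian of a vector is the average of a linear phase over an auxiliary Gaussian `d`
  have key : ((∫ x, ∫ y, Real.exp (-‖P x + Q y + v‖ ^ 2 / 2) ∂g ∂g : ℝ) : ℂ)
      = ∫ d, Complex.exp (((inner ℝ d v : ℝ) : ℂ) * Complex.I) *
        (((Real.exp (-‖P.adjoint d‖ ^ 2 / 2) * Real.exp (-‖Q.adjoint d‖ ^ 2 / 2) : ℝ)) : ℂ)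
          ∂(stdGaussian F) := by
    rw [← integral_complex_ofReal]
    simp_rw [← integral_complex_ofReal, ← integral_cexp_inner_stdGaussian]
    have hb : ∀ (ν : Measure E) [IsProbabilityMeasure ν] (x : E),
        Integrable (Function.uncurry fun (y : E) (d : F) =>
        Complex.exp (((inner ℝ d (P x + Q y + v) : ℝ) : ℂ) * Complex.I))
        (ν.prod (stdGaussian F)) := by
      intro ν _ x
      refine Integrable.of_bound (C := 1) ?_ (ae_of_all _ fun p => ?_)
      · exact Continuous.aestronglyMeasurable (by simp only [Function.uncurry_def]; fun_prop)
      · simp [Function.uncurry_def, Complex.norm_exp_ofReal_mul_I]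
    have hsw : ∀ x, ∫ y, ∫ d, Complex.exp (((inner ℝ d (P x + Q y + v) : ℝ) : ℂ) * Complex.I)
        ∂(stdGaussian F) ∂g = ∫ d, Complex.exp (((inner ℝ d (P x + v) : ℝ) : ℂ) * Complex.I) *
          ((Real.exp (-‖Q.adjoint d‖ ^ 2 / 2) : ℝ) : ℂ) ∂(stdGaussian F) := by
      intro x
      rw [integral_integral_swap (hb g x)]
      congr 1
      ext d
      rw [← integral_cexp_inner_stdGaussian (Q.adjoint d), ← integral_const_mul]
      congr 1
      ext y
      rw [← Complex.exp_add, ContinuousLinearMap.adjoint_inner_right, real_inner_comm d (Q y)]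
      congr 1
      simp only [inner_add_right]
      push_cast
      ring
    simp_rw [hsw]
    rw [integral_integral_swap]
    · congr 1
      ext d
      have : ∀ x, Complex.exp (((inner ℝ d (P x + v) : ℝ) : ℂ) * Complex.I) *
          ((Real.exp (-‖Q.adjoint d‖ ^ 2 / 2) : ℝ) : ℂ)
          = (Complex.exp (((inner ℝ d v : ℝ) : ℂ) * Complex.I) *
          ((Real.exp (-‖Q.adjoint d‖ ^ 2 / 2) : ℝ) : ℂ)) *
            Complex.exp (((inner ℝ x (P.adjoint d) : ℝ) : ℂ) * Complex.I) := by
        intro x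
        rw [ContinuousLinearMap.adjoint_inner_right, real_inner_comm d (P x), inner_add_right]
        push_cast
        rw [add_mul, Complex.exp_add]
        ring
      simp_rw [this]
      rw [integral_const_mul, integral_cexp_inner_stdGaussian]
      push_cast
      ring
    · refine Integrable.of_bound (C := 1) ?_ (ae_of_all _ fun p => ?_)
      · exact Continuous.aestronglyMeasurable (by simp only [Function.uncurry_def]; fun_prop)
      · simp only [Function.uncurry_def, norm_mul, Complex.norm_exp_ofReal_mul_I, one_mul,
          Complex.norm_real, Real.norm_eq_abs, Real.abs_exp]
        exact Real.exp_le_one_iff.2 (by have := sq_nonneg ‖Q.adjoint p.2‖; linarith)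
  have h0 : 0 ≤ ∫ x, ∫ y, Real.exp (-‖P x + Q y + v‖ ^ 2 / 2) ∂g ∂g :=
    integral_nonneg fun x => integral_nonneg fun y => (Real.exp_pos _).le
  rw [← abs_of_nonneg h0, ← Real.norm_eq_abs, ← Complex.norm_real, key,
    ← integral_exp_neg_inner_sq_stdGaussian u]
  refine (norm_integral_le_integral_norm _).trans ?_
  refine integral_mono_of_nonneg (ae_of_all _ fun d => norm_nonneg _) ?_
    (ae_of_all _ fun d => ?_)
  · refine Integrable.of_bound (C := 1) ?_ (ae_of_all _ fun p => ?_)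
    · exact Continuous.aestronglyMeasurable (by fun_prop)
    · rw [Real.norm_eq_abs, Real.abs_exp]
      exact Real.exp_le_one_iff.2 (by have := sq_nonneg (inner ℝ p u : ℝ); linarith)
  · simp only [norm_mul, Complex.norm_exp_ofReal_mul_I, one_mul, Complex.norm_real,
      Real.norm_eq_abs, Real.abs_exp]
    rw [← Real.exp_add]
    refine Real.exp_le_exp.2 ?_
    have aux : ∀ R : E →L[ℝ] F, (inner ℝ d (R e) : ℝ) ^ 2 ≤ ‖R.adjoint d‖ ^ 2 := by
      intro R
      rw [← ContinuousLinearMap.adjoint_inner_left, sq_le_sq, abs_norm]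
      refine (abs_real_inner_le_norm _ _).trans ?_
      exact mul_le_of_le_one_right (norm_nonneg _) he
    have hP := aux P
    have hQ := aux Q
    have hP0 := sq_nonneg ‖P.adjoint d‖
    have hQ0 := sq_nonneg ‖Q.adjoint d‖
    rcases hu with rfl | rfl <;> linarith

/-- The average of the quadratic phase `⟪x, l⟫ - κ / 2 ⟪x, H x⟫` over a standard Gaussian `x`. -/
noncomputable def gaussPhase (H : E →L[ℝ] E) (κ : ℝ) (l : E) : ℂ :=
  ∫ x, Complex.exp (((inner ℝ x l - κ / 2 * inner ℝ x (H x) : ℝ) : ℂ) * Complex.I) ∂(stdGaussian E)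

/-- Decoupling: squaring the average of a quadratic phase and rotating the two independent copies
of the Gaussian by `π / 4` leaves a phase which is bilinear in the rotated copies. -/
lemma norm_gaussPhase_sq_le (H : E →L[ℝ] E) (hH : ∀ x y, (inner ℝ (H x) y : ℝ) = inner ℝ x (H y))
    (κ : ℝ) (l : E) :
    ‖gaussPhase H κ l‖ ^ 2 ≤
      ∫ y, Real.exp (-‖(√2 • l) - κ • H y‖ ^ 2 / 2) ∂(stdGaussian E) := by
  set g := stdGaussian E
  set ψ : E → ℝ := fun x => inner ℝ x l - κ / 2 * inner ℝ x (H x) with hψ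
  have hψc : Continuous ψ := by fun_prop
  have h1 : ((‖gaussPhase H κ l‖ ^ 2 : ℝ) : ℂ)
      = ∫ p, Complex.exp (((ψ p.1 - ψ p.2 : ℝ) : ℂ) * Complex.I) ∂(g.prod g) := by
    have : ((‖gaussPhase H κ l‖ ^ 2 : ℝ) : ℂ) =
        gaussPhase H κ l * (starRingEnd ℂ) (gaussPhase H κ l) := by
      rw [Complex.mul_conj, Complex.normSq_eq_norm_sq]
    rw [this]
    simp only [gaussPhase]
    rw [← integral_conj, ← integral_prod_mul]
    congr 1
    ext p
    rw [← Complex.exp_conj, ← Complex.exp_add]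
    congr 1
    simp only [hψ, map_mul, Complex.conj_I, Complex.conj_ofReal]
    push_cast
    ring
  have hrot : (g.prod g).map (ContinuousLinearMap.rotation (Real.pi / 4)) = g.prod g :=
    IsGaussian.map_rotation_eq_self (by simpa using integral_id_stdGaussian) _
  have h2 : ∀ p : E × E, ψ (ContinuousLinearMap.rotation (Real.pi / 4) p).1
      - ψ (ContinuousLinearMap.rotation (Real.pi / 4) p).2
      = inner ℝ p.1 (√2 • l - κ • H p.2) := by
    intro p
    have hs : (√2 / 2 : ℝ) * (√2 / 2) = 1 / 2 := by
      rw [div_mul_div_comm, Real.mul_self_sqrt (by norm_num)]; norm_num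
    have hsym := hH p.1 p.2
    rw [real_inner_comm] at hsym
    have hx : (inner ℝ p.2 (H p.1) : ℝ) = inner ℝ p.1 (H p.2) := hsym
    simp only [hψ, ContinuousLinearMap.rotation_apply, Real.cos_pi_div_four, Real.sin_pi_div_four,
      map_add, map_smul, map_neg, inner_add_left, inner_add_right, inner_smul_left,
      inner_smul_right, inner_sub_right, neg_smul, inner_neg_left, inner_neg_right, conj_trivial, hx]
    linear_combination (-2 * κ * inner ℝ p.1 (H p.2)) * hs
  rw [← hrot, integral_map (by fun_prop) (Continuous.aestronglyMeasurable (by fun_prop))] at h1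
  simp_rw [h2] at h1
  rw [integral_prod_symm] at h1
  · simp only [g, integral_cexp_inner_stdGaussian, integral_complex_ofReal] at h1
    exact (Complex.ofReal_inj.1 h1).le
  · refine Integrable.of_bound (C := 1) ?_ (ae_of_all _ fun p => ?_)
    · exact Continuous.aestronglyMeasurable (by fun_prop)
    · simp [Complex.norm_exp_ofReal_mul_I]

/-- Averaging the squared modulus of the quadratic phase over a Gaussian direction `Θ y` of the
linear term gains a factor of the order of `1 / ‖u‖`, where `u` is the image of a unit vector under
either the quadratic form or the linear map `Θ`. -/
lemma integral_norm_gaussPhase_sq_le (H : E →L[ℝ] E)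
    (hH : ∀ x y, (inner ℝ (H x) y : ℝ) = inner ℝ x (H y)) (κ : ℝ) (Θ : E →L[ℝ] E) (v e u : E)
    (he : ‖e‖ ≤ 1) (hu : u = √2 • Θ e ∨ u = -κ • H e) :
    ∫ y, ‖gaussPhase H κ (Θ y + v)‖ ^ 2 ∂(stdGaussian E) ≤ (1 + ‖u‖ ^ 2) ^ (-(1 / 2) : ℝ) := by
  refine le_trans ?_ (integral_exp_neg_norm_sq_affine_le (√2 • Θ) (-κ • H) (√2 • v) e he u hu)
  refine integral_mono_of_nonneg (ae_of_all _ fun y => by positivity) ?_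
    (ae_of_all _ fun y => ?_)
  · refine Integrable.integral_prod_left (f := fun p : E × E =>
      Real.exp (-‖(√2 • Θ) p.1 + (-κ • H) p.2 + √2 • v‖ ^ 2 / 2)) ?_
    refine Integrable.of_bound (C := 1) ?_ (ae_of_all _ fun p => ?_)
    · exact Continuous.aestronglyMeasurable (by fun_prop)
    · rw [Real.norm_eq_abs, Real.abs_exp]
      exact Real.exp_le_one_iff.2 (by
        have := sq_nonneg ‖(√2 • Θ) p.1 + (-κ • H) p.2 + √2 • v‖; linarith)
  · refine (norm_gaussPhase_sq_le H hH κ _).trans_eq ?_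
    congr 1
    ext z
    congr 4
    rw [show (-κ • H) z = -(κ • H z) by simp, show (√2 • Θ) y = √2 • Θ y from rfl, smul_add]
    abel_nf

end GaussianPhase

/-! ### Densities of solutions of random linear equations -/

section RandomLinearEquation

variable {V : Type*} [NormedAddCommGroup V] [InnerProductSpace ℝ V] [FiniteDimensional ℝ V]
  [MeasurableSpace V] [BorelSpace V]

lemma integral_abs_det_mul_comp (A : V →L[ℝ] V) (hA : A.det ≠ 0) (F : V → ℝ) :
    ∫ x, |A.det| * F (A x) = ∫ x, F x := by
  have h := Measure.map_linearMap_addHaar_eq_smul_addHaar (volume : Measure V) (f := (A : V →ₗ[ℝ] V)) hA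
  have hemb : MeasurableEmbedding A := by
    have := (A.toContinuousLinearEquivOfDetNeZero hA).toHomeomorph.measurableEmbedding
    exact this
  have h2 : ∫ x, F (A x) = |A.det|⁻¹ * ∫ x, F x := by
    rw [← hemb.integral_map]
    change ∫ y, F y ∂(Measure.map (⇑(A : V →ₗ[ℝ] V)) volume) = _
    rw [h, integral_smul_measure, ENNReal.toReal_ofReal (abs_nonneg _), abs_inv, smul_eq_mul]
  rw [integral_const_mul, h2, ← mul_assoc, mul_inv_cancel₀ (abs_ne_zero.2 hA), one_mul]

/-- Fourier transform of the Gaussian `exp (-s² ‖ξ‖² / 4)`. -/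
lemma integral_exp_neg_mul_cexp_inner (s : ℝ) (hs : 0 < s) (w : V) :
    ∫ ξ : V, ((Real.exp (-(s ^ 2 / 4) * ‖ξ‖ ^ 2) : ℝ) : ℂ) *
        Complex.exp (((inner ℝ ξ w : ℝ) : ℂ) * Complex.I)
      = (((2 * √Real.pi / s) ^ Module.finrank ℝ V * Real.exp (-‖w‖ ^ 2 / s ^ 2) : ℝ) : ℂ) := by
  have h := GaussianFourier.integral_cexp_neg_mul_sq_norm_add (V := V) (b := ((s ^ 2 / 4 : ℝ) : ℂ))
    (by rw [Complex.ofReal_re]; positivity) Complex.I w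
  have e1 : ∀ ξ : V, ((Real.exp (-(s ^ 2 / 4) * ‖ξ‖ ^ 2) : ℝ) : ℂ) *
      Complex.exp (((inner ℝ ξ w : ℝ) : ℂ) * Complex.I)
      = Complex.exp (-((s ^ 2 / 4 : ℝ) : ℂ) * ‖ξ‖ ^ 2 + Complex.I * ((inner ℝ w ξ : ℝ) : ℂ)) := by
    intro ξ
    rw [Complex.ofReal_exp, ← Complex.exp_add, real_inner_comm]
    congr 1
    push_cast
    ring
  simp_rw [e1]
  rw [h]
  have e2 : ((Real.pi : ℂ) / ((s ^ 2 / 4 : ℝ) : ℂ)) = (((2 * √Real.pi / s) ^ 2 : ℝ) : ℂ) := by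
    rw [div_pow, mul_pow, Real.sq_sqrt Real.pi_pos.le]
    push_cast
    field_simp
    norm_num
  have hpos : 0 ≤ 2 * √Real.pi / s := by positivity
  have e3 : ((Real.pi : ℂ) / ((s ^ 2 / 4 : ℝ) : ℂ)) ^ ((Module.finrank ℝ V : ℂ) / 2)
      = (((2 * √Real.pi / s) ^ Module.finrank ℝ V : ℝ) : ℂ) := by
    rw [e2, show ((Module.finrank ℝ V : ℂ) / 2) = (((Module.finrank ℝ V : ℝ) / 2 : ℝ) : ℂ) by
      push_cast; ring, ← Complex.ofReal_cpow (by positivity), ← Real.rpow_natCast,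
      ← Real.rpow_mul hpos]
    congr 1
    rw [← Real.rpow_natCast]
    congr 1
    push_cast
    ring
  rw [e3, Complex.I_sq]
  push_cast
  congr 2
  have : (s : ℂ) ≠ 0 := by exact_mod_cast hs.ne'
  field_simp

lemma integrable_exp_neg_mul_norm_sq {b : ℝ} (hb : 0 < b) :
    Integrable fun ξ : V => Real.exp (-b * ‖ξ‖ ^ 2) := by
  have h := (GaussianFourier.integrable_cexp_neg_mul_sq_norm_add (V := V) (b := (b : ℂ))
    (by simpa using hb) 0 0).norm
  refine h.congr (ae_of_all _ fun ξ => ?_)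
  simp only [inner_zero_left, Complex.norm_exp]
  congr 1
  norm_cast
  simp

variable {Ω : Type*} [MeasurableSpace Ω] [TopologicalSpace Ω] [OpensMeasurableSpace Ω]

/-- If `Y` solves the random linear equation `L Y = C` and the weighted characteristic functions
`E[|det L| exp (i ⟪ξ, C - L B⟫)]` are bounded by an integrable function of `ξ`, then `Y` has a
continuous density: at `B` it is the density of `C - L B` at `0`, weighted by `|det L|`, which
Fourier inversion expresses through these characteristic functions. -/
theorem exists_continuous_density_of_linear_equation (ν : Measure Ω) [IsProbabilityMeasure ν]
    (C : Ω → V) (L : Ω → V →L[ℝ] V) (hC : Continuous C) (hL : Continuous L)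
    (D : Ω → ℝ) (hDc : Continuous D) (hD : ∀ ω, D ω = |(L ω).det|)
    (hdet : ∀ᵐ ω ∂ν, (L ω).det ≠ 0) (hint : Integrable D ν)
    (h : V → ℝ) (hh : Integrable h)
    (hbound : ∀ B ξ : V, ‖∫ ω, ((D ω : ℝ) : ℂ) *
      Complex.exp (((inner ℝ ξ (C ω - L ω B) : ℝ) : ℂ) * Complex.I) ∂ν‖ ≤ h ξ)
    (Y : Ω → V) (hYm : AEMeasurable Y ν) (hY : ∀ᵐ ω ∂ν, L ω (Y ω) = C ω) :
    ∃ p : V → ℝ, Continuous p ∧ (∀ x, 0 ≤ p x) ∧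
      HasLaw Y (volume.withDensity fun x => ENNReal.ofReal (p x)) ν := by
  set d := Module.finrank ℝ V with hd
  have hD0 : ∀ ω, 0 ≤ D ω := fun ω => (hD ω).symm ▸ abs_nonneg _
  set Φ : V → V → ℂ := fun B ξ => ∫ ω, ((D ω : ℝ) : ℂ) *
      Complex.exp (((inner ℝ ξ (C ω - L ω B) : ℝ) : ℂ) * Complex.I) ∂ν with hΦ
  have hΦc : Continuous (Function.uncurry Φ) := by
    refine continuous_of_dominated (bound := D)
      (fun x => Continuous.aestronglyMeasurable (by fun_prop)) (fun x => ae_of_all _ fun ω => ?_)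
      hint (ae_of_all _ fun ω => by fun_prop)
    rw [norm_mul, Complex.norm_exp_ofReal_mul_I, mul_one, Complex.norm_real, Real.norm_eq_abs,
      abs_of_nonneg (hD0 ω)]
  have hΦ1 : ∀ B, Continuous (Φ B) := fun B => hΦc.comp (by fun_prop : Continuous fun ξ => (B, ξ))
  have hΦ2 : ∀ ξ, Continuous fun B => Φ B ξ :=
    fun ξ => hΦc.comp (by fun_prop : Continuous fun B => (B, ξ))
  set P : V → ℂ := fun B => ∫ ξ, Φ B ξ with hP
  have hPc : Continuous P :=
    continuous_of_dominated (fun B => (hΦ1 B).aestronglyMeasurable)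
      (fun B => ae_of_all _ fun ξ => hbound B ξ) hh (ae_of_all _ fun ξ => hΦ2 ξ)
  -- the mollified density
  set r : ℝ → V → ℝ := fun s B => ∫ ω, D ω *
    ((2 * √Real.pi / s) ^ d * Real.exp (-‖C ω - L ω B‖ ^ 2 / s ^ 2)) ∂ν with hr
  have hr1 : ∀ s, 0 < s → ∀ B, ((r s B : ℝ) : ℂ)
      = ∫ ξ, ((Real.exp (-(s ^ 2 / 4) * ‖ξ‖ ^ 2) : ℝ) : ℂ) * Φ B ξ := by
    intro s hs B
    have hg : Integrable fun ξ : V => Real.exp (-(s ^ 2 / 4) * ‖ξ‖ ^ 2) :=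
      integrable_exp_neg_mul_norm_sq (by positivity)
    have hpi : Integrable (Function.uncurry fun (ω : Ω) (ξ : V) =>
        ((Real.exp (-(s ^ 2 / 4) * ‖ξ‖ ^ 2) : ℝ) : ℂ) * (((D ω : ℝ) : ℂ) *
        Complex.exp (((inner ℝ ξ (C ω - L ω B) : ℝ) : ℂ) * Complex.I))) (ν.prod volume) := by
      refine (hint.mul_prod hg).mono'
        (Continuous.aestronglyMeasurable (by simp only [Function.uncurry_def]; fun_prop))
        (ae_of_all _ fun q => ?_)
      simp only [Function.uncurry_def, norm_mul, Complex.norm_exp_ofReal_mul_I, mul_one,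
        Complex.norm_real, Real.norm_eq_abs, Real.abs_exp, abs_of_nonneg (hD0 _)]
      rw [mul_comm]
    simp_rw [hΦ, ← integral_const_mul]
    rw [← integral_integral_swap hpi, ← integral_complex_ofReal]
    congr 1
    ext ω
    rw [Complex.ofReal_mul, ← integral_exp_neg_mul_cexp_inner s hs, ← integral_const_mul]
    congr 1
    ext ξ
    ring
  have hr0 : ∀ s, 0 < s → ∀ B, 0 ≤ r s B := by
    intro s hs B
    exact integral_nonneg fun ω => mul_nonneg (hD0 ω) (by positivity)
  have hrb : ∀ s, 0 < s → ∀ B, ‖r s B‖ ≤ ∫ ξ, h ξ := by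
    intro s hs B
    rw [← Complex.norm_real, hr1 s hs B]
    refine norm_integral_le_of_norm_le hh (ae_of_all _ fun ξ => ?_)
    rw [norm_mul, Complex.norm_real, Real.norm_eq_abs, Real.abs_exp]
    refine (mul_le_of_le_one_left (norm_nonneg _) (Real.exp_le_one_iff.2 ?_)).trans (hbound B ξ)
    have : 0 ≤ s ^ 2 / 4 * ‖ξ‖ ^ 2 := by positivity
    linarith
  have hrlim : ∀ B, Tendsto (fun s => r s B) (𝓝[>] 0) (𝓝 (P B).re) := by
    intro B
    have h1 : Tendsto (fun s => ∫ ξ, ((Real.exp (-(s ^ 2 / 4) * ‖ξ‖ ^ 2) : ℝ) : ℂ) * Φ B ξ)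
        (𝓝[>] 0) (𝓝 (∫ ξ, Φ B ξ)) := by
      refine tendsto_integral_filter_of_dominated_convergence h
        (Eventually.of_forall fun s => Continuous.aestronglyMeasurable (by fun_prop))
        (Eventually.of_forall fun s => ae_of_all _ fun ξ => ?_) hh (ae_of_all _ fun ξ => ?_)
      · rw [norm_mul, Complex.norm_real, Real.norm_eq_abs, Real.abs_exp]
        refine (mul_le_of_le_one_left (norm_nonneg _) (Real.exp_le_one_iff.2 ?_)).trans
          (hbound B ξ)
        have : 0 ≤ s ^ 2 / 4 * ‖ξ‖ ^ 2 := by positivity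
        linarith
      · have hc : Continuous fun s : ℝ => ((Real.exp (-(s ^ 2 / 4) * ‖ξ‖ ^ 2) : ℝ) : ℂ) * Φ B ξ := by
          fun_prop
        have := (hc.tendsto 0).mono_left (nhdsWithin_le_nhds (s := Set.Ioi 0))
        simpa using this
    have h2 := (Complex.continuous_re.tendsto _).comp h1
    refine h2.congr' ?_
    filter_upwards [self_mem_nhdsWithin] with s hs
    rw [Function.comp_apply, ← hr1 s hs B, Complex.ofReal_re]
  have hP0 : ∀ B, 0 ≤ (P B).re := fun B => ge_of_tendsto (hrlim B)
    (by filter_upwards [self_mem_nhdsWithin] with s hs using hr0 s hs B)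
  -- the mollified density, tested against a function and conditioned on `ω`
  set F : (V → ℝ) → ℝ → Ω → ℝ := fun φ s ω => ∫ B, φ B * (D ω *
        ((2 * √Real.pi / s) ^ d * Real.exp (-‖C ω - L ω B‖ ^ 2 / s ^ 2))) with hF
  have hfub : ∀ φ : V → ℝ, Continuous φ → HasCompactSupport φ → ∀ s, 0 < s →
      AEStronglyMeasurable (F φ s) ν ∧ ∫ B, φ B * r s B = ∫ ω, F φ s ω ∂ν := by
    intro φ hφ hφs s hs
    obtain ⟨K, hK⟩ := hφs.exists_bound_of_continuous hφ
    have hφi : Integrable φ := hφ.integrable_of_hasCompactSupport hφs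
    have hpi : Integrable (Function.uncurry fun (ω : Ω) (B : V) => φ B * (D ω *
        ((2 * √Real.pi / s) ^ d * Real.exp (-‖C ω - L ω B‖ ^ 2 / s ^ 2)))) (ν.prod volume) := by
      refine ((hint.mul_prod hφi.norm).const_mul ((2 * √Real.pi / s) ^ d)).mono'
        (Continuous.aestronglyMeasurable (by simp only [Function.uncurry_def]; fun_prop))
        (ae_of_all _ fun q => ?_)
      have hle : Real.exp (-‖C q.1 - L q.1 q.2‖ ^ 2 / s ^ 2) ≤ 1 := by
        refine Real.exp_le_one_iff.2 ?_
        rw [neg_div, neg_nonpos]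
        positivity
      simp only [Function.uncurry_def, norm_mul, Real.norm_eq_abs, abs_of_nonneg (hD0 _), Real.abs_exp]
      rw [abs_of_nonneg (by positivity : (0 : ℝ) ≤ (2 * √Real.pi / s) ^ d)]
      calc |φ q.2| * (D q.1 * ((2 * √Real.pi / s) ^ d *
            Real.exp (-‖C q.1 - L q.1 q.2‖ ^ 2 / s ^ 2)))
          = ((2 * √Real.pi / s) ^ d * (D q.1 * |φ q.2|)) *
            Real.exp (-‖C q.1 - L q.1 q.2‖ ^ 2 / s ^ 2) := by ring
        _ ≤ _ := mul_le_of_le_one_right (mul_nonneg (by positivity)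
            (mul_nonneg (hD0 _) (abs_nonneg _))) hle
    refine ⟨hpi.integral_prod_left.aestronglyMeasurable, ?_⟩
    simp_rw [hr, ← integral_const_mul]
    rw [← integral_integral_swap hpi]
  have hFeq : ∀ (φ : V → ℝ) (ω : Ω), (L ω).det ≠ 0 → L ω (Y ω) = C ω → ∀ s, 0 < s →
      F φ s ω = (2 * √Real.pi) ^ d *
        (∫ z, φ (Y ω - s • ((L ω).inverse z)) * Real.exp (-‖z‖ ^ 2)) := by
    intro φ ω hω hYω s hs
    -- substitute `B = Y - s L⁻¹ z`
    set e := (L ω).toContinuousLinearEquivOfDetNeZero hω with he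
    have hLe : L ω = (e : V →L[ℝ] V) := rfl
    have hinv : ∀ z, (L ω).inverse z = e.symm z := by
      intro z
      rw [hLe, ContinuousLinearMap.inverse_equiv]
      rfl
    have hsd : (s⁻¹ • L ω).det = (s⁻¹) ^ d * (L ω).det := by
      change LinearMap.det (s⁻¹ • (L ω : V →ₗ[ℝ] V)) = _
      rw [LinearMap.det_smul]
    have hcv := integral_abs_det_mul_comp (s⁻¹ • L ω) (by rw [hsd]; positivity)
      fun z => φ (Y ω - s • ((L ω).inverse z)) * Real.exp (-‖z‖ ^ 2)
    simp only [hF]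
    rw [← hcv, ← integral_sub_left_eq_self _ volume (Y ω),
      ← integral_const_mul]
    congr 1
    ext B
    have e1 : (L ω).inverse ((s⁻¹ • L ω) B) = s⁻¹ • B := by
      rw [hinv]
      change e.symm (s⁻¹ • e B) = _
      rw [map_smul, e.symm_apply_apply]
    have e2 : C ω - L ω (Y ω - B) = L ω B := by rw [map_sub, hYω]; abel
    have e3 : ‖(s⁻¹ • L ω) B‖ ^ 2 = ‖L ω B‖ ^ 2 / s ^ 2 := by
      change ‖s⁻¹ • L ω B‖ ^ 2 = _
      rw [norm_smul, mul_pow, norm_inv, Real.norm_eq_abs, inv_pow, sq_abs]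
      field_simp
    rw [e1, e2, e3, smul_smul, mul_inv_cancel₀ hs.ne', one_smul, hD, hsd, abs_mul, abs_of_nonneg
      (by positivity : (0 : ℝ) ≤ s⁻¹ ^ d), div_pow, inv_pow, neg_div]
    field_simp
  have hmain : ∀ φ : V → ℝ, Continuous φ → HasCompactSupport φ →
      (2 * Real.pi) ^ d * ∫ ω, φ (Y ω) ∂ν = ∫ B, φ B * (P B).re := by
    intro φ hφ hφs
    obtain ⟨K, hK⟩ := hφs.exists_bound_of_continuous hφ
    have hφi : Integrable φ := hφ.integrable_of_hasCompactSupport hφs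
    have hge : Integrable fun z : V => Real.exp (-‖z‖ ^ 2) := by
      simpa using integrable_exp_neg_mul_norm_sq (V := V) one_pos
    have hgi : ∫ z : V, Real.exp (-‖z‖ ^ 2) = √Real.pi ^ d := by
      have := GaussianFourier.integral_rexp_neg_mul_sq_norm (V := V) one_pos
      simp only [neg_mul, one_mul, div_one] at this
      rw [this, Real.sqrt_eq_rpow, ← Real.rpow_natCast, ← Real.rpow_mul Real.pi_pos.le]
      congr 1
      ring
    have h1 : Tendsto (fun s => ∫ B, φ B * r s B) (𝓝[>] 0) (𝓝 (∫ B, φ B * (P B).re)) := by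
      refine tendsto_integral_filter_of_dominated_convergence (fun B => |φ B| * ∫ ξ, h ξ) ?_ ?_
        (hφi.abs.mul_const _) (ae_of_all _ fun B => (hrlim B).const_mul _)
      · filter_upwards [self_mem_nhdsWithin] with s hs
        refine hφ.aestronglyMeasurable.mul (Continuous.aestronglyMeasurable ?_)
        have : r s = fun B => (∫ ξ, ((Real.exp (-(s ^ 2 / 4) * ‖ξ‖ ^ 2) : ℝ) : ℂ) * Φ B ξ).re := by
          ext B
          rw [← hr1 s hs, Complex.ofReal_re]
        rw [this]
        refine Complex.continuous_re.comp (continuous_of_dominated (bound := h)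
          (fun B => Continuous.aestronglyMeasurable (by fun_prop))
          (fun B => ae_of_all _ fun ξ => ?_) hh (ae_of_all _ fun ξ => by fun_prop))
        rw [norm_mul, Complex.norm_real, Real.norm_eq_abs, Real.abs_exp]
        refine (mul_le_of_le_one_left (norm_nonneg _) (Real.exp_le_one_iff.2 ?_)).trans
          (hbound B ξ)
        have : 0 ≤ s ^ 2 / 4 * ‖ξ‖ ^ 2 := by positivity
        linarith
      · filter_upwards [self_mem_nhdsWithin] with s hs
        refine ae_of_all _ fun B => ?_
        rw [norm_mul, Real.norm_eq_abs]
        exact mul_le_mul_of_nonneg_left (hrb s hs B) (abs_nonneg _)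
    have hsmall : ∀ (ω : Ω) (s : ℝ) (z : V), ‖φ (Y ω - s • ((L ω).inverse z)) * Real.exp (-‖z‖ ^ 2)‖
        ≤ K * Real.exp (-‖z‖ ^ 2) := by
      intro ω s z
      rw [norm_mul, Real.norm_eq_abs (Real.exp _), Real.abs_exp]
      exact mul_le_mul_of_nonneg_right (hK _) (Real.exp_pos _).le
    have h2 : Tendsto (fun s : ℝ => ∫ ω, F φ s ω ∂ν) (𝓝[>] 0)
        (𝓝 (∫ ω, (2 * √Real.pi) ^ d * (∫ z : V, φ (Y ω) * Real.exp (-‖z‖ ^ 2)) ∂ν)) := by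
      refine tendsto_integral_filter_of_dominated_convergence
        (fun _ => (2 * √Real.pi) ^ d * ∫ z : V, K * Real.exp (-‖z‖ ^ 2)) ?_ ?_
        (integrable_const _) ?_
      · filter_upwards [self_mem_nhdsWithin] with s hs using (hfub φ hφ hφs s hs).1
      · filter_upwards [self_mem_nhdsWithin] with s hs
        filter_upwards [hdet, hY] with ω hω hYω
        rw [hFeq φ ω hω hYω s hs, norm_mul, Real.norm_of_nonneg (by positivity)]
        refine mul_le_mul_of_nonneg_left ?_ (by positivity)
        exact norm_integral_le_of_norm_le (hge.const_mul K) (ae_of_all _ (hsmall ω s))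
      · filter_upwards [hdet, hY] with ω hω hYω
        have h4 : Tendsto (fun s : ℝ => (2 * √Real.pi) ^ d *
            (∫ z, φ (Y ω - s • ((L ω).inverse z)) * Real.exp (-‖z‖ ^ 2))) (𝓝[>] 0)
            (𝓝 ((2 * √Real.pi) ^ d * (∫ z : V, φ (Y ω) * Real.exp (-‖z‖ ^ 2)))) := by
          refine Tendsto.const_mul _ ?_
          refine tendsto_integral_filter_of_dominated_convergence _
            (Eventually.of_forall fun s => Continuous.aestronglyMeasurable (by fun_prop))
            (Eventually.of_forall fun s => ae_of_all _ (hsmall ω s)) (hge.const_mul K)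
            (ae_of_all _ fun z => ?_)
          have hc : Continuous fun s : ℝ =>
            φ (Y ω - s • ((L ω).inverse z)) * Real.exp (-‖z‖ ^ 2) := by fun_prop
          have := (hc.tendsto 0).mono_left (nhdsWithin_le_nhds (s := Set.Ioi 0))
          simpa using this
        refine h4.congr' ?_
        filter_upwards [self_mem_nhdsWithin] with s hs using (hFeq φ ω hω hYω s hs).symm
    have h3 := h1.congr' (f₂ := fun s : ℝ => ∫ ω, F φ s ω ∂ν) (by
      filter_upwards [self_mem_nhdsWithin] with s hs using (hfub φ hφ hφs s hs).2)
    rw [tendsto_nhds_unique h3 h2, integral_const_mul (μ := ν)]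
    simp_rw [integral_const_mul, hgi]
    rw [integral_mul_const, mul_comm (∫ ω, φ (Y ω) ∂ν), ← mul_assoc, ← mul_pow]
    congr 2
    rw [mul_assoc, Real.mul_self_sqrt Real.pi_pos.le]
  refine ⟨fun B => ((2 * Real.pi) ^ d)⁻¹ * (P B).re, by fun_prop,
    fun B => mul_nonneg (by positivity) (hP0 B), hYm, ?_⟩
  set p : V → ℝ := fun B => ((2 * Real.pi) ^ d)⁻¹ * (P B).re with hp
  have hpc : Continuous p := by fun_prop
  have hp0 : ∀ B, 0 ≤ p B := fun B => mul_nonneg (by positivity) (hP0 B)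
  have : IsLocallyFiniteMeasure (volume.withDensity fun x : V => ENNReal.ofReal (p x)) :=
    IsLocallyFiniteMeasure.withDensity_ofReal hpc
  refine Measure.ext_of_integral_eq_on_compactlySupported fun φ => ?_
  rw [integral_map (f := fun x => φ x) hYm (φ.continuous.aestronglyMeasurable),
    integral_withDensity_eq_integral_toReal_smul (by fun_prop) (ae_of_all _ fun _ => by simp)]
  have := hmain φ φ.continuous φ.hasCompactSupport
  have hne : (2 * Real.pi) ^ d ≠ 0 := by positivity
  rw [← mul_right_inj' hne, this, ← integral_const_mul]
  congr 1
  ext B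
  rw [ENNReal.toReal_ofReal (hp0 B), hp, smul_eq_mul]
  field_simp

end RandomLinearEquation

/-! ### Oscillatory integrals over independent blocks -/

section Blocks

variable {E : Type*} [MeasurableSpace E] {n : ℕ} (g : Measure E) [IsProbabilityMeasure g]

/-- Resampling the coordinates in `G` of a product measure leaves it invariant. -/
lemma measurePreserving_piecewise (G : Finset (Fin n)) :
    MeasurePreserving (fun p : (Fin n → E) × (Fin n → E) => G.piecewise p.1 p.2)
      ((Measure.pi fun _ : Fin n => g).prod (Measure.pi fun _ : Fin n => g))
      (Measure.pi fun _ : Fin n => g) := by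
  have hm : Measurable fun p : (Fin n → E) × (Fin n → E) => G.piecewise p.1 p.2 := by
    refine measurable_pi_lambda _ fun j => ?_
    by_cases hj : j ∈ G
    · simp only [Finset.piecewise_eq_of_mem _ _ _ hj]; fun_prop
    · simp only [Finset.piecewise_eq_of_notMem _ _ _ hj]; fun_prop
  refine ⟨hm, (Measure.pi_eq fun s hs => ?_).symm⟩
  rw [Measure.map_apply hm (MeasurableSet.univ_pi hs)]
  have hset : (fun p : (Fin n → E) × (Fin n → E) => G.piecewise p.1 p.2) ⁻¹' Set.univ.pi s
      = (Set.univ.pi fun j => if j ∈ G then s j else Set.univ) ×ˢ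
        (Set.univ.pi fun j => if j ∈ G then Set.univ else s j) := by
    ext p
    simp only [Set.mem_preimage, Set.mem_pi, Set.mem_univ, forall_const, Set.mem_prod,
      ← forall_and]
    refine forall_congr' fun j => ?_
    by_cases hj : j ∈ G <;> simp [hj]
  rw [hset, Measure.prod_prod, Measure.pi_pi, Measure.pi_pi, ← Finset.prod_mul_distrib]
  refine Finset.prod_congr rfl fun j _ => ?_
  by_cases hj : j ∈ G <;> simp [hj]

/-- Integrating out the coordinates in `G`, on which the weight `W` does not depend. -/
lemma norm_integral_mul_prod_le (G : Finset (Fin n)) (W : (Fin n → E) → ℝ)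
    (hW : ∀ α α' : Fin n → E, W (G.piecewise α' α) = W α)
    (hWi : Integrable W (Measure.pi fun _ : Fin n => g)) (f : Fin n → E → ℂ)
    (hf : ∀ j, Measurable (f j)) (hf1 : ∀ j x, ‖f j x‖ ≤ 1) :
    ‖∫ α, (W α : ℂ) * ∏ j, f j (α j) ∂(Measure.pi fun _ : Fin n => g)‖
      ≤ ∫ α, |W α| * ∏ j ∈ G, ‖∫ x, f j x ∂g‖ ∂(Measure.pi fun _ : Fin n => g) := by
  set π := Measure.pi fun _ : Fin n => g
  have hpn : ∀ α : Fin n → E, ‖∏ j, f j (α j)‖ ≤ 1 := fun α => by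
    rw [norm_prod]
    exact Finset.prod_le_one (fun _ _ => norm_nonneg _) fun j _ => hf1 j _
  have hFi : Integrable (fun α => (W α : ℂ) * ∏ j, f j (α j)) π := by
    refine (hWi.norm).mono' ((hWi.ofReal (𝕜 := ℂ)).aestronglyMeasurable.mul
      (Measurable.aestronglyMeasurable (by fun_prop))) (ae_of_all _ fun α => ?_)
    rw [norm_mul, Complex.norm_real]
    exact mul_le_of_le_one_right (norm_nonneg _) (hpn α)
  have hmp := measurePreserving_piecewise (n := n) g G
  have hFi2 := (hmp.integrable_comp hFi.aestronglyMeasurable).2 hFi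
  have h1 : ∫ α, (W α : ℂ) * ∏ j, f j (α j) ∂π = ∫ α, ∫ α', (W α : ℂ) *
      ((∏ j, if j ∈ G then 1 else f j (α j)) * ∏ j, if j ∈ G then f j (α' j) else 1) ∂π ∂π := by
    conv_lhs => rw [show π = (π.prod π).map (fun p => G.piecewise p.1 p.2) from hmp.map_eq.symm]
    rw [integral_map hmp.measurable.aemeasurable (by rw [hmp.map_eq]; exact hFi.aestronglyMeasurable)]
    refine (integral_prod_symm _ hFi2).trans ?_
    congr 1; ext α; congr 1; ext α'
    simp only [Function.comp_apply, hW, ← Finset.prod_mul_distrib]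
    congr 1
    refine Finset.prod_congr rfl fun j _ => ?_
    by_cases hj : j ∈ G <;> simp [hj]
  have h2 : ∀ α : Fin n → E, ∫ α', (W α : ℂ) *
      ((∏ j, if j ∈ G then 1 else f j (α j)) * ∏ j, if j ∈ G then f j (α' j) else 1) ∂π
      = (W α : ℂ) * ((∏ j, if j ∈ G then 1 else f j (α j)) * ∏ j ∈ G, ∫ x, f j x ∂g) := by
    intro α
    rw [integral_const_mul, integral_const_mul,
      integral_fintype_prod_eq_prod (fun j x => if j ∈ G then f j x else 1)]
    congr 2
    rw [← Finset.prod_subset (Finset.subset_univ G)]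
    · refine Finset.prod_congr rfl fun j hj => by simp [hj]
    · intro j _ hj
      simp [hj]
  rw [h1]
  simp_rw [h2]
  refine norm_integral_le_of_norm_le (hWi.abs.mul_const _) (ae_of_all _ fun α => ?_)
  rw [norm_mul, norm_mul, Complex.norm_real, Real.norm_eq_abs, norm_prod (s := G)]
  refine mul_le_mul_of_nonneg_left (mul_le_of_le_one_left (by positivity) ?_) (abs_nonneg _)
  rw [norm_prod]
  refine Finset.prod_le_one (fun _ _ => norm_nonneg _) fun j _ => ?_
  by_cases hj : j ∈ G <;> simp [hj, hf1]

open scoped ENNReal in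
/-- A product of adapted factors, each of conditional mean at most `κ`, has mean at most `κ` to the
number of factors. -/
lemma lintegral_prod_adapted_le (G : Finset (Fin n)) (f : Fin n → (Fin n → E) → ℝ≥0∞)
    (hf : ∀ j, Measurable (f j)) (κ : ℝ≥0∞)
    (hdep : ∀ j i, j < i → ∀ β y, f j (Function.update β i y) = f j β)
    (hκ : ∀ j ∈ G, ∀ β, ∫⁻ y, f j (Function.update β j y) ∂g ≤ κ) :
    ∫⁻ β, ∏ j ∈ G, f j β ∂(Measure.pi fun _ : Fin n => g) ≤ κ ^ G.card := by
  have key : ∀ β, lmarginal (fun _ => g) G (fun β => ∏ j ∈ G, f j β) β ≤ κ ^ G.card := by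
    induction G using Finset.induction_on_max with
    | empty => intro β; simp
    | insert i s hi ih =>
      intro β
      have his : i ∉ s := fun h => lt_irrefl _ (hi i h)
      rw [lmarginal_insert' _ (by fun_prop) his, Finset.card_insert_of_notMem his, pow_succ']
      have h1 : (fun β => ∫⁻ y, ∏ j ∈ insert i s, f j (Function.update β i y) ∂g)
          ≤ fun β => κ * ∏ j ∈ s, f j β := by
        intro β
        simp only
        have : ∀ y, ∏ j ∈ insert i s, f j (Function.update β i y)
            = f i (Function.update β i y) * ∏ j ∈ s, f j β := by
          intro y
          rw [Finset.prod_insert his]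
          congr 1
          exact Finset.prod_congr rfl fun j hj => hdep j i (hi j hj) β y
        simp_rw [this]
        rw [lintegral_mul_const _ (by fun_prop)]
        gcongr
        exact hκ i (Finset.mem_insert_self _ _) β
      refine (lmarginal_mono h1 β).trans ?_
      have h2 : lmarginal (fun _ => g) s (fun β => κ * ∏ j ∈ s, f j β) β
          = κ * lmarginal (fun _ => g) s (fun β => ∏ j ∈ s, f j β) β := by
        unfold lmarginal
        rw [lintegral_const_mul]
        exact (Finset.measurable_prod s fun j _ => hf j).comp measurable_updateFinset
      rw [h2]
      gcongr
      exact ih (fun j hj => hκ j (Finset.mem_insert_of_mem hj)) β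
  have := lintegral_le_of_lmarginal_le (μ := fun _ : Fin n => g) G
    (f := fun β => ∏ j ∈ G, f j β) (g := fun _ => κ ^ G.card) (by fun_prop) (by fun_prop)
    (fun β => (key β).trans (by simp [lmarginal]))
  simpa using this

/-- A weighted oscillatory integral, whose phase is a sum over blocks `j` of terms in a variable
`α j` of the block alone and in the variables `β i`, `i ≤ j`, decays like the product of the mean
squares of the oscillatory integrals over the single `α j`, as long as the weight does not depend on
these variables. -/
lemma norm_integral_block_le (G : Finset (Fin n)) (W : (Fin n → E) × (Fin n → E) → ℝ)
    (hWm : Measurable W)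
    (hW2 : Integrable (fun q => W q ^ 2)
      ((Measure.pi fun _ : Fin n => g).prod (Measure.pi fun _ : Fin n => g)))
    (hW : ∀ α α' β : Fin n → E, W (G.piecewise α' α, β) = W (α, β))
    (P : Fin n → E → (Fin n → E) → ℝ) (hP : ∀ j, Measurable (Function.uncurry (P j)))
    (hdep : ∀ j i, j < i → ∀ x β y, P j x (Function.update β i y) = P j x β) (κ : ℝ) (hκ0 : 0 ≤ κ)
    (hκ : ∀ j ∈ G, ∀ β, ∫ y, ‖∫ x, Complex.exp ((P j x (Function.update β j y) : ℂ) * Complex.I) ∂g‖ ^ 2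
      ∂g ≤ κ) :
    ‖∫ q, (W q : ℂ) * Complex.exp (((∑ j, P j (q.1 j) q.2 : ℝ) : ℂ) * Complex.I)
      ∂((Measure.pi fun _ : Fin n => g).prod (Measure.pi fun _ : Fin n => g))‖
      ≤ √(∫ q, W q ^ 2 ∂((Measure.pi fun _ : Fin n => g).prod (Measure.pi fun _ : Fin n => g)))
        * √(κ ^ G.card) := by
  set π := Measure.pi fun _ : Fin n => g with hπ
  have hWL : MemLp W 2 (π.prod π) := (memLp_two_iff_integrable_sq hWm.aestronglyMeasurable).2 hW2
  have hWi : Integrable W (π.prod π) := hWL.integrable (by norm_num)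
  set φ : Fin n → (Fin n → E) → ℂ := fun j β => ∫ x, Complex.exp ((P j x β : ℂ) * Complex.I) ∂g
    with hφ
  have hφm : ∀ j, Measurable (φ j) := by
    intro j
    refine StronglyMeasurable.measurable (StronglyMeasurable.integral_prod_left'
      (f := fun p : E × (Fin n → E) => Complex.exp ((P j p.1 p.2 : ℂ) * Complex.I)) ?_)
    refine Measurable.stronglyMeasurable ?_
    have := hP j
    simp only [Function.uncurry_def] at this
    fun_prop
  have hφ1 : ∀ j β, ‖φ j β‖ ≤ 1 := fun j β =>
    (norm_integral_le_of_norm_le_const (C := 1) (ae_of_all _ fun x => by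
      rw [Complex.norm_exp_ofReal_mul_I])).trans (by simp)
  set Q : (Fin n → E) → ℝ := fun β => ∏ j ∈ G, ‖φ j β‖ with hQ
  have hQm : Measurable Q := by fun_prop
  have hQ0 : ∀ β, 0 ≤ Q β := fun β => by positivity
  have hQ1 : ∀ β, Q β ≤ 1 := fun β => Finset.prod_le_one (fun _ _ => norm_nonneg _) fun j _ => hφ1 j β
  have hQL : MemLp (fun q : (Fin n → E) × (Fin n → E) => Q q.2) 2 (π.prod π) :=
    MemLp.of_bound (hQm.comp measurable_snd).aestronglyMeasurable 1 (ae_of_all _ fun q => by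
      rw [Real.norm_of_nonneg (hQ0 _)]; exact hQ1 _)
  have hprod : ∀ q : (Fin n → E) × (Fin n → E),
      Complex.exp (((∑ j, P j (q.1 j) q.2 : ℝ) : ℂ) * Complex.I)
        = ∏ j, Complex.exp ((P j (q.1 j) q.2 : ℂ) * Complex.I) := by
    intro q
    rw [← Complex.exp_sum, Complex.ofReal_sum, Finset.sum_mul]
  have hPm : ∀ j, Measurable fun q : (Fin n → E) × (Fin n → E) => P j (q.1 j) q.2 := fun j =>
    (hP j).comp (by fun_prop : Measurable fun q : (Fin n → E) × (Fin n → E) => (q.1 j, q.2))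
  have hFi : Integrable (fun q => (W q : ℂ) *
      Complex.exp (((∑ j, P j (q.1 j) q.2 : ℝ) : ℂ) * Complex.I)) (π.prod π) := by
    refine hWi.norm.mono' (Measurable.aestronglyMeasurable (by fun_prop))
      (ae_of_all _ fun q => ?_)
    rw [norm_mul, Complex.norm_exp_ofReal_mul_I, mul_one, Complex.norm_real]
  have hWQi : Integrable (fun q : (Fin n → E) × (Fin n → E) => |W q| * Q q.2) (π.prod π) := by
    refine hWi.norm.mono' (Measurable.aestronglyMeasurable (by fun_prop))
      (ae_of_all _ fun q => ?_)
    rw [norm_mul, Real.norm_of_nonneg (hQ0 _), Real.norm_eq_abs, abs_abs]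
    exact mul_le_of_le_one_right (abs_nonneg _) (hQ1 _)
  -- integrate out the `α j` with `j ∈ G`
  have step1 : ‖∫ q, (W q : ℂ) * Complex.exp (((∑ j, P j (q.1 j) q.2 : ℝ) : ℂ) * Complex.I)
      ∂(π.prod π)‖ ≤ ∫ q, |W q| * Q q.2 ∂(π.prod π) := by
    rw [integral_prod_symm _ hFi, integral_prod_symm _ hWQi]
    refine norm_integral_le_of_norm_le hWQi.integral_prod_right ?_
    filter_upwards [hWi.prod_left_ae] with β hβ
    have hprod' : ∀ α : Fin n → E, Complex.exp (((∑ j, P j (α j) β : ℝ) : ℂ) * Complex.I)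
        = ∏ j, Complex.exp ((P j (α j) β : ℂ) * Complex.I) := fun α => hprod (α, β)
    simp only [hprod']
    exact norm_integral_mul_prod_le g G (fun α => W (α, β)) (fun α α' => hW α α' β) hβ
      (fun j x => Complex.exp ((P j x β : ℂ) * Complex.I))
      (fun j => by
        have := (hP j).comp (by fun_prop : Measurable fun x : E => (x, β))
        simp only [Function.comp_def, Function.uncurry_def] at this
        fun_prop)
      (fun j x => by rw [Complex.norm_exp_ofReal_mul_I])
  -- integrate out the `β j` with `j ∈ G`, the last one first
  have step2 : ∫ q, Q q.2 ^ 2 ∂(π.prod π) ≤ κ ^ G.card := by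
    have h1 : ∫ q, Q q.2 ^ 2 ∂(π.prod π) = ∫ β, Q β ^ 2 ∂π := by
      have := integral_fun_snd (μ := π) (ν := π) (fun β => Q β ^ 2)
      simpa using this
    rw [h1, integral_eq_lintegral_of_nonneg_ae (ae_of_all _ fun β => by positivity)
      (Measurable.aestronglyMeasurable (by fun_prop))]
    refine ENNReal.toReal_le_of_le_ofReal (by positivity) ?_
    have h2 := lintegral_prod_adapted_le g G (fun j β => ENNReal.ofReal (‖φ j β‖ ^ 2))
      (fun j => by fun_prop) (ENNReal.ofReal κ)
      (fun j i hij β y => by simp only [hφ, hdep j i hij]) (fun j hj β => ?_)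
    · rw [ENNReal.ofReal_pow hκ0]
      refine le_trans (le_of_eq ?_) h2
      congr 1
      ext β
      rw [← ENNReal.ofReal_prod_of_nonneg (fun _ _ => by positivity), Finset.prod_pow]
    · rw [← ofReal_integral_eq_lintegral_ofReal]
      · exact ENNReal.ofReal_le_ofReal (hκ j hj β)
      · refine Integrable.of_bound (C := 1) (Measurable.aestronglyMeasurable ?_)
          (ae_of_all _ fun y => ?_)
        · have := (hφm j).comp (measurable_update β (a := j))
          simp only [Function.comp_def] at this
          fun_prop
        · rw [Real.norm_of_nonneg (by positivity)]
          exact pow_le_one₀ (norm_nonneg _) (hφ1 _ _)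
      · exact ae_of_all _ fun y => by positivity
  refine step1.trans ?_
  have hH := integral_mul_le_Lp_mul_Lq_of_nonneg (μ := π.prod π) (p := 2) (q := 2)
    (Real.holderConjugate_iff.2 (by norm_num)) (f := fun q => |W q|) (g := fun q => Q q.2)
    (ae_of_all _ fun q => abs_nonneg _) (ae_of_all _ fun q => hQ0 _)
    (by simpa using hWL.norm) (by simpa using hQL)
  refine hH.trans ?_
  simp only [Real.rpow_ofNat, sq_abs, ← Real.sqrt_eq_rpow]
  gcongr

end Blocks

/-! ### Trajectories in rotated noise coordinates -/

/-- Extension of a finite sequence by zero. -/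
def extendZero {E : Type*} [NormedAddCommGroup E] {n : ℕ} (z : Fin n → E) (j : ℕ) : E :=
  if h : j < n then z ⟨j, h⟩ else 0

lemma extendZero_val {E : Type*} [NormedAddCommGroup E] {n : ℕ} (z : Fin n → E)
    (j : Fin n) : extendZero z j = z j := by
  simp [extendZero]

@[fun_prop]
lemma continuous_extendZero {E : Type*} [NormedAddCommGroup E] {n : ℕ} (j : ℕ) :
    Continuous fun z : Fin n → E => extendZero z j := by
  unfold extendZero
  split_ifs <;> fun_prop

section RotatedNoise

variable {E : Type*} [NormedAddCommGroup E] [InnerProductSpace ℝ E]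

/-- The trajectory `X₀ = 0`, `X_{t+1} = a X_t + η_{t+1}` of a scalar system. -/
noncomputable def scalarTraj (a : ℝ) (η : ℕ → E) : ℕ → E
  | 0 => 0
  | t + 1 => a • scalarTraj a η t + η (t + 1)

/-- Noise made from two sequences: the pair `(η_{2j+1}, η_{2j+2})` is the rotation of
`(α_j, β_j)` by the angle `arctan a`, for which the contributions of `α_j` to
`X_{2j+2} = a² X_{2j} + a η_{2j+1} + η_{2j+2}` cancel. -/
noncomputable def rotNoise (a : ℝ) (α β : ℕ → E) (t : ℕ) : E :=
  if t % 2 = 1 then (ContinuousLinearMap.rotation (Real.arctan a) (α (t / 2), β (t / 2))).1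
  else (ContinuousLinearMap.rotation (Real.arctan a) (α (t / 2 - 1), β (t / 2 - 1))).2

/-- The trajectory driven by `rotNoise` at the even times, where it only depends on `β`. -/
noncomputable def evenState (a : ℝ) (β : ℕ → E) : ℕ → E
  | 0 => 0
  | j + 1 => a ^ 2 • evenState a β j + (Real.cos (Real.arctan a))⁻¹ • β j

lemma sin_arctan_eq (a : ℝ) : Real.sin (Real.arctan a) = a * Real.cos (Real.arctan a) := by
  rw [← Real.tan_mul_cos (Real.cos_arctan_pos a).ne', Real.tan_arctan]

lemma cos_arctan_sq_mul (a : ℝ) : Real.cos (Real.arctan a) ^ 2 * (1 + a ^ 2) = 1 := by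
  rw [Real.cos_sq_arctan]
  have : 1 + a ^ 2 ≠ 0 := by positivity
  field_simp

lemma cos_arctan_inv (a : ℝ) :
    (Real.cos (Real.arctan a))⁻¹ = Real.cos (Real.arctan a) * (1 + a ^ 2) := by
  have h := (Real.cos_arctan_pos a).ne'
  rw [inv_eq_iff_eq_inv, eq_comm, inv_eq_iff_eq_inv, eq_comm, inv_eq_of_mul_eq_one_right]
  linear_combination cos_arctan_sq_mul a

lemma scalarTraj_rotNoise_even (a : ℝ) (α β : ℕ → E) (j : ℕ) :
    scalarTraj a (rotNoise a α β) (2 * j) = evenState a β j := by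
  induction j with
  | zero => rfl
  | succ j ih =>
    rw [show 2 * (j + 1) = 2 * j + 1 + 1 by ring, scalarTraj, scalarTraj, ih, evenState, rotNoise,
      rotNoise, if_pos (by omega), if_neg (by omega), show (2 * j + 1) / 2 = j by omega,
      show (2 * j + 1 + 1) / 2 - 1 = j by omega]
    simp only [ContinuousLinearMap.rotation_apply, sin_arctan_eq, cos_arctan_inv]
    module

lemma scalarTraj_rotNoise_odd (a : ℝ) (α β : ℕ → E) (j : ℕ) :
    scalarTraj a (rotNoise a α β) (2 * j + 1) = a • evenState a β j +
      (Real.cos (Real.arctan a) • α j + (a * Real.cos (Real.arctan a)) • β j) := by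
  rw [scalarTraj, scalarTraj_rotNoise_even, rotNoise, if_pos (by omega),
    show (2 * j + 1) / 2 = j by omega]
  simp only [ContinuousLinearMap.rotation_apply, sin_arctan_eq]

lemma evenState_congr (a : ℝ) {β β' : ℕ → E} (j : ℕ) (h : ∀ i < j, β i = β' i) :
    evenState a β j = evenState a β' j := by
  induction j with
  | zero => rfl
  | succ j ih =>
    rw [evenState, evenState, ih fun i hi => h i (hi.trans j.lt_succ_self), h j j.lt_succ_self]

lemma continuous_evenState {n : ℕ} (a : ℝ) (j : ℕ) :
    Continuous fun β : Fin n → E => evenState a (extendZero β) j := by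
  induction j with
  | zero => exact continuous_const
  | succ j ih => simp only [evenState]; fun_prop

/-- The trajectory as a function of the rotated noise coordinates. -/
noncomputable def rotTraj (a : ℝ) {n : ℕ} (q : (Fin n → E) × (Fin n → E)) (t : ℕ) : E :=
  scalarTraj a (rotNoise a (extendZero q.1) (extendZero q.2)) t

@[fun_prop]
lemma continuous_rotTraj (a : ℝ) {n : ℕ} (t : ℕ) :
    Continuous fun q : (Fin n → E) × (Fin n → E) => rotTraj a q t := by
  unfold rotTraj
  have hE := fun j => (continuous_evenState (E := E) (n := n) a j).comp
    (continuous_snd (X := Fin n → E))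
  simp only [Function.comp_def] at hE
  rcases Nat.even_or_odd' t with ⟨j, rfl | rfl⟩
  · simp only [scalarTraj_rotNoise_even]
    exact hE j
  · simp only [scalarTraj_rotNoise_odd]
    have := hE j
    fun_prop

/-- One term of the phase `⟪Ξ, ∑ (X_{t+1} - B X_t) X_tᵀ⟫`. -/
noncomputable def phaseTerm (Ξ B : E →L[ℝ] E) (X : ℕ → E) (t : ℕ) : ℝ :=
  inner ℝ (Ξ (X t)) (X (t + 1) - B (X t))

variable [FiniteDimensional ℝ E] [MeasurableSpace E] [BorelSpace E]

/-- The part of the phase that belongs to two consecutive steps `x ↦ m ↦ x'` of the trajectory,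
where `m` and `x'` are written in rotated noise coordinates. -/
noncomputable def blockPhase (a : ℝ) (Ξ B : E →L[ℝ] E) (x α β : E) : ℝ :=
  let c := Real.cos (Real.arctan a)
  let m := a • x + (c • α + (a * c) • β)
  inner ℝ (Ξ x) (m - B x) + inner ℝ (Ξ m) (a ^ 2 • x + c⁻¹ • β - B m)

lemma integral_norm_blockPhase_sq_le (a : ℝ) (ha : 0 ≤ a) (Ξ B : E →L[ℝ] E) (x e : E)
    (he : ‖e‖ ≤ 1) :
    ∫ β, ‖∫ α, Complex.exp ((blockPhase a Ξ B x α β : ℂ) * Complex.I) ∂(stdGaussian E)‖ ^ 2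
      ∂(stdGaussian E) ≤ (1 + (‖Ξ.adjoint e‖ / (1 + a)) ^ 2) ^ (-(1 / 2) : ℝ) := by
  set c := Real.cos (Real.arctan a) with hc
  have hc2 : c ^ 2 * (1 + a ^ 2) = 1 := cos_arctan_sq_mul a
  have hcinv : c⁻¹ = c * (1 + a ^ 2) := cos_arctan_inv a
  set H : E →L[ℝ] E := Ξ.adjoint ∘L B + B.adjoint ∘L Ξ with hH
  have hsym : ∀ x y, (inner ℝ (H x) y : ℝ) = inner ℝ x (H y) := by
    intro x y
    simp only [hH, add_apply, ContinuousLinearMap.comp_apply, inner_add_left,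
      inner_add_right, ContinuousLinearMap.adjoint_inner_left,
      ContinuousLinearMap.adjoint_inner_right]
    ring
  set Θ : E →L[ℝ] E := Ξ.adjoint - (a * c ^ 2) • H with hΘ
  set v : E := c • (Ξ x + a ^ 2 • Ξ.adjoint x - a • H x) with hv
  -- the phase as a function of `α`
  have hphase : ∀ β, ∃ r : ℝ, ∀ α, blockPhase a Ξ B x α β
      = r + (inner ℝ α (Θ β + v) - c ^ 2 / 2 * inner ℝ α (H α)) := by
    intro β
    refine ⟨blockPhase a Ξ B x 0 β, fun α => ?_⟩
    have adj : ∀ (R : E →L[ℝ] E) (y z : E), (inner ℝ y (R.adjoint z) : ℝ) = inner ℝ z (R y) := by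
      intro R y z
      rw [ContinuousLinearMap.adjoint_inner_right, real_inner_comm]
    simp only [blockPhase, ← hc, hcinv, hΘ, hv, hH, sub_apply, add_apply, smul_apply,
      ContinuousLinearMap.comp_apply, map_add, map_smul, inner_add_left, inner_add_right,
      inner_sub_right, inner_smul_left, inner_smul_right, adj, conj_trivial, smul_zero, zero_add]
    rw [real_inner_comm (Ξ α) (B x), real_inner_comm (Ξ α) (B β), real_inner_comm (Ξ α) (B α),
      real_inner_comm (Ξ α) x, real_inner_comm (Ξ α) β, real_inner_comm (Ξ x) α]
    linear_combination (inner ℝ (Ξ α) β) * hc2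
  have hnorm : ∀ β, ‖∫ α, Complex.exp ((blockPhase a Ξ B x α β : ℂ) * Complex.I)
      ∂(stdGaussian E)‖ = ‖gaussPhase H (c ^ 2) (Θ β + v)‖ := by
    intro β
    obtain ⟨r, hr⟩ := hphase β
    simp_rw [hr, Complex.ofReal_add r, add_mul, Complex.exp_add]
    rw [integral_const_mul, norm_mul, Complex.norm_exp_ofReal_mul_I, one_mul]
    rfl
  simp_rw [hnorm]
  -- one of the two directions of decay is long
  have hsplit : Ξ.adjoint e = Θ e + a • c ^ 2 • H e := by
    simp only [hΘ, sub_apply, smul_apply, smul_smul]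
    abel
  have h1a : (0 : ℝ) < 1 + a := by linarith
  have hlong : ‖Ξ.adjoint e‖ / (1 + a) ≤ ‖√2 • Θ e‖ ∨ ‖Ξ.adjoint e‖ / (1 + a) ≤ ‖-c ^ 2 • H e‖ := by
    by_contra! hcon
    have h2 : ‖Θ e‖ ≤ ‖√2 • Θ e‖ := by
      rw [norm_smul, Real.norm_of_nonneg (Real.sqrt_nonneg _)]
      exact le_mul_of_one_le_left (norm_nonneg _) (Real.one_le_sqrt.2 (by norm_num))
    have h3 : ‖Ξ.adjoint e‖ ≤ ‖Θ e‖ + a * ‖-c ^ 2 • H e‖ := by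
      rw [hsplit, neg_smul, norm_neg]
      refine (norm_add_le _ _).trans_eq ?_
      rw [norm_smul a, Real.norm_of_nonneg ha]
    have h4 := h2.trans_lt hcon.1
    have h5 : a * ‖-c ^ 2 • H e‖ ≤ a * (‖Ξ.adjoint e‖ / (1 + a)) :=
      mul_le_mul_of_nonneg_left hcon.2.le ha
    have h6 : ‖Ξ.adjoint e‖ / (1 + a) + a * (‖Ξ.adjoint e‖ / (1 + a)) = ‖Ξ.adjoint e‖ := by
      field_simp
    linarith
  have hmono : ∀ u : E, ‖Ξ.adjoint e‖ / (1 + a) ≤ ‖u‖ → (1 + ‖u‖ ^ 2) ^ (-(1 / 2) : ℝ)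
      ≤ (1 + (‖Ξ.adjoint e‖ / (1 + a)) ^ 2) ^ (-(1 / 2) : ℝ) := by
    intro u hu
    refine Real.rpow_le_rpow_of_nonpos (by positivity) ?_ (by norm_num)
    have := pow_le_pow_left₀ (by positivity) hu 2
    linarith
  rcases hlong with h | h
  · exact (integral_norm_gaussPhase_sq_le H hsym _ Θ v e _ he (Or.inl rfl)).trans (hmono _ h)
  · exact (integral_norm_gaussPhase_sq_le H hsym _ Θ v e _ he (Or.inr rfl)).trans (hmono _ h)

end RotatedNoise

/-! ### Decay of the weighted characteristic functions -/

section Decay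

variable {E : Type*} [NormedAddCommGroup E] [InnerProductSpace ℝ E]

lemma rotTraj_even (a : ℝ) {n : ℕ} (q : (Fin n → E) × (Fin n → E)) (j : ℕ) :
    rotTraj a q (2 * j) = evenState a (extendZero q.2) j :=
  scalarTraj_rotNoise_even a _ _ j

lemma rotTraj_odd (a : ℝ) {n : ℕ} (q : (Fin n → E) × (Fin n → E)) (j : ℕ) :
    rotTraj a q (2 * j + 1) = a • evenState a (extendZero q.2) j +
      (Real.cos (Real.arctan a) • extendZero q.1 j +
        (a * Real.cos (Real.arctan a)) • extendZero q.2 j) :=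
  scalarTraj_rotNoise_odd a _ _ j

/-- The part of the phase up to time `T` that involves the block of times `2j`, `2j + 1`. -/
noncomputable def truncBlockPhase (a : ℝ) (T : ℕ) (Ξ B : E →L[ℝ] E) (j : ℕ) (α : E) (β : ℕ → E) :
    ℝ :=
  let x := evenState a β j
  let c := Real.cos (Real.arctan a)
  let m := a • x + (c • α + (a * c) • β j)
  (if 2 * j < T + 1 then inner ℝ (Ξ x) (m - B x) else 0) +
    (if 2 * j + 1 < T + 1 then inner ℝ (Ξ m) (evenState a β (j + 1) - B m) else 0)

lemma truncBlockPhase_eq_blockPhase (a : ℝ) (T : ℕ) (Ξ B : E →L[ℝ] E) (j : ℕ) (hj : 2 * j + 1 ≤ T)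
    (α : E) (β : ℕ → E) :
    truncBlockPhase a T Ξ B j α β = blockPhase a Ξ B (evenState a β j) α (β j) := by
  simp only [truncBlockPhase, blockPhase, evenState]
  rw [if_pos (by omega), if_pos (by omega)]

lemma sum_phaseTerm_eq (a : ℝ) {n : ℕ} (T : ℕ) (hn : T + 1 ≤ 2 * n) (Ξ B : E →L[ℝ] E)
    (q : (Fin n → E) × (Fin n → E)) :
    ∑ t ∈ Finset.range (T + 1), phaseTerm Ξ B (rotTraj a q) t
      = ∑ j : Fin n, truncBlockPhase a T Ξ B j (q.1 j) (extendZero q.2) := by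
  have h1 : ∑ t ∈ Finset.range (T + 1), phaseTerm Ξ B (rotTraj a q) t
      = ∑ t ∈ Finset.range (2 * n), if t < T + 1 then phaseTerm Ξ B (rotTraj a q) t else 0 := by
    rw [← Finset.sum_filter]
    congr 1
    ext t
    simp only [Finset.mem_range, Finset.mem_filter]
    omega
  have h2 : ∀ (m : ℕ) (f : ℕ → ℝ), ∑ t ∈ Finset.range (2 * m), f t
      = ∑ j ∈ Finset.range m, (f (2 * j) + f (2 * j + 1)) := by
    intro m f
    induction m with
    | zero => simp
    | succ m ih =>
      rw [show 2 * (m + 1) = 2 * m + 1 + 1 by ring, Finset.sum_range_succ, Finset.sum_range_succ,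
        ih, Finset.sum_range_succ]
      ring
  rw [h1, h2, Finset.sum_range]
  refine Finset.sum_congr rfl fun j _ => ?_
  simp only [truncBlockPhase, phaseTerm]
  rw [show 2 * (j : ℕ) + 1 + 1 = 2 * (j + 1) by ring, rotTraj_even, rotTraj_even, rotTraj_odd,
    extendZero_val]

lemma continuous_truncBlockPhase (a : ℝ) {n : ℕ} (T : ℕ) (Ξ B : E →L[ℝ] E) (j : ℕ) :
    Continuous fun p : E × (Fin n → E) => truncBlockPhase a T Ξ B j p.1 (extendZero p.2) := by
  have h1 : ∀ j, Continuous fun p : E × (Fin n → E) => evenState a (extendZero p.2) j :=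
    fun j => (continuous_evenState a j).comp continuous_snd
  have h2 : Continuous fun p : E × (Fin n → E) => extendZero p.2 j :=
    (continuous_extendZero j).comp continuous_snd
  have h3 := h1 j
  have h4 := h1 (j + 1)
  simp only [truncBlockPhase]
  split_ifs <;> fun_prop

lemma evenState_extendZero_update (a : ℝ) {n : ℕ} (β : Fin n → E) (i : Fin n) (y : E) (j : ℕ)
    (hj : j ≤ i) :
    evenState a (extendZero (Function.update β i y)) j = evenState a (extendZero β) j := by
  refine evenState_congr a j fun l hl => ?_
  unfold extendZero
  split_ifs with h
  · rw [Function.update_of_ne]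
    intro hli
    have := congrArg Fin.val hli
    simp only at this
    omega
  · rfl

variable [FiniteDimensional ℝ E] [MeasurableSpace E] [BorelSpace E]

/-- The standard Gaussian measure on pairs of `n`-tuples of rotated noise coordinates. -/
noncomputable abbrev rotGaussian (E : Type*) [NormedAddCommGroup E] [InnerProductSpace ℝ E]
    [FiniteDimensional ℝ E] [MeasurableSpace E] [BorelSpace E] (n : ℕ) :
    Measure ((Fin n → E) × (Fin n → E)) :=
  (Measure.pi fun _ : Fin n => stdGaussian E).prod (Measure.pi fun _ : Fin n => stdGaussian E)

/-- A weight that depends on at most four of the states leaves at least ten of the first fourteen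
blocks untouched, each of which contributes a factor to the decay in `Ξ`. -/
theorem norm_integral_weighted_phase_le (a : ℝ) (ha : 0 ≤ a) {n : ℕ} (T : ℕ) (hn : T + 1 ≤ 2 * n)
    (hT : 27 ≤ T) (k : Fin 4 → ℕ) (w : (Fin 4 → E) → ℝ) (hw : Continuous w)
    (hw2 : Integrable (fun q => w (fun i => rotTraj a q (k i)) ^ 2) (rotGaussian E n))
    (Ξ B : E →L[ℝ] E) (e : E) (he : ‖e‖ ≤ 1) :
    ‖∫ q, (w (fun i => rotTraj a q (k i)) : ℂ) * Complex.exp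
        (((∑ t ∈ Finset.range (T + 1), phaseTerm Ξ B (rotTraj a q) t : ℝ) : ℂ) * Complex.I)
        ∂(rotGaussian E n)‖
      ≤ √(∫ q, w (fun i => rotTraj a q (k i)) ^ 2 ∂(rotGaussian E n)) *
        √(((1 + (‖Ξ.adjoint e‖ / (1 + a)) ^ 2) ^ (-(1 / 2) : ℝ)) ^ 10) := by
  obtain ⟨G, hGs, hGc⟩ : ∃ G ⊆ (Finset.univ.filter fun j : Fin n =>
      (j : ℕ) < 14 ∧ ∀ i, k i ≠ 2 * j + 1), G.card = 10 := by
    refine Finset.exists_subset_card_eq ?_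
    have h14 : (Finset.univ.filter fun j : Fin n => (j : ℕ) < 14).card = 14 := by
      rw [Fin.card_filter_val_lt]
      omega
    have hsub : (Finset.univ.filter fun j : Fin n => (j : ℕ) < 14)
        ⊆ (Finset.univ.filter fun j : Fin n => (j : ℕ) < 14 ∧ ∀ i, k i ≠ 2 * j + 1) ∪
          (Finset.univ.filter fun j : Fin n => ∃ i, k i = 2 * j + 1) := by
      intro j hj
      simp only [Finset.mem_filter, Finset.mem_univ, true_and, Finset.mem_union] at hj ⊢
      by_cases h : ∃ i, k i = 2 * j + 1
      · exact Or.inr h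
      · exact Or.inl ⟨hj, fun i hi => h ⟨i, hi⟩⟩
    have hbad : (Finset.univ.filter fun j : Fin n => ∃ i, k i = 2 * j + 1).card ≤ 4 := by
      have : ((Finset.univ.filter fun j : Fin n => ∃ i, k i = 2 * j + 1).image
          fun j : Fin n => 2 * (j : ℕ) + 1) ⊆ Finset.univ.image k := by
        intro x hx
        simp only [Finset.mem_image, Finset.mem_filter, Finset.mem_univ, true_and] at hx ⊢
        obtain ⟨j, ⟨i, hi⟩, rfl⟩ := hx
        exact ⟨i, hi⟩
      have h1 := (Finset.card_le_card this).trans Finset.card_image_le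
      rw [Finset.card_image_of_injective _ (fun i j h => by
        ext; omega)] at h1
      simpa using h1
    have := (Finset.card_le_card hsub).trans (Finset.card_union_le _ _)
    omega
  have hG : ∀ j ∈ G, 2 * (j : ℕ) + 1 ≤ T ∧ ∀ i, k i ≠ 2 * j + 1 := by
    intro j hj
    have := Finset.mem_filter.1 (hGs hj)
    exact ⟨by have := this.2.1; omega, this.2.2⟩
  rw [← hGc]
  have hmain := norm_integral_block_le (stdGaussian E) G (fun q => w (fun i => rotTraj a q (k i)))
    (Continuous.measurable (by fun_prop)) hw2 ?_
    (fun j x β => truncBlockPhase a T Ξ B j x (extendZero β))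
    (fun j => (continuous_truncBlockPhase a T Ξ B j).measurable) ?_
    ((1 + (‖Ξ.adjoint e‖ / (1 + a)) ^ 2) ^ (-(1 / 2) : ℝ)) (by positivity) ?_
  · simp_rw [sum_phaseTerm_eq a T hn]
    exact hmain
  · intro α α' β
    congr 1
    ext i
    rcases Nat.even_or_odd' (k i) with ⟨l, hl | hl⟩
    · rw [hl, rotTraj_even, rotTraj_even]
    · rw [hl, rotTraj_odd, rotTraj_odd]
      have : extendZero (G.piecewise α' α) l = extendZero α l := by
        unfold extendZero
        split_ifs with h
        · rw [Finset.piecewise_eq_of_notMem]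
          intro hmem
          exact (hG _ hmem).2 i hl
        · rfl
      simp only [this]
  · intro j i hji x β y
    have hne : extendZero (Function.update β i y) j = extendZero β j := by
      rw [extendZero_val, extendZero_val, Function.update_of_ne hji.ne]
    simp only [truncBlockPhase, hne, evenState_extendZero_update a β i y j hji.le,
      evenState_extendZero_update a β i y (j + 1) hji]
  · intro j hj β
    simp only [truncBlockPhase_eq_blockPhase a T Ξ B j (hG j hj).1,
      evenState_extendZero_update a β j _ j le_rfl, extendZero_val, Function.update_self]
    exact integral_norm_blockPhase_sq_le a ha Ξ B _ e he

end Decay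

/-! ### The density of the norm of a random vector -/

section NormDensity

variable {F : Type*} [NormedAddCommGroup F] [NormedSpace ℝ F] [FiniteDimensional ℝ F]
  [Nontrivial F] [MeasurableSpace F] [BorelSpace F]

open scoped ENNReal in
/-- Integration in polar coordinates for an arbitrary norm. -/
lemma lintegral_eq_lintegral_Ioi_toSphere (ν : Measure F) [ν.IsAddHaarMeasure] (G : F → ℝ≥0∞)
    (hG : Measurable G) :
    ∫⁻ x, G x ∂ν = ∫⁻ r in Set.Ioi (0 : ℝ), ENNReal.ofReal (r ^ (Module.finrank ℝ F - 1)) *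
      ∫⁻ θ, G (r • (θ : F)) ∂ν.toSphere := by
  have h1 : ∫⁻ x, G x ∂ν = ∫⁻ x : ({0}ᶜ : Set F), G x ∂(ν.comap (↑)) := by
    rw [lintegral_subtype_comap (measurableSet_singleton _).compl, restrict_compl_singleton]
  have h2 : ∫⁻ x : ({0}ᶜ : Set F), G x ∂(ν.comap (↑)) = ∫⁻ q : Metric.sphere (0 : F) 1 × Set.Ioi (0 : ℝ),
      G ((q.2 : ℝ) • (q.1 : F)) ∂(ν.toSphere.prod (Measure.volumeIoiPow (Module.finrank ℝ F - 1))) := by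
    rw [← ν.measurePreserving_homeomorphUnitSphereProd.lintegral_comp_emb
      (Homeomorph.measurableEmbedding _)]
    refine lintegral_congr fun x => ?_
    congr 1
    have hx : ‖(x : F)‖ ≠ 0 := norm_ne_zero_iff.2 x.2
    simp [smul_smul, hx]
  have hm : Measurable fun q : Metric.sphere (0 : F) 1 × Set.Ioi (0 : ℝ) =>
      G ((q.2 : ℝ) • (q.1 : F)) := by fun_prop
  have hm2 : Measurable fun r : ℝ => ∫⁻ θ, G (r • (θ : F)) ∂ν.toSphere :=
    Measurable.lintegral_prod_right' (f := fun q : ℝ × Metric.sphere (0 : F) 1 =>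
      G (q.1 • (q.2 : F))) (by fun_prop)
  rw [h1, h2, lintegral_prod_symm _ hm.aemeasurable, Measure.volumeIoiPow,
    lintegral_withDensity_eq_lintegral_mul _ (by fun_prop) (by fun_prop)]
  exact lintegral_subtype_comap measurableSet_Ioi (fun r : ℝ =>
    ENNReal.ofReal (r ^ (Module.finrank ℝ F - 1)) * ∫⁻ θ, G (r • (θ : F)) ∂ν.toSphere)

/-- The norm of a random vector with a continuous density in dimension at least two has a
continuous density, including at the origin. -/
theorem exists_continuous_density_norm (ν : Measure F) [ν.IsAddHaarMeasure]
    (hdim : 2 ≤ Module.finrank ℝ F) {Ω : Type*} [MeasurableSpace Ω] (μ : Measure Ω) (Y : Ω → F)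
    (p : F → ℝ) (hp : Continuous p) (hp0 : ∀ x, 0 ≤ p x)
    (hY : HasLaw Y (ν.withDensity fun x => ENNReal.ofReal (p x)) μ) :
    ∃ f : ℝ → ℝ, Continuous f ∧ (∀ x, 0 ≤ f x) ∧
      HasLaw (fun ω => ‖Y ω‖) (volume.withDensity fun x => ENNReal.ofReal (f x)) μ := by
  set d := Module.finrank ℝ F - 1 with hd
  have hd0 : d ≠ 0 := by omega
  set S : ℝ → ℝ := fun r => ∫ θ, p (r • (θ : F)) ∂ν.toSphere with hS
  have hSc : Continuous S := by
    have := continuous_parametric_integral_of_continuous (μ := ν.toSphere)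
      (f := fun (r : ℝ) (θ : Metric.sphere (0 : F) 1) => p (r • (θ : F))) (by fun_prop)
      (isCompact_univ)
    simpa using this
  have hS0 : ∀ r, 0 ≤ S r := fun r => integral_nonneg fun θ => hp0 _
  refine ⟨fun r => (max r 0) ^ d * S r, by fun_prop, fun r => mul_nonneg (by positivity) (hS0 r),
    hY.aemeasurable.norm, ?_⟩
  have hmap : μ.map (fun ω => ‖Y ω‖) = (μ.map Y).map (fun x => ‖x‖) := by
    rw [AEMeasurable.map_map_of_aemeasurable (by fun_prop) hY.aemeasurable]
    rfl
  rw [hmap, hY.map_eq]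
  refine Measure.ext fun s hs => ?_
  rw [Measure.map_apply measurable_norm hs, withDensity_apply _ (measurable_norm hs),
    withDensity_apply _ hs, ← lintegral_indicator (measurable_norm hs), ← lintegral_indicator hs,
    lintegral_eq_lintegral_Ioi_toSphere ν _
      (Measurable.indicator (by fun_prop) (measurable_norm hs)),
    ← lintegral_indicator measurableSet_Ioi]
  refine lintegral_congr fun r => ?_
  by_cases hr : 0 < r
  · rw [Set.indicator_of_mem (Set.mem_Ioi.2 hr)]
    have hind : ∀ θ : Metric.sphere (0 : F) 1,
        Set.indicator ((fun x : F => ‖x‖) ⁻¹' s) (fun x => ENNReal.ofReal (p x)) (r • (θ : F))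
          = Set.indicator s (fun _ => ENNReal.ofReal (p (r • (θ : F)))) r := by
      intro θ
      have : ‖r • (θ : F)‖ = r := by
        rw [norm_smul, Real.norm_of_nonneg hr.le, norm_eq_of_mem_sphere, mul_one]
      by_cases hrs : r ∈ s
      · rw [Set.indicator_of_mem (by rwa [Set.mem_preimage, this]), Set.indicator_of_mem hrs]
      · rw [Set.indicator_of_notMem (by rwa [Set.mem_preimage, this]),
          Set.indicator_of_notMem hrs]
    simp_rw [hind]
    by_cases hrs : r ∈ s
    · simp only [Set.indicator_of_mem hrs]
      rw [max_eq_left hr.le, ENNReal.ofReal_mul (by positivity), hS,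
        ofReal_integral_eq_lintegral_ofReal _ (ae_of_all _ fun θ => hp0 _)]
      exact (Continuous.integrable_of_hasCompactSupport (by fun_prop)
        (HasCompactSupport.of_compactSpace _))
    · simp [Set.indicator_of_notMem hrs]
  · rw [Set.indicator_of_notMem (by simpa using hr)]
    have : max r 0 = 0 := max_eq_right (not_lt.1 hr)
    simp [Set.indicator, this, hd0]

end NormDensity

/-! ### The law of the trajectory -/

section TrajectoryLaw

variable {E : Type*} [NormedAddCommGroup E]

/-- Interleaving of two finite sequences: `α_j` at time `2j+1` and `β_j` at time `2j+2`. -/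
def interleave {n : ℕ} (q : (Fin n → E) × (Fin n → E)) (t : ℕ) : E :=
  if t % 2 = 1 then extendZero q.1 (t / 2) else extendZero q.2 (t / 2 - 1)

variable [InnerProductSpace ℝ E]

lemma scalarTraj_congr (a : ℝ) {η η' : ℕ → E} (t : ℕ) (h : ∀ s, 1 ≤ s → s ≤ t → η s = η' s) :
    scalarTraj a η t = scalarTraj a η' t := by
  induction t with
  | zero => rfl
  | succ t ih =>
    rw [scalarTraj, scalarTraj, ih fun s h1 h2 => h s h1 (h2.trans t.le_succ),
      h (t + 1) (by omega) le_rfl]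

lemma continuous_scalarTraj_interleave {n : ℕ} (a : ℝ) (t : ℕ) :
    Continuous fun q : (Fin n → E) × (Fin n → E) => scalarTraj a (interleave q) t := by
  induction t with
  | zero => exact continuous_const
  | succ t ih =>
    simp only [scalarTraj]
    refine (ih.const_smul a).add ?_
    unfold interleave
    split_ifs <;> fun_prop

variable [FiniteDimensional ℝ E] [MeasurableSpace E] [BorelSpace E]

/-- A rotation in every pair of coordinates preserves a product of standard Gaussians. -/
lemma measurePreserving_rotation_pairs (θ : ℝ) (n : ℕ) :
    MeasurePreserving (fun q : (Fin n → E) × (Fin n → E) =>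
      (((fun j => (ContinuousLinearMap.rotation θ (q.1 j, q.2 j)).1),
        (fun j => (ContinuousLinearMap.rotation θ (q.1 j, q.2 j)).2)) :
          (Fin n → E) × (Fin n → E))) (rotGaussian E n) (rotGaussian E n) := by
  have h1 := measurePreserving_arrowProdEquivProdArrow E E (Fin n) (fun _ => stdGaussian E)
    (fun _ => stdGaussian E)
  have h2 : MeasurePreserving (fun (z : Fin n → E × E) j => ContinuousLinearMap.rotation θ (z j))
      (Measure.pi fun _ => (stdGaussian E).prod (stdGaussian E))
      (Measure.pi fun _ => (stdGaussian E).prod (stdGaussian E)) := by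
    have hrot : ((stdGaussian E).prod (stdGaussian E)).map (ContinuousLinearMap.rotation θ)
        = (stdGaussian E).prod (stdGaussian E) :=
      IsGaussian.map_rotation_eq_self integral_id_stdGaussian θ
    refine ⟨by fun_prop, ?_⟩
    rw [Measure.pi_map_pi (fun _ => by fun_prop)]
    simp_rw [hrot]
  exact (h1.comp (h2.comp h1.symm))

variable {Ω : Type*} [MeasurableSpace Ω] {μ : Measure Ω} [IsProbabilityMeasure μ] {η : ℕ → Ω → E}

/-- Independent standard Gaussian noise at the odd and at the even times up to `2n` is a pair of
independent standard Gaussian sequences. -/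
lemma map_odd_even_noise (hind : iIndepFun (fun t => η (t + 1)) μ)
    (hlaw : ∀ t : ℕ, HasLaw (η (t + 1)) (stdGaussian E) μ) (n : ℕ) :
    μ.map (fun ω => ((fun j : Fin n => η (2 * j + 1) ω), (fun j : Fin n => η (2 * j + 2) ω)))
      = rotGaussian E n := by
  let g : Fin n ⊕ Fin n → ℕ := Sum.elim (fun j => 2 * j) (fun j => 2 * j + 1)
  have hg : Function.Injective g := by
    rintro (i | i) (j | j) h <;> simp only [g, Sum.elim_inl, Sum.elim_inr] at h
    · exact congrArg _ (Fin.ext (by omega))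
    · omega
    · omega
    · exact congrArg _ (Fin.ext (by omega))
  have h1 := hind.precomp hg
  rw [iIndepFun_iff_map_fun_eq_pi_map (fun i => (hlaw (g i)).aemeasurable)] at h1
  simp_rw [(hlaw _).map_eq] at h1
  have h2 := measurePreserving_sumPiEquivProdPi (X := fun _ : Fin n ⊕ Fin n => E)
    (fun _ => stdGaussian E)
  rw [rotGaussian, ← h2.map_eq, ← h1, AEMeasurable.map_map_of_aemeasurable h2.measurable.aemeasurable
    (aemeasurable_pi_lambda _ fun i => (hlaw (g i)).aemeasurable)]
  rfl

/-- The trajectory of the system has the law of the trajectory in rotated noise coordinates. -/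
theorem map_scalarTraj_eq_map_rotTraj (a : ℝ) (hind : iIndepFun (fun t => η (t + 1)) μ)
    (hlaw : ∀ t : ℕ, HasLaw (η (t + 1)) (stdGaussian E) μ) {n m : ℕ} (hm : m ≤ 2 * n + 1) :
    μ.map (fun ω (t : Fin m) => scalarTraj a (fun s => η s ω) t)
      = (rotGaussian E n).map (fun q (t : Fin m) => rotTraj a q t) := by
  let Φ : (Fin n → E) × (Fin n → E) → Fin m → E := fun q t => scalarTraj a (interleave q) t
  have hΦ : Measurable Φ :=
    measurable_pi_lambda _ fun t => (continuous_scalarTraj_interleave a t).measurable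
  have hE := measurePreserving_rotation_pairs (E := E) (Real.arctan a) n
  have key : (fun q (t : Fin m) => rotTraj a q t) = Φ ∘ (fun q : (Fin n → E) × (Fin n → E) =>
      (((fun j => (ContinuousLinearMap.rotation (Real.arctan a) (q.1 j, q.2 j)).1),
        (fun j => (ContinuousLinearMap.rotation (Real.arctan a) (q.1 j, q.2 j)).2)) :
          (Fin n → E) × (Fin n → E))) := by
    ext1 q
    ext1 t
    refine scalarTraj_congr a _ fun s h1 h2 => ?_
    have := t.2
    unfold rotNoise interleave extendZero
    split_ifs with h3 h4 h5
    · rfl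
    · omega
    · rfl
    · omega
  have key2 : (fun ω (t : Fin m) => scalarTraj a (fun s => η s ω) t) = Φ ∘ (fun ω =>
      ((fun j : Fin n => η (2 * j + 1) ω), (fun j : Fin n => η (2 * j + 2) ω))) := by
    ext1 ω
    ext1 t
    refine scalarTraj_congr a _ fun s h1 h2 => ?_
    have := t.2
    unfold interleave extendZero
    split_ifs with h3 h4 h5
    · exact congrArg (η · ω) (by simp only; omega)
    · omega
    · exact congrArg (η · ω) (by simp only; omega)
    · omega
  have hm : AEMeasurable (fun ω => (((fun j : Fin n => η (2 * j + 1) ω),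
      (fun j : Fin n => η (2 * j + 2) ω)) : (Fin n → E) × (Fin n → E))) μ :=
    (aemeasurable_pi_lambda _ fun j : Fin n => (hlaw (2 * j)).aemeasurable).prodMk
      (aemeasurable_pi_lambda _ fun j : Fin n => (hlaw (2 * j + 1)).aemeasurable)
  rw [key, key2, ← Measure.map_map hΦ hE.measurable, hE.map_eq,
    ← AEMeasurable.map_map_of_aemeasurable hΦ.aemeasurable hm, map_odd_even_noise hind hlaw]

end TrajectoryLaw

/-! ### The normal equations of least squares -/

section NormalEquations

variable {d : ℕ}

/-- The Gram matrix `∑_{t=0}^{T} X_t X_tᵀ`. -/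
def gramMat (X : ℕ → EuclideanSpace ℝ (Fin d)) (T : ℕ) : Matrix (Fin d) (Fin d) ℝ :=
  ∑ t ∈ Finset.range (T + 1), Matrix.vecMulVec (fun i => X t i) (fun i => X t i)

/-- The cross-covariance matrix `∑_{t=0}^{T} X_{t+1} X_tᵀ`. -/
def crossMat (X : ℕ → EuclideanSpace ℝ (Fin d)) (T : ℕ) : Matrix (Fin d) (Fin d) ℝ :=
  ∑ t ∈ Finset.range (T + 1), Matrix.vecMulVec (fun i => X (t + 1) i) (fun i => X t i)

lemma gramMat_apply (X : ℕ → EuclideanSpace ℝ (Fin d)) (T : ℕ) (i j : Fin d) :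
    gramMat X T i j = ∑ t ∈ Finset.range (T + 1), X t i * X t j := by
  simp [gramMat, Matrix.sum_apply, Matrix.vecMulVec_apply]

lemma crossMat_apply (X : ℕ → EuclideanSpace ℝ (Fin d)) (T : ℕ) (i j : Fin d) :
    crossMat X T i j = ∑ t ∈ Finset.range (T + 1), X (t + 1) i * X t j := by
  simp [crossMat, Matrix.sum_apply, Matrix.vecMulVec_apply]

lemma sampleCov_eq_gramMat (X : ℕ → EuclideanSpace ℝ (Fin d)) (h0 : X 0 = 0) (T : ℕ) :
    sampleCov X T = gramMat X T := by
  ext i j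
  rw [gramMat_apply, Finset.sum_range_succ', h0]
  simp only [sampleCov, Matrix.sum_apply, Matrix.vecMulVec_apply, PiLp.zero_apply, mul_zero,
    add_zero]
  rw [Finset.range_eq_Ico, Finset.sum_Ico_add' (fun t => X t i * X t j) 0 T 1]
  rfl

/-- A least squares estimate solves the normal equations `B ∑ X_t X_tᵀ = ∑ X_{t+1} X_tᵀ`. -/
theorem IsOLS.mul_gramMat_eq {X : ℕ → EuclideanSpace ℝ (Fin d)} {T : ℕ}
    {B : Matrix (Fin d) (Fin d) ℝ} (h : IsOLS X T B) : B * gramMat X T = crossMat X T := by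
  ext i j
  let R : ℕ → EuclideanSpace ℝ (Fin d) := fun t =>
    X (t + 1) - Matrix.toEuclideanCLM (𝕜 := ℝ) B (X t)
  have hR : ∀ t, R t i = X (t + 1) i - ∑ k, B i k * X t k := fun t => rfl
  -- perturb `B` in its `(i, j)` entry
  have hquad : ∀ s : ℝ, 0 ≤ (∑ t ∈ Finset.range (T + 1), X t j ^ 2) * (s * s)
      + (-2 * ∑ t ∈ Finset.range (T + 1), R t i * X t j) * s + 0 := by
    intro s
    have h1 := isMinOn_iff.1 h (B + s • Matrix.single i j 1) (Set.mem_univ _)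
    have h2 : ∀ t, ‖X (t + 1) - Matrix.toEuclideanCLM (𝕜 := ℝ) (B + s • Matrix.single i j 1) (X t)‖
        ^ 2 = ‖R t‖ ^ 2 + X t j ^ 2 * (s * s) + -2 * (R t i * X t j) * s := by
      intro t
      have h3 : Matrix.toEuclideanCLM (𝕜 := ℝ) (B + s • Matrix.single i j 1) (X t)
          = Matrix.toEuclideanCLM (𝕜 := ℝ) B (X t) + EuclideanSpace.single i (s * X t j) := by
        rw [map_add, map_smul, add_apply, smul_apply]
        congr 1
        ext k
        simp only [PiLp.smul_apply, Matrix.ofLp_toEuclideanCLM, smul_eq_mul,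
          Matrix.single_mulVec, PiLp.single_apply, Function.update_apply, Pi.zero_apply, one_mul]
        split_ifs <;> simp
      rw [h3, ← sub_sub, norm_sub_sq_real, EuclideanSpace.inner_single_right,
        PiLp.norm_single, Real.norm_eq_abs, sq_abs]
      simp only [R, conj_trivial]
      ring
    simp only [h2, Finset.sum_add_distrib, ← Finset.sum_mul, ← Finset.mul_sum] at h1
    simp only [R] at h1 ⊢
    linarith
  have hzero := discrim_le_zero hquad
  have hsum : ∑ t ∈ Finset.range (T + 1), R t i * X t j = 0 := by
    rw [discrim] at hzero
    nlinarith [sq_nonneg (∑ t ∈ Finset.range (T + 1), R t i * X t j)]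
  rw [crossMat_apply, Matrix.mul_apply]
  simp only [gramMat_apply, hR, sub_mul, Finset.sum_sub_distrib, Finset.mul_sum, Finset.sum_mul]
    at hsum ⊢
  rw [Finset.sum_comm]
  simp only [← mul_assoc]
  linarith

lemma IsOLS.eq_of_det_ne_zero {X : ℕ → EuclideanSpace ℝ (Fin d)} {T : ℕ}
    {B B' : Matrix (Fin d) (Fin d) ℝ} (hdet : (gramMat X T).det ≠ 0) (h : IsOLS X T B)
    (h' : IsOLS X T B') : B = B' := by
  have hu : IsUnit (gramMat X T) := (Matrix.isUnit_iff_isUnit_det _).2 hdet.isUnit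
  exact hu.mul_right_cancel (h.mul_gramMat_eq.trans h'.mul_gramMat_eq.symm)

end NormalEquations

/-! ### Planar determinants -/

/-- The determinant of two vectors of the plane. -/
def cross2 (u v : EuclideanSpace ℝ (Fin 2)) : ℝ := u 0 * v 1 - u 1 * v 0

lemma det_gramMat_eq_sum (X : ℕ → EuclideanSpace ℝ (Fin 2)) (T : ℕ) :
    (gramMat X T).det = ∑ s ∈ Finset.range (T + 1), ∑ t ∈ Finset.range (T + 1),
      X s 0 * X t 1 * cross2 (X s) (X t) := by
  rw [Matrix.det_fin_two]
  simp only [gramMat_apply, Finset.sum_mul_sum, cross2]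
  rw [← Finset.sum_sub_distrib]
  refine Finset.sum_congr rfl fun s _ => ?_
  rw [← Finset.sum_sub_distrib]
  exact Finset.sum_congr rfl fun t _ => by ring

/-- Lagrange's identity for the Gram determinant. -/
lemma two_mul_det_gramMat (X : ℕ → EuclideanSpace ℝ (Fin 2)) (T : ℕ) :
    2 * (gramMat X T).det = ∑ s ∈ Finset.range (T + 1), ∑ t ∈ Finset.range (T + 1),
      cross2 (X s) (X t) ^ 2 := by
  have h1 := det_gramMat_eq_sum X T
  have h2 := h1
  rw [Finset.sum_comm] at h2
  rw [two_mul]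
  nth_rewrite 1 [h1]
  rw [h2, ← Finset.sum_add_distrib]
  refine Finset.sum_congr rfl fun s _ => ?_
  rw [← Finset.sum_add_distrib]
  exact Finset.sum_congr rfl fun t _ => by simp only [cross2]; ring

lemma sq_cross2_le_det_gramMat (X : ℕ → EuclideanSpace ℝ (Fin 2)) (T : ℕ) {s t : ℕ} (hst : s ≠ t)
    (hs : s ≤ T) (ht : t ≤ T) : cross2 (X s) (X t) ^ 2 ≤ (gramMat X T).det := by
  have h := two_mul_det_gramMat X T
  rw [← Finset.sum_product'] at h
  have h2 : ∑ p ∈ ({(s, t), (t, s)} : Finset (ℕ × ℕ)), cross2 (X p.1) (X p.2) ^ 2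
      ≤ ∑ p ∈ Finset.range (T + 1) ×ˢ Finset.range (T + 1), cross2 (X p.1) (X p.2) ^ 2 := by
    refine Finset.sum_le_sum_of_subset_of_nonneg ?_ fun _ _ _ => sq_nonneg _
    intro p hp
    simp only [Finset.mem_insert, Finset.mem_singleton] at hp
    rcases hp with rfl | rfl <;> simp only [Finset.mem_product, Finset.mem_range] <;> omega
  rw [Finset.sum_pair (by simp [hst])] at h2
  have h3 : cross2 (X t) (X s) ^ 2 = cross2 (X s) (X t) ^ 2 := by simp only [cross2]; ring
  simp only at h2
  linarith

/-! ### The error matrix -/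

/-- The vector of entries of `(∑ (X_{t+1} - a X_t) X_tᵀ) (∑ X_t X_tᵀ)⁻¹`, with the inverse written
through the adjugate to keep measurability evident; it is zero if the Gram matrix is singular. -/
noncomputable def errVec (a : ℝ) (X : ℕ → EuclideanSpace ℝ (Fin 2)) (T : ℕ) :
    EuclideanSpace ℝ (Fin 2 × Fin 2) :=
  WithLp.toLp 2 fun p => ((gramMat X T).det)⁻¹ *
    ((crossMat X T - a • gramMat X T) * (gramMat X T).adjugate) p.1 p.2

/-- The operator with a given vector of matrix entries. -/
noncomputable def entryOp : EuclideanSpace ℝ (Fin 2 × Fin 2) ≃L[ℝ]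
    (EuclideanSpace ℝ (Fin 2) →L[ℝ] EuclideanSpace ℝ (Fin 2)) :=
  (((WithLp.linearEquiv 2 ℝ (Fin 2 × Fin 2 → ℝ)).trans
    (LinearEquiv.curry ℝ ℝ (Fin 2) (Fin 2))).trans
    (((Matrix.ofLinearEquiv ℝ).trans
      (Matrix.toEuclideanCLM (n := Fin 2) (𝕜 := ℝ)).toAlgEquiv.toLinearEquiv))).toContinuousLinearEquiv

lemma entryOp_apply (B : EuclideanSpace ℝ (Fin 2 × Fin 2)) :
    entryOp B = Matrix.toEuclideanCLM (𝕜 := ℝ) (Matrix.of fun i j => B (i, j)) := rfl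

lemma entryOp_apply_apply (B : EuclideanSpace ℝ (Fin 2 × Fin 2)) (x : EuclideanSpace ℝ (Fin 2))
    (i : Fin 2) : entryOp B x i = ∑ j, B (i, j) * x j := rfl

lemma Ao_eq_smul_one : Ao = aRate • (1 : Matrix (Fin 2) (Fin 2) ℝ) := by
  ext i j
  fin_cases i <;> fin_cases j <;> simp [Ao]

/-- The error of a least squares estimate is the error matrix of the normal equations. -/
lemma norm_entryOp_errVec {X : ℕ → EuclideanSpace ℝ (Fin 2)} {T : ℕ}
    {B : Matrix (Fin 2) (Fin 2) ℝ} (hdet : (gramMat X T).det ≠ 0) (h : IsOLS X T B) :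
    ‖entryOp (errVec aRate X T)‖ = opNorm2 (B - Ao) := by
  have h1 : crossMat X T - aRate • gramMat X T = (B - Ao) * gramMat X T := by
    rw [sub_mul, h.mul_gramMat_eq, Ao_eq_smul_one, Matrix.smul_mul, Matrix.one_mul]
  rw [entryOp_apply, opNorm2]
  congr 2
  ext i j
  simp only [errVec, Matrix.of_apply, h1, Matrix.mul_assoc, Matrix.mul_adjugate, Matrix.mul_smul,
    Matrix.mul_one, Matrix.smul_apply, smul_eq_mul]
  field_simp

/-- Right multiplication `B ↦ B ∑ X_t X_tᵀ` on vectors of matrix entries. -/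
noncomputable def gramOp (X : ℕ → EuclideanSpace ℝ (Fin 2)) (T : ℕ) :
    EuclideanSpace ℝ (Fin 2 × Fin 2) →L[ℝ] EuclideanSpace ℝ (Fin 2 × Fin 2) :=
  Matrix.toEuclideanCLM (𝕜 := ℝ)
    (Matrix.kroneckerMap (· * ·) (1 : Matrix (Fin 2) (Fin 2) ℝ) (gramMat X T).transpose)

/-- The vector of entries of `∑ (X_{t+1} - a X_t) X_tᵀ`. -/
def innovVec (a : ℝ) (X : ℕ → EuclideanSpace ℝ (Fin 2)) (T : ℕ) :
    EuclideanSpace ℝ (Fin 2 × Fin 2) :=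
  WithLp.toLp 2 fun p => (crossMat X T - a • gramMat X T) p.1 p.2

lemma gramOp_apply (X : ℕ → EuclideanSpace ℝ (Fin 2)) (T : ℕ)
    (B : EuclideanSpace ℝ (Fin 2 × Fin 2)) (i j : Fin 2) :
    gramOp X T B (i, j) = ∑ k, B (i, k) * gramMat X T k j := by
  simp only [gramOp, Matrix.ofLp_toEuclideanCLM, Matrix.mulVec, dotProduct,
    Matrix.kroneckerMap_apply, Fintype.sum_prod_type, Matrix.one_apply, Matrix.transpose_apply,
    ite_mul, one_mul, zero_mul]
  rw [Finset.sum_eq_single i (fun b _ hb => by simp [hb.symm]) (by simp)]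
  simp [mul_comm]

lemma det_gramOp (X : ℕ → EuclideanSpace ℝ (Fin 2)) (T : ℕ) :
    (gramOp X T).det = (gramMat X T).det ^ 2 := by
  rw [gramOp, ContinuousLinearMap.det, Matrix.coe_toEuclideanCLM_eq_toEuclideanLin,
    Matrix.toEuclideanLin_eq_toLin_orthonormal, LinearMap.det_toLin, Matrix.det_kronecker]
  simp

lemma gramOp_errVec (a : ℝ) {X : ℕ → EuclideanSpace ℝ (Fin 2)} {T : ℕ}
    (hdet : (gramMat X T).det ≠ 0) : gramOp X T (errVec a X T) = innovVec a X T := by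
  ext ⟨i, j⟩
  rw [gramOp_apply]
  simp only [errVec, innovVec, mul_assoc]
  rw [← Finset.mul_sum, ← Matrix.mul_apply, Matrix.mul_assoc, Matrix.adjugate_mul, Matrix.mul_smul,
    Matrix.mul_one, Matrix.smul_apply, smul_eq_mul]
  field_simp

lemma inner_innovVec_sub_gramOp (a : ℝ) (X : ℕ → EuclideanSpace ℝ (Fin 2)) (T : ℕ)
    (Ξ B : EuclideanSpace ℝ (Fin 2 × Fin 2)) :
    inner ℝ Ξ (innovVec a X T - gramOp X T B) = ∑ t ∈ Finset.range (T + 1),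
      phaseTerm (entryOp Ξ) (a • ContinuousLinearMap.id ℝ _ + entryOp B) X t := by
  simp only [phaseTerm, PiLp.inner_apply, Fintype.sum_prod_type, PiLp.sub_apply, gramOp_apply,
    innovVec, Matrix.sub_apply, Matrix.smul_apply, crossMat_apply, gramMat_apply, Fin.sum_univ_two,
    add_apply, smul_apply, ContinuousLinearMap.id_apply, PiLp.add_apply, PiLp.smul_apply,
    entryOp_apply_apply, smul_eq_mul, RCLike.inner_apply, conj_trivial]
  simp only [Finset.mul_sum, Finset.sum_mul, ← Finset.sum_add_distrib, ← Finset.sum_sub_distrib]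
  exact Finset.sum_congr rfl fun t _ => by ring

/-! ### The density of the error matrix -/

section Moments

variable {E : Type*} [NormedAddCommGroup E]

/-- The sum of the norms of all noise vectors. -/
noncomputable def noiseNorm {n : ℕ} (q : (Fin n → E) × (Fin n → E)) : ℝ :=
  ∑ j, ‖q.1 j‖ + ∑ j, ‖q.2 j‖

lemma norm_extendZero_le {n : ℕ} (z : Fin n → E) (j : ℕ) : ‖extendZero z j‖ ≤ ∑ i, ‖z i‖ := by
  unfold extendZero
  split_ifs with h
  · exact Finset.single_le_sum (f := fun i => ‖z i‖) (fun i _ => norm_nonneg _) (Finset.mem_univ _)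
  · rw [norm_zero]
    positivity

lemma noiseNorm_nonneg {n : ℕ} (q : (Fin n → E) × (Fin n → E)) : 0 ≤ noiseNorm q := by
  unfold noiseNorm
  positivity

variable [InnerProductSpace ℝ E]

lemma norm_rotNoise_le (a : ℝ) {n : ℕ} (q : (Fin n → E) × (Fin n → E)) (t : ℕ) :
    ‖rotNoise a (extendZero q.1) (extendZero q.2) t‖ ≤ noiseNorm q := by
  have hs : ∀ (r : ℝ) (x : E), |r| ≤ 1 → ‖r • x‖ ≤ ‖x‖ := fun r x hr => by
    rw [norm_smul]
    exact mul_le_of_le_one_left (norm_nonneg _) hr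
  unfold rotNoise noiseNorm
  have h1 := norm_extendZero_le q.1
  have h2 := norm_extendZero_le q.2
  split_ifs
  all_goals
    simp only [ContinuousLinearMap.rotation_apply]
    refine (norm_add_le _ _).trans (add_le_add ((hs _ _ ?_).trans (h1 _)) ((hs _ _ ?_).trans (h2 _)))
  all_goals
    simp only [abs_neg, Real.abs_cos_le_one, Real.abs_sin_le_one]

lemma exists_norm_rotTraj_le (a : ℝ) {n : ℕ} (t : ℕ) :
    ∃ C : ℝ, 0 ≤ C ∧ ∀ q : (Fin n → E) × (Fin n → E), ‖rotTraj a q t‖ ≤ C * noiseNorm q := by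
  unfold rotTraj
  induction t with
  | zero => exact ⟨0, le_rfl, fun q => by simp [scalarTraj]⟩
  | succ t ih =>
    obtain ⟨C, hC, h⟩ := ih
    refine ⟨|a| * C + 1, by positivity, fun q => ?_⟩
    rw [scalarTraj]
    refine (norm_add_le _ _).trans ?_
    rw [norm_smul, Real.norm_eq_abs]
    have := mul_le_mul_of_nonneg_left (h q) (abs_nonneg a)
    linarith [norm_rotNoise_le a q (t + 1)]

variable [FiniteDimensional ℝ E] [MeasurableSpace E] [BorelSpace E]

lemma integrable_noiseNorm_pow (n k : ℕ) :
    Integrable (fun q : (Fin n → E) × (Fin n → E) => noiseNorm q ^ k) (rotGaussian E n) := by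
  rcases eq_or_ne k 0 with rfl | hk
  · simp
  have hid : MemLp id (k : ENNReal) (stdGaussian E) :=
    IsGaussian.memLp_id _ _ (ENNReal.natCast_ne_top k)
  have h1 : ∀ j : Fin n, MemLp (fun q : (Fin n → E) × (Fin n → E) => ‖q.1 j‖) k
      (rotGaussian E n) := fun j =>
    (hid.comp_measurePreserving ((measurePreserving_eval (fun _ : Fin n => stdGaussian E) j).comp
      measurePreserving_fst)).norm
  have h2 : ∀ j : Fin n, MemLp (fun q : (Fin n → E) × (Fin n → E) => ‖q.2 j‖) k
      (rotGaussian E n) := fun j =>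
    (hid.comp_measurePreserving ((measurePreserving_eval (fun _ : Fin n => stdGaussian E) j).comp
      measurePreserving_snd)).norm
  have h3 : MemLp (fun q : (Fin n → E) × (Fin n → E) => noiseNorm q) k (rotGaussian E n) :=
    (memLp_finsetSum _ fun j _ => h1 j).add (memLp_finsetSum _ fun j _ => h2 j)
  refine (h3.integrable_norm_pow hk).congr (Eventually.of_forall fun q => ?_)
  simp only [Real.norm_of_nonneg (noiseNorm_nonneg q)]

end Moments

section ErrorDensity

@[fun_prop]
lemma continuous_cross2 {Q : Type*} [TopologicalSpace Q] {f g : Q → 𝔼₂} (hf : Continuous f)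
    (hg : Continuous g) : Continuous fun q => cross2 (f q) (g q) := by
  unfold cross2
  fun_prop

lemma abs_apply_le_norm (u : 𝔼₂) (i : Fin 2) : |u i| ≤ ‖u‖ := by
  simpa using PiLp.norm_apply_le u i

lemma abs_cross2_le (u v : 𝔼₂) : |cross2 u v| ≤ 2 * (‖u‖ * ‖v‖) := by
  have h1 := mul_le_mul (abs_apply_le_norm u 0) (abs_apply_le_norm v 1) (abs_nonneg _) (norm_nonneg _)
  have h2 := mul_le_mul (abs_apply_le_norm u 1) (abs_apply_le_norm v 0) (abs_nonneg _) (norm_nonneg _)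
  rw [← abs_mul] at h1 h2
  unfold cross2
  linarith [abs_sub (u 0 * v 1) (u 1 * v 0)]

/-- The monomial in four states whose sum is the squared Gram determinant. -/
def gramWeight (x : Fin 4 → 𝔼₂) : ℝ :=
  x 0 0 * x 1 1 * cross2 (x 0) (x 1) * (x 2 0 * x 3 1 * cross2 (x 2) (x 3))

lemma continuous_gramWeight : Continuous gramWeight := by
  unfold gramWeight
  fun_prop

lemma abs_gramWeight_le (x : Fin 4 → 𝔼₂) {R : ℝ} (h : ∀ i, ‖x i‖ ≤ R) :
    |gramWeight x| ≤ 4 * R ^ 8 := by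
  have hR : 0 ≤ R := (norm_nonneg _).trans (h 0)
  have key : ∀ i j, |x i 0 * x j 1 * cross2 (x i) (x j)| ≤ 2 * R ^ 4 := by
    intro i j
    rw [abs_mul, abs_mul]
    have h1 := (abs_apply_le_norm (x i) 0).trans (h i)
    have h2 := (abs_apply_le_norm (x j) 1).trans (h j)
    have h3 : |cross2 (x i) (x j)| ≤ 2 * (R * R) := (abs_cross2_le _ _).trans
      (mul_le_mul_of_nonneg_left (mul_le_mul (h i) (h j) (norm_nonneg _) hR) zero_le_two)
    calc _ ≤ R * R * (2 * (R * R)) := by gcongr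
      _ = _ := by ring
  rw [gramWeight, abs_mul]
  calc _ ≤ 2 * R ^ 4 * (2 * R ^ 4) := mul_le_mul (key 0 1) (key 2 3) (abs_nonneg _) (by positivity)
    _ = _ := by ring

lemma sq_det_gramMat_eq_sum (X : ℕ → 𝔼₂) (T : ℕ) : (gramMat X T).det ^ 2 =
    ∑ k ∈ (Finset.range (T + 1) ×ˢ Finset.range (T + 1)) ×ˢ
      (Finset.range (T + 1) ×ˢ Finset.range (T + 1)),
      gramWeight fun i => X ((![k.1.1, k.1.2, k.2.1, k.2.2] : Fin 4 → ℕ) i) := by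
  rw [sq, det_gramMat_eq_sum, ← Finset.sum_product', Finset.sum_mul_sum, ← Finset.sum_product']
  rfl

lemma integrable_gramWeight_sq (a : ℝ) {n : ℕ} (k : Fin 4 → ℕ) :
    Integrable (fun q => gramWeight (fun i => rotTraj a q (k i)) ^ 2) (rotGaussian 𝔼₂ n) := by
  choose C hC h using fun t => exists_norm_rotTraj_le (E := 𝔼₂) a (n := n) t
  have hbound : ∀ q : (Fin n → 𝔼₂) × (Fin n → 𝔼₂), |gramWeight (fun i => rotTraj a q (k i))|
      ≤ 4 * ((∑ i, C (k i)) * noiseNorm q) ^ 8 := fun q => by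
    refine abs_gramWeight_le _ fun i => (h (k i) q).trans ?_
    refine mul_le_mul_of_nonneg_right ?_ (noiseNorm_nonneg q)
    exact Finset.single_le_sum (f := fun i => C (k i)) (fun i _ => hC _) (Finset.mem_univ i)
  refine ((integrable_noiseNorm_pow n 16).const_mul (16 * (∑ i, C (k i)) ^ 16)).mono' ?_
    (Eventually.of_forall fun q => ?_)
  · exact ((continuous_gramWeight.comp (continuous_pi fun i =>
      continuous_rotTraj a (k i))).pow 2).aestronglyMeasurable
  · rw [norm_pow, Real.norm_eq_abs]
    calc _ ≤ (4 * ((∑ i, C (k i)) * noiseNorm q) ^ 8) ^ 2 :=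
          pow_le_pow_left₀ (abs_nonneg _) (hbound q) 2
      _ = _ := by ring

/-- One of the rows of a matrix carries at least half of its squared norm. -/
lemma exists_norm_adjoint_entryOp_ge (Ξ : 𝕍₄) :
    ∃ e : 𝔼₂, ‖e‖ ≤ 1 ∧ ‖Ξ‖ ^ 2 / 2 ≤ ‖(entryOp Ξ).adjoint e‖ ^ 2 := by
  have hrow : ∀ i j, (entryOp Ξ).adjoint (EuclideanSpace.single i 1) j = Ξ (i, j) := by
    intro i j
    have h1 : inner ℝ (EuclideanSpace.single j (1 : ℝ))
        ((entryOp Ξ).adjoint (EuclideanSpace.single i 1)) = Ξ (i, j) := by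
      rw [ContinuousLinearMap.adjoint_inner_right, EuclideanSpace.inner_single_right,
        entryOp_apply_apply]
      simp
    rw [← h1, EuclideanSpace.inner_single_left]
    simp
  have hsum : ‖Ξ‖ ^ 2 = ∑ i, ‖(entryOp Ξ).adjoint (EuclideanSpace.single i 1)‖ ^ 2 := by
    simp_rw [EuclideanSpace.norm_sq_eq, hrow, Fintype.sum_prod_type]
  by_contra! hcon
  have h0 := hcon (EuclideanSpace.single 0 1) (by simp)
  have h1 := hcon (EuclideanSpace.single 1 1) (by simp)
  rw [Fin.sum_univ_two] at hsum
  linarith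

lemma integrable_one_add_norm_sq_rpow (K : ℝ) {c : ℝ} (hc : 0 ≤ c) :
    Integrable fun Ξ : 𝕍₄ => K * (c * (1 + ‖Ξ‖ ^ 2)) ^ (-(5 / 2) : ℝ) := by
  have h1 : Integrable fun Ξ : 𝕍₄ => (1 + ‖Ξ‖ ^ 2) ^ (-(5 : ℝ) / 2) := by
    refine integrable_rpow_neg_one_add_norm_sq ?_
    rw [finrank_euclideanSpace, Fintype.card_prod, Fintype.card_fin]
    norm_num
  refine (h1.const_mul (K * c ^ (-(5 / 2) : ℝ))).congr (Eventually.of_forall fun Ξ => ?_)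
  simp only
  rw [Real.mul_rpow hc (by positivity), mul_assoc, neg_div]

lemma sqrt_decay_factor_le (a : ℝ) (ha : 0 ≤ a) {x y : ℝ} (hx : x / 2 ≤ y ^ 2) (hx0 : 0 ≤ x) :
    √(((1 + (y / (1 + a)) ^ 2) ^ (-(1 / 2) : ℝ)) ^ 10)
      ≤ (1 / (2 * (1 + a) ^ 2) * (1 + x)) ^ (-(5 / 2) : ℝ) := by
  have h1 : (0 : ℝ) ≤ 1 + (y / (1 + a)) ^ 2 := by positivity
  have h2 : √(((1 + (y / (1 + a)) ^ 2) ^ (-(1 / 2) : ℝ)) ^ 10)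
      = (1 + (y / (1 + a)) ^ 2) ^ (-(5 / 2) : ℝ) := by
    rw [← Real.rpow_natCast, ← Real.rpow_mul h1, Real.sqrt_eq_rpow, ← Real.rpow_mul h1]
    norm_num
  rw [h2]
  refine Real.rpow_le_rpow_of_nonpos (by positivity) ?_ (by norm_num)
  have h3 : (1 : ℝ) ≤ (1 + a) ^ 2 := one_le_pow₀ (by linarith)
  have h4 : (0 : ℝ) < (1 + a) ^ 2 := by positivity
  rw [div_pow, div_mul_eq_mul_div, one_mul, div_le_iff₀ (by positivity), add_mul]
  field_simp
  nlinarith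

lemma continuous_gramMat {Q : Type*} [TopologicalSpace Q] {d : ℕ}
    {X : Q → ℕ → EuclideanSpace ℝ (Fin d)} (hX : ∀ t, Continuous fun q => X q t) (T : ℕ) :
    Continuous fun q => gramMat (X q) T := by
  refine continuous_matrix fun i j => ?_
  simp only [gramMat_apply]
  have h := fun t i => (EuclideanSpace.proj (𝕜 := ℝ) i).continuous.comp (hX t)
  exact continuous_finsetSum _ fun t _ => (h t i).mul (h t j)

lemma continuous_crossMat {Q : Type*} [TopologicalSpace Q] {d : ℕ}
    {X : Q → ℕ → EuclideanSpace ℝ (Fin d)} (hX : ∀ t, Continuous fun q => X q t) (T : ℕ) :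
    Continuous fun q => crossMat (X q) T := by
  refine continuous_matrix fun i j => ?_
  simp only [crossMat_apply]
  have h := fun t i => (EuclideanSpace.proj (𝕜 := ℝ) i).continuous.comp (hX t)
  exact continuous_finsetSum _ fun t _ => (h (t + 1) i).mul (h t j)

lemma continuous_innovVec {Q : Type*} [TopologicalSpace Q] (a : ℝ) {X : Q → ℕ → 𝔼₂}
    (hX : ∀ t, Continuous fun q => X q t) (T : ℕ) : Continuous fun q => innovVec a (X q) T := by
  have h := (continuous_crossMat hX T).sub ((continuous_gramMat hX T).const_smul a)
  exact (PiLp.continuous_toLp 2 _).comp (continuous_pi fun p => h.matrix_elem p.1 p.2)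

lemma continuous_gramOp {Q : Type*} [TopologicalSpace Q] {X : Q → ℕ → 𝔼₂}
    (hX : ∀ t, Continuous fun q => X q t) (T : ℕ) : Continuous fun q => gramOp (X q) T := by
  have h1 : Continuous fun q => Matrix.kroneckerMap (· * ·) (1 : Matrix (Fin 2) (Fin 2) ℝ)
      (gramMat (X q) T).transpose := by
    refine continuous_matrix fun i j => ?_
    simp only [Matrix.kroneckerMap_apply, Matrix.transpose_apply]
    exact continuous_const.mul ((continuous_gramMat hX T).matrix_elem _ _)
  exact (LinearMap.continuous_of_finiteDimensional (Matrix.toEuclideanCLM (n := Fin 2 × Fin 2)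
    (𝕜 := ℝ)).toAlgEquiv.toLinearEquiv.toLinearMap).comp h1

lemma measurable_errVec {Q : Type*} [TopologicalSpace Q] [MeasurableSpace Q]
    [OpensMeasurableSpace Q] (a : ℝ) {X : Q → ℕ → 𝔼₂} (hX : ∀ t, Continuous fun q => X q t)
    (T : ℕ) : Measurable fun q => errVec a (X q) T := by
  have h := ((continuous_crossMat hX T).sub ((continuous_gramMat hX T).const_smul a)).matrix_mul
    (continuous_gramMat hX T).matrix_adjugate
  refine (PiLp.continuous_toLp 2 _).measurable.comp (measurable_pi_lambda _ fun p => ?_)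
  exact (continuous_gramMat hX T).matrix_det.measurable.inv.mul (h.matrix_elem p.1 p.2).measurable

/-- The least squares error matrix has a continuous density as soon as the Gram matrix is almost
surely invertible and `T` is large. -/
theorem exists_continuous_density_errVec (a : ℝ) (ha : 0 ≤ a) {n : ℕ} (T : ℕ)
    (hn : T + 1 ≤ 2 * n) (hT : 27 ≤ T)
    (hdet : ∀ᵐ q ∂(rotGaussian 𝔼₂ n), (gramMat (rotTraj a q) T).det ≠ 0) :
    ∃ p : 𝕍₄ → ℝ, Continuous p ∧ (∀ x, 0 ≤ p x) ∧
      HasLaw (fun q => errVec a (rotTraj a q) T)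
        (volume.withDensity fun x => ENNReal.ofReal (p x)) (rotGaussian 𝔼₂ n) := by
  let P := (Finset.range (T + 1) ×ˢ Finset.range (T + 1)) ×ˢ
    (Finset.range (T + 1) ×ˢ Finset.range (T + 1))
  let k : (ℕ × ℕ) × (ℕ × ℕ) → Fin 4 → ℕ := fun k => ![k.1.1, k.1.2, k.2.1, k.2.2]
  have hcont : ∀ t, Continuous fun q : (Fin n → 𝔼₂) × (Fin n → 𝔼₂) => rotTraj a q t :=
    continuous_rotTraj a
  have hD : ∀ q : (Fin n → 𝔼₂) × (Fin n → 𝔼₂), (gramMat (rotTraj a q) T).det ^ 2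
      = ∑ l ∈ P, gramWeight fun i => rotTraj a q (k l i) := fun q =>
    sq_det_gramMat_eq_sum (rotTraj a q) T
  have hwc : ∀ l, Continuous fun q : (Fin n → 𝔼₂) × (Fin n → 𝔼₂) =>
      gramWeight fun i => rotTraj a q (k l i) := fun l =>
    continuous_gramWeight.comp (continuous_pi fun i => hcont _)
  have hw2 := fun l => integrable_gramWeight_sq a (n := n) (k l)
  have hw1 : ∀ l, Integrable (fun q : (Fin n → 𝔼₂) × (Fin n → 𝔼₂) =>
      gramWeight fun i => rotTraj a q (k l i)) (rotGaussian 𝔼₂ n) := fun l =>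
    ((memLp_two_iff_integrable_sq (hwc l).aestronglyMeasurable).2 (hw2 l)).integrable
      one_le_two
  let K : ℝ := ∑ l ∈ P, √(∫ q, gramWeight (fun i => rotTraj a q (k l i)) ^ 2 ∂(rotGaussian 𝔼₂ n))
  refine exists_continuous_density_of_linear_equation (rotGaussian 𝔼₂ n)
    (fun q => innovVec a (rotTraj a q) T) (fun q => gramOp (rotTraj a q) T)
    (continuous_innovVec a hcont T) (continuous_gramOp hcont T)
    (fun q => (gramMat (rotTraj a q) T).det ^ 2) ((continuous_gramMat hcont T).matrix_det.pow 2)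
    (fun q => by rw [det_gramOp, abs_of_nonneg (sq_nonneg _)])
    (hdet.mono fun q hq => by rw [det_gramOp]; exact pow_ne_zero 2 hq)
    ?_ (fun Ξ => K * (1 / (2 * (1 + a) ^ 2) * (1 + ‖Ξ‖ ^ 2)) ^ (-(5 / 2) : ℝ))
    (integrable_one_add_norm_sq_rpow K (by positivity)) ?_ _
    (measurable_errVec a hcont T).aemeasurable (hdet.mono fun q hq => gramOp_errVec a hq)
  · simp_rw [hD]
    exact integrable_finsetSum _ fun l _ => hw1 l
  · intro B Ξ
    obtain ⟨e, he, hΞ⟩ := exists_norm_adjoint_entryOp_ge Ξ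
    have hcast : ∀ q : (Fin n → 𝔼₂) × (Fin n → 𝔼₂),
        (((gramMat (rotTraj a q) T).det ^ 2 : ℝ) : ℂ)
          = ∑ l ∈ P, ((gramWeight fun i => rotTraj a q (k l i) : ℝ) : ℂ) := fun q => by
      rw [hD, Complex.ofReal_sum]
    simp_rw [hcast, inner_innovVec_sub_gramOp, Finset.sum_mul]
    rw [integral_finsetSum]
    · simp only [K, Finset.sum_mul]
      refine (norm_sum_le _ _).trans (Finset.sum_le_sum fun l _ => ?_)
      have h := norm_integral_weighted_phase_le a ha T hn hT (k l) gramWeight continuous_gramWeight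
        (hw2 l) (entryOp Ξ) (a • ContinuousLinearMap.id ℝ _ + entryOp B) e he
      exact h.trans (mul_le_mul_of_nonneg_left (sqrt_decay_factor_le a ha hΞ (sq_nonneg _))
        (Real.sqrt_nonneg _))
    · intro l _
      refine ((hw1 l).ofReal (𝕜 := ℂ)).mul_bdd (c := 1) ?_ (Eventually.of_forall fun q => ?_)
      · refine Continuous.aestronglyMeasurable ?_
        simp only [phaseTerm]
        fun_prop
      · rw [Complex.norm_exp_ofReal_mul_I]

end ErrorDensity

/-! ### Almost sure uniqueness and the law of the error -/

lemma stdGaussian_hyperplane {E : Type*} [NormedAddCommGroup E] [InnerProductSpace ℝ E]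
    [FiniteDimensional ℝ E] [MeasurableSpace E] [BorelSpace E] {w : E} (hw : w ≠ 0) (c : ℝ) :
    stdGaussian E {v | inner ℝ w v = c} = 0 := by
  have h := IsGaussian.map_eq_gaussianReal (μ := stdGaussian E) (innerSL ℝ w)
  have hv : Var[innerSL ℝ w; stdGaussian E].toNNReal ≠ 0 := by
    rw [variance_dual_stdGaussian, innerSL_apply_norm, Ne, Real.toNNReal_eq_zero, not_le]
    have := norm_pos_iff.2 hw
    positivity
  have := nullSingletonClass_gaussianReal (μ := (stdGaussian E)[innerSL ℝ w]) hv
  have h2 : (stdGaussian E).map (innerSL ℝ w) {c} = 0 := by rw [h, measure_singleton]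
  rwa [Measure.map_apply (by fun_prop) (measurableSet_singleton c)] at h2

/-- The norm of the image of a random vector with continuous density under a linear isomorphism has
a continuous density. -/
lemma exists_continuous_density_norm_equiv {V F : Type*} [NormedAddCommGroup V]
    [InnerProductSpace ℝ V] [FiniteDimensional ℝ V] [MeasurableSpace V] [BorelSpace V]
    [NormedAddCommGroup F] [NormedSpace ℝ F] [MeasurableSpace F] [BorelSpace F] (φ : V ≃L[ℝ] F)
    (hdim : 2 ≤ Module.finrank ℝ V) {Ω : Type*} [MeasurableSpace Ω] {μ : Measure Ω} {Y : Ω → V}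
    {p : V → ℝ} (hpc : Continuous p) (hp0 : ∀ x, 0 ≤ p x)
    (hY : HasLaw Y (volume.withDensity fun x => ENNReal.ofReal (p x)) μ) :
    ∃ f : ℝ → ℝ, Continuous f ∧ (∀ x, 0 ≤ f x) ∧
      HasLaw (fun ω => ‖φ (Y ω)‖) (volume.withDensity fun x => ENNReal.ofReal (f x)) μ := by
  let ν : Measure F := (volume : Measure V).map φ
  have hν : ν.IsAddHaarMeasure := φ.isAddHaarMeasure_map volume
  have : FiniteDimensional ℝ F := φ.toLinearEquiv.finiteDimensional
  have hrank : 2 ≤ Module.finrank ℝ F := by rwa [← φ.toLinearEquiv.finrank_eq]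
  have : Nontrivial F := Module.nontrivial_of_finrank_pos (R := ℝ) (by omega)
  have hme : Measurable φ := φ.continuous.measurable
  refine exists_continuous_density_norm ν hrank μ _ _ (hpc.comp φ.symm.continuous)
    (fun x => hp0 _) ⟨hme.comp_aemeasurable hY.aemeasurable, ?_⟩
  rw [← Function.comp_def, ← AEMeasurable.map_map_of_aemeasurable hme.aemeasurable
    hY.aemeasurable, hY.map_eq]
  ext s hs
  have hdm : Measurable fun x : F => ENNReal.ofReal (p (φ.symm x)) :=
    (ENNReal.measurable_ofReal.comp hpc.measurable).comp φ.symm.continuous.measurable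
  rw [Measure.map_apply hme hs, withDensity_apply _ (hme hs)]
  simp only [Function.comp_apply]
  rw [withDensity_apply _ hs, setLIntegral_map hs hdm hme]
  simp only [ContinuousLinearEquiv.symm_apply_apply]

lemma ae_ne_zero_of_hasLaw_stdGaussian {Ω : Type*} [MeasurableSpace Ω] {μ : Measure Ω} {ξ : Ω → 𝔼₂}
    (h : HasLaw ξ (stdGaussian 𝔼₂) μ) : ∀ᵐ ω ∂μ, ξ ω ≠ 0 := by
  have hw : (EuclideanSpace.single 0 1 : 𝔼₂) ≠ 0 := by simp
  have h1 : ∀ᵐ v ∂(stdGaussian 𝔼₂), v ≠ 0 := by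
    rw [ae_iff]
    refine measure_mono_null ?_ (stdGaussian_hyperplane hw 0)
    intro v hv
    simp only [ne_eq, not_not, Set.mem_ofPred_eq] at hv ⊢
    rw [hv, inner_zero_right]
  rw [← h.map_eq] at h1
  exact ae_of_ae_map h.aemeasurable h1

lemma cross2_eq_inner (u v : 𝔼₂) : cross2 u v = inner ℝ (!₂[-u 1, u 0] : 𝔼₂) v := by
  simp [cross2, PiLp.inner_apply, Fin.sum_univ_two]
  ring

/-- A vector and an independent standard Gaussian vector are almost surely not parallel. -/
lemma ae_cross2_ne_zero {Ω : Type*} [MeasurableSpace Ω] {μ : Measure Ω} [IsProbabilityMeasure μ]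
    {ξ ζ : Ω → 𝔼₂} (hind : IndepFun ξ ζ μ) (hξ : AEMeasurable ξ μ)
    (hζ : HasLaw ζ (stdGaussian 𝔼₂) μ) (h0 : ∀ᵐ ω ∂μ, ξ ω ≠ 0) :
    ∀ᵐ ω ∂μ, cross2 (ξ ω) (ζ ω) ≠ 0 := by
  have hlaw := (indepFun_iff_map_prod_eq_prod_map_map hξ hζ.aemeasurable).1 hind
  rw [hζ.map_eq] at hlaw
  have := Measure.isProbabilityMeasure_map (μ := μ) hξ
  have hc : Continuous fun p : 𝔼₂ × 𝔼₂ => cross2 p.1 p.2 := by fun_prop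
  have hm : MeasurableSet {p : 𝔼₂ × 𝔼₂ | cross2 p.1 p.2 ≠ 0} :=
    (hc.measurable (measurableSet_singleton 0)).compl
  have h1 : ∀ᵐ p ∂((μ.map ξ).prod (stdGaussian 𝔼₂)), cross2 p.1 p.2 ≠ 0 := by
    rw [Measure.ae_prod_iff_ae_ae hm]
    have h2 : ∀ᵐ u ∂(μ.map ξ), u ≠ 0 :=
      (ae_map_iff hξ (measurableSet_singleton (0 : 𝔼₂)).compl).2 h0
    filter_upwards [h2] with u hu
    have hw : (!₂[-u 1, u 0] : 𝔼₂) ≠ 0 := by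
      intro h
      refine hu ?_
      ext i
      have h3 := congrArg (fun v : 𝔼₂ => v 0) h
      have h4 := congrArg (fun v : 𝔼₂ => v 1) h
      fin_cases i <;> simp_all
    rw [ae_iff]
    refine measure_mono_null ?_ (stdGaussian_hyperplane (E := 𝔼₂) hw 0)
    intro v hv
    simpa [cross2_eq_inner] using hv
  rw [← hlaw] at h1
  exact ae_of_ae_map (hξ.prodMk hζ.aemeasurable) h1

lemma gramMat_congr {d : ℕ} {X X' : ℕ → EuclideanSpace ℝ (Fin d)} {T : ℕ}
    (h : ∀ t ≤ T + 1, X t = X' t) : gramMat X T = gramMat X' T := by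
  unfold gramMat
  refine Finset.sum_congr rfl fun t ht => ?_
  rw [h t (by have := Finset.mem_range.1 ht; omega)]

lemma crossMat_congr {d : ℕ} {X X' : ℕ → EuclideanSpace ℝ (Fin d)} {T : ℕ}
    (h : ∀ t ≤ T + 1, X t = X' t) : crossMat X T = crossMat X' T := by
  unfold crossMat
  refine Finset.sum_congr rfl fun t ht => ?_
  rw [h t (by have := Finset.mem_range.1 ht; omega),
    h (t + 1) (by have := Finset.mem_range.1 ht; omega)]

lemma extendZero_restrict {E : Type*} [NormedAddCommGroup E] (X : ℕ → E) {m t : ℕ} (h : t < m) :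
    extendZero (fun i : Fin m => X i) t = X t := by
  simp [extendZero, h]

lemma ltiState_Ao (η : ℕ → 𝔼₂) (t : ℕ) : ltiState Ao η t = scalarTraj aRate η t := by
  induction t with
  | zero => rfl
  | succ t ih =>
    rw [ltiState, scalarTraj, ih, Ao_eq_smul_one, map_smul, map_one]
    rfl

section Law

variable {Ω : Type*} [MeasurableSpace Ω] {μ : Measure Ω} [IsProbabilityMeasure μ] {η : ℕ → Ω → 𝔼₂}

lemma ae_det_gramMat_pos (a : ℝ) (hind : iIndepFun (fun t => η (t + 1)) μ)
    (hlaw : ∀ t : ℕ, HasLaw (η (t + 1)) (stdGaussian 𝔼₂) μ) :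
    ∀ᵐ ω ∂μ, ∀ T : ℕ, 2 ≤ T → 0 < (gramMat (scalarTraj a fun s => η s ω) T).det := by
  have h01 : IndepFun (η 1) (η 2) μ := hind.indepFun (i := 0) (j := 1) (by norm_num)
  filter_upwards [ae_cross2_ne_zero h01 (hlaw 0).aemeasurable (hlaw 1)
    (ae_ne_zero_of_hasLaw_stdGaussian (hlaw 0))] with ω hω T hT
  refine lt_of_lt_of_le ?_ (sq_cross2_le_det_gramMat _ T (s := 1) (t := 2) (by norm_num)
    (by omega) hT)
  have h : cross2 (scalarTraj a (fun s => η s ω) 1) (scalarTraj a (fun s => η s ω) 2)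
      = cross2 (η 1 ω) (η 2 ω) := by
    simp only [scalarTraj, smul_zero, zero_add, cross2, PiLp.add_apply, PiLp.smul_apply,
      smul_eq_mul]
    ring
  rw [h]
  positivity

/-- The operator norm of the least squares error has a continuous density for large `T`. -/
theorem exists_continuous_density_norm_errVec (a : ℝ) (ha : 0 ≤ a)
    (hind : iIndepFun (fun t => η (t + 1)) μ)
    (hlaw : ∀ t : ℕ, HasLaw (η (t + 1)) (stdGaussian 𝔼₂) μ) (T : ℕ) (hT : 27 ≤ T) :
    ∃ f : ℝ → ℝ, Continuous f ∧ (∀ x, 0 ≤ f x) ∧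
      HasLaw (fun ω => ‖entryOp (errVec a (scalarTraj a fun s => η s ω) T)‖)
        (volume.withDensity fun x => ENNReal.ofReal (f x)) μ := by
  have htraj := map_scalarTraj_eq_map_rotTraj a hind hlaw (n := T + 1) (m := T + 2) (by omega)
  have hXm : AEMeasurable (fun ω (t : Fin (T + 2)) => scalarTraj a (fun s => η s ω) t) μ := by
    refine aemeasurable_pi_lambda _ fun t => ?_
    induction (t : ℕ) with
    | zero => exact aemeasurable_const
    | succ t ih => exact (ih.const_smul a).add (hlaw t).aemeasurable
  have hRm : Measurable fun (q : (Fin (T + 1) → 𝔼₂) × (Fin (T + 1) → 𝔼₂)) (t : Fin (T + 2)) =>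
      rotTraj a q t := measurable_pi_lambda _ fun t => (continuous_rotTraj a t).measurable
  have hext : ∀ t, Continuous fun x : Fin (T + 2) → 𝔼₂ => extendZero x t := continuous_extendZero
  have hgram : ∀ X : ℕ → 𝔼₂, gramMat (extendZero fun t : Fin (T + 2) => X t) T = gramMat X T :=
    fun X => gramMat_congr fun t ht => extendZero_restrict X (by omega)
  have hcross : ∀ X : ℕ → 𝔼₂, crossMat (extendZero fun t : Fin (T + 2) => X t) T = crossMat X T :=
    fun X => crossMat_congr fun t ht => extendZero_restrict X (by omega)
  have herr : ∀ X : ℕ → 𝔼₂, errVec a (extendZero fun t : Fin (T + 2) => X t) T = errVec a X T :=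
    fun X => by simp only [errVec, hgram, hcross]
  -- almost sure invertibility of the Gram matrix passes to the rotated coordinates
  have hdet : ∀ᵐ q ∂(rotGaussian 𝔼₂ (T + 1)), (gramMat (rotTraj a q) T).det ≠ 0 := by
    have hms : MeasurableSet {x : Fin (T + 2) → 𝔼₂ | (gramMat (extendZero x) T).det ≠ 0} :=
      ((continuous_gramMat hext T).matrix_det.measurable (measurableSet_singleton 0)).compl
    have h1 : ∀ᵐ x ∂(μ.map fun ω (t : Fin (T + 2)) => scalarTraj a (fun s => η s ω) t),
        (gramMat (extendZero x) T).det ≠ 0 := by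
      rw [ae_map_iff hXm hms]
      filter_upwards [ae_det_gramMat_pos a hind hlaw] with ω hω
      rw [hgram (scalarTraj a fun s => η s ω)]
      exact (hω T (by omega)).ne'
    rw [htraj] at h1
    filter_upwards [ae_of_ae_map hRm.aemeasurable h1] with q hq
    rwa [hgram (rotTraj a q)] at hq
  obtain ⟨p, hpc, hp0, hp⟩ := exists_continuous_density_errVec a ha T (by omega) hT hdet
  have hrank : 2 ≤ Module.finrank ℝ 𝕍₄ := by
    rw [finrank_euclideanSpace, Fintype.card_prod, Fintype.card_fin]
    norm_num
  obtain ⟨f, hf, hf0, hlawf⟩ := exists_continuous_density_norm_equiv entryOp hrank hpc hp0 hp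
  refine ⟨f, hf, hf0, ?_, ?_⟩
  all_goals
    have hGm : Measurable fun x : Fin (T + 2) → 𝔼₂ => ‖entryOp (errVec a (extendZero x) T)‖ :=
      (entryOp.continuous.norm).measurable.comp (measurable_errVec a hext T)
    have hG : (fun ω => ‖entryOp (errVec a (scalarTraj a fun s => η s ω) T)‖)
        = (fun x : Fin (T + 2) → 𝔼₂ => ‖entryOp (errVec a (extendZero x) T)‖) ∘
          fun ω (t : Fin (T + 2)) => scalarTraj a (fun s => η s ω) t := by
      ext1 ω
      simp only [Function.comp_apply, herr]
    rw [hG]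
  · exact hGm.comp_aemeasurable hXm
  · rw [← AEMeasurable.map_map_of_aemeasurable hGm.aemeasurable hXm, htraj,
      Measure.map_map hGm hRm, ← hlawf.map_eq]
    congr 1
    ext1 q
    simp only [Function.comp_apply, herr]

end Law

/-- In the regime `T² ≤ 1.1 ^ T` the trajectory is long enough for the decay estimates. -/
lemma le_of_sq_le_aRate_pow {T : ℕ} (hT : 2 ≤ T) (h : (T : ℝ) ^ 2 ≤ aRate ^ T) : 27 ≤ T := by
  by_contra! hlt
  unfold aRate at h
  interval_cases T <;> norm_num at h

/-! ### A lower bound for the least squares error -/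

section ErrorLowerBound

lemma cross2_self (u : 𝔼₂) : cross2 u u = 0 := by
  simp only [cross2]
  ring

lemma cross2_comm (u v : 𝔼₂) : cross2 u v = -cross2 v u := by
  simp only [cross2]
  ring

lemma cross2_add_right (u v w : 𝔼₂) : cross2 u (v + w) = cross2 u v + cross2 u w := by
  simp only [cross2, PiLp.add_apply]
  ring

lemma cross2_smul_right (r : ℝ) (u v : 𝔼₂) : cross2 u (r • v) = r * cross2 u v := by
  simp only [cross2, PiLp.smul_apply, smul_eq_mul]
  ring

lemma cross2_zero_right (u : 𝔼₂) : cross2 u 0 = 0 := by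
  simp [cross2]

/-- The trace of a least squares estimate, by Cramer's rule. -/
lemma IsOLS.trace_mul_det {X : ℕ → 𝔼₂} {T : ℕ} {B : Matrix (Fin 2) (Fin 2) ℝ} (h : IsOLS X T B) :
    B.trace * (gramMat X T).det = ∑ s ∈ Finset.range (T + 1), ∑ t ∈ Finset.range (T + 1),
      cross2 (X s) (X t) * cross2 (X s) (X (t + 1)) := by
  have h1 : B.trace * (gramMat X T).det = (crossMat X T * (gramMat X T).adjugate).trace := by
    rw [← h.mul_gramMat_eq, Matrix.mul_assoc, Matrix.mul_adjugate, Matrix.mul_smul, Matrix.mul_one,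
      Matrix.trace_smul, smul_eq_mul, mul_comm]
  rw [h1, Matrix.adjugate_fin_two, Matrix.trace_fin_two]
  simp only [Matrix.mul_apply, Fin.sum_univ_two, Matrix.of_apply, Matrix.cons_val', Matrix.cons_val,
    Matrix.cons_val_fin_one, gramMat_apply, crossMat_apply, mul_neg, Finset.sum_mul_sum, cross2]
  conv_rhs => rw [Finset.sum_comm]
  simp only [← Finset.sum_neg_distrib, ← Finset.sum_add_distrib]
  refine Finset.sum_congr rfl fun s _ => ?_
  refine Finset.sum_congr rfl fun t _ => ?_
  ring

/-- The Gram determinant as a sum over the pairs `t < s`. -/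
lemma det_gramMat_eq_sum_lt (X : ℕ → 𝔼₂) (T : ℕ) : (gramMat X T).det =
    ∑ s ∈ Finset.range (T + 1), ∑ t ∈ Finset.range (T + 1),
      if t < s then cross2 (X s) (X t) ^ 2 else 0 := by
  have h1 := two_mul_det_gramMat X T
  have h2 : ∑ s ∈ Finset.range (T + 1), ∑ t ∈ Finset.range (T + 1), cross2 (X s) (X t) ^ 2
      = ∑ s ∈ Finset.range (T + 1), ∑ t ∈ Finset.range (T + 1),
          (if t < s then cross2 (X s) (X t) ^ 2 else 0)
        + ∑ s ∈ Finset.range (T + 1), ∑ t ∈ Finset.range (T + 1),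
          (if s < t then cross2 (X s) (X t) ^ 2 else 0) := by
    simp only [← Finset.sum_add_distrib]
    refine Finset.sum_congr rfl fun s _ => Finset.sum_congr rfl fun t _ => ?_
    rcases lt_trichotomy s t with hst | rfl | hst
    · simp [hst, hst.le]
    · simp [cross2_self]
    · simp [hst, hst.le]
  have h3 : ∑ s ∈ Finset.range (T + 1), ∑ t ∈ Finset.range (T + 1),
          (if s < t then cross2 (X s) (X t) ^ 2 else 0)
      = ∑ s ∈ Finset.range (T + 1), ∑ t ∈ Finset.range (T + 1),
          (if t < s then cross2 (X s) (X t) ^ 2 else 0) := by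
    rw [Finset.sum_comm]
    refine Finset.sum_congr rfl fun s _ => Finset.sum_congr rfl fun t _ => ?_
    rw [cross2_comm, neg_sq]
  linarith

lemma det_gramMat_eq_sum_gt (X : ℕ → 𝔼₂) (T : ℕ) : (gramMat X T).det =
    ∑ s ∈ Finset.range (T + 1), ∑ t ∈ Finset.range (T + 1),
      if s < t then cross2 (X s) (X t) ^ 2 else 0 := by
  rw [det_gramMat_eq_sum_lt, Finset.sum_comm]
  refine Finset.sum_congr rfl fun s _ => Finset.sum_congr rfl fun t _ => ?_
  rw [cross2_comm, neg_sq]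

/-- The interaction of the noise with the earlier states. -/
def noiseEnergy (X η : ℕ → 𝔼₂) (T : ℕ) : ℝ :=
  ∑ s ∈ Finset.range (T + 1), ∑ t ∈ Finset.range (T + 1),
    if s < t then cross2 (X s) (η (t + 1)) ^ 2 else 0

/-- The pairs `t < s` contribute at most `det S` to the trace, since
`[X_s, X_t][X_s, X_{t+1}] ≤ ([X_s, X_t]² + [X_s, X_{t+1}]²) / 2`, where the sum of the right-hand
sides over `t < s` telescopes to `∑ [X_s, X_t]²`. -/
lemma sum_lt_cross2_mul_le (X : ℕ → 𝔼₂) (h0 : X 0 = 0) (T : ℕ) :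
    ∑ s ∈ Finset.range (T + 1), ∑ t ∈ Finset.range (T + 1),
      (if t < s then cross2 (X s) (X t) * cross2 (X s) (X (t + 1)) else 0)
        ≤ (gramMat X T).det := by
  rw [det_gramMat_eq_sum_lt]
  refine Finset.sum_le_sum fun s hs => ?_
  rw [← Finset.sum_filter, ← Finset.sum_filter]
  have hf : (Finset.range (T + 1)).filter (· < s) = Finset.range s := by
    ext t
    simp only [Finset.mem_filter, Finset.mem_range] at hs ⊢
    omega
  rw [hf]
  have htel : ∑ t ∈ Finset.range s, cross2 (X s) (X (t + 1)) ^ 2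
      = ∑ t ∈ Finset.range s, cross2 (X s) (X t) ^ 2 := by
    have h1 := Finset.sum_range_succ' (fun t => cross2 (X s) (X t) ^ 2) s
    have h2 := Finset.sum_range_succ (fun t => cross2 (X s) (X t) ^ 2) s
    simp only [h0, cross2_self, cross2_zero_right] at h1 h2
    linarith
  calc _ ≤ ∑ t ∈ Finset.range s,
        (cross2 (X s) (X t) ^ 2 / 2 + cross2 (X s) (X (t + 1)) ^ 2 / 2) :=
        Finset.sum_le_sum fun t _ => by
          nlinarith [sq_nonneg (cross2 (X s) (X t) - cross2 (X s) (X (t + 1)))]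
    _ = _ := by
        rw [Finset.sum_add_distrib, ← Finset.sum_div, ← Finset.sum_div, htel]
        ring

/-- The trace of the error is at most `1 - a` up to the interaction with the noise. -/
lemma IsOLS.trace_sub_mul_det_le {a : ℝ} {X η : ℕ → 𝔼₂} (h0 : X 0 = 0)
    (hX : ∀ t, X (t + 1) = a • X t + η (t + 1)) {T : ℕ} {B : Matrix (Fin 2) (Fin 2) ℝ}
    (h : IsOLS X T B) : (B.trace - 2 * a) * (gramMat X T).det
      ≤ (1 - a) * (gramMat X T).det + √((gramMat X T).det * noiseEnergy X η T) := by
  set R := Finset.range (T + 1) with hR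
  have hsplit : ∑ s ∈ R, ∑ t ∈ R, cross2 (X s) (X t) * cross2 (X s) (X (t + 1))
      = ∑ s ∈ R, ∑ t ∈ R, (if t < s then cross2 (X s) (X t) * cross2 (X s) (X (t + 1)) else 0)
        + a * ∑ s ∈ R, ∑ t ∈ R, (if s < t then cross2 (X s) (X t) ^ 2 else 0)
        + ∑ s ∈ R, ∑ t ∈ R, (if s < t then cross2 (X s) (X t) else 0) *
          (if s < t then cross2 (X s) (η (t + 1)) else 0) := by
    simp only [Finset.mul_sum, ← Finset.sum_add_distrib]
    refine Finset.sum_congr rfl fun s _ => Finset.sum_congr rfl fun t _ => ?_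
    rcases lt_trichotomy s t with hst | rfl | hst
    · simp only [hst, hst.not_gt, if_true, if_false, hX t, cross2_add_right, cross2_smul_right]
      ring
    · simp [cross2_self]
    · simp only [hst, hst.not_gt, if_true, if_false]
      ring
  have hcs : ∑ s ∈ R, ∑ t ∈ R, (if s < t then cross2 (X s) (X t) else 0) *
      (if s < t then cross2 (X s) (η (t + 1)) else 0)
        ≤ √((gramMat X T).det * noiseEnergy X η T) := by
    refine Real.le_sqrt_of_sq_le ?_
    rw [det_gramMat_eq_sum_gt, noiseEnergy, ← Finset.sum_product', ← Finset.sum_product',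
      ← Finset.sum_product']
    refine (Finset.sum_mul_sq_le_sq_mul_sq _ _ _).trans_eq ?_
    simp only [ite_pow, ne_eq, OfNat.ofNat_ne_zero, not_false_eq_true, zero_pow, hR]
  have hle := sum_lt_cross2_mul_le X h0 T
  have htr := h.trace_mul_det
  rw [hsplit, ← det_gramMat_eq_sum_gt] at htr
  linarith

lemma abs_trace_le_two_mul_opNorm2 (M : Matrix (Fin 2) (Fin 2) ℝ) : |M.trace| ≤ 2 * opNorm2 M := by
  have hentry : ∀ i, |M i i| ≤ opNorm2 M := by
    intro i
    have h1 : M i i = Matrix.toEuclideanCLM (𝕜 := ℝ) M (EuclideanSpace.single i 1) i := by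
      simp
    rw [h1]
    refine (abs_apply_le_norm _ i).trans ?_
    refine (ContinuousLinearMap.le_opNorm _ _).trans_eq ?_
    rw [PiLp.norm_single, norm_one, mul_one, opNorm2]
  rw [Matrix.trace_fin_two]
  linarith [abs_add_le (M 0 0) (M 1 1), hentry 0, hentry 1]

/-- If the noise interacts little with the earlier states then the least squares error is bounded
below. -/
theorem IsOLS.le_opNorm2_sub {X η : ℕ → 𝔼₂} (h0 : X 0 = 0)
    (hX : ∀ t, X (t + 1) = aRate • X t + η (t + 1)) {T : ℕ} {B : Matrix (Fin 2) (Fin 2) ℝ}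
    (h : IsOLS X T B) (hdet : 0 < (gramMat X T).det)
    (hN : noiseEnergy X η T ≤ (1 / 20) ^ 2 * (gramMat X T).det) :
    1 / 40 ≤ opNorm2 (B - Ao) := by
  have h1 := h.trace_sub_mul_det_le h0 hX
  have h2 : √((gramMat X T).det * noiseEnergy X η T) ≤ 1 / 20 * (gramMat X T).det := by
    refine Real.sqrt_le_iff.2 ⟨by positivity, ?_⟩
    nlinarith
  have h3 : (B - Ao).trace = B.trace - 2 * aRate := by
    rw [Matrix.trace_sub, Ao, Matrix.trace_fin_two_of]
    ring
  have h4 : (B - Ao).trace ≤ -(1 / 20) := by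
    rw [h3]
    refine le_of_mul_le_mul_right ?_ hdet
    unfold aRate at h1 ⊢
    linarith
  have h5 := abs_trace_le_two_mul_opNorm2 (B - Ao)
  have h6 := neg_abs_le (B - Ao).trace
  linarith

end ErrorLowerBound

/-! ### Singular values of the sample covariance -/

section SingularValues

variable {d : ℕ}

/-- The squared norm of `M x` in a basis of right singular vectors. -/
lemma exists_norm_sq_eq_sum_matSingularValue (M : Matrix (Fin d) (Fin d) ℝ) :
    ∃ b : OrthonormalBasis (Fin d) ℝ (EuclideanSpace ℝ (Fin d)), ∀ x,
      ‖Matrix.toEuclideanLin M x‖ ^ 2 = ∑ i : Fin d, matSingularValue M i ^ 2 * b.repr x i ^ 2 := by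
  have hn : Module.finrank ℝ (EuclideanSpace ℝ (Fin d)) = d := finrank_euclideanSpace_fin
  set S := Matrix.toEuclideanLin M with hS
  have hsym := S.isSymmetric_adjoint_comp_self
  refine ⟨hsym.eigenvectorBasis hn, fun x => ?_⟩
  have h1 : ‖S x‖ ^ 2 = inner ℝ x ((S.adjoint ∘ₗ S) x) := by
    rw [LinearMap.comp_apply, LinearMap.adjoint_inner_right, real_inner_self_eq_norm_sq]
  rw [h1, ← (hsym.eigenvectorBasis hn).repr.inner_map_map, PiLp.inner_apply]
  refine Finset.sum_congr rfl fun i _ => ?_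
  rw [LinearMap.IsSymmetric.eigenvectorBasis_apply_self_apply, matSingularValue,
    LinearMap.sq_singularValues_fin _ hn]
  simp only [RCLike.inner_apply, conj_trivial, RCLike.ofReal_real_eq_id, id_eq]
  ring

lemma matSingularValue_nonneg (M : Matrix (Fin d) (Fin d) ℝ) (i : ℕ) : 0 ≤ matSingularValue M i :=
  LinearMap.singularValues_nonneg _ _

lemma norm_le_matSingularValue_zero_mul (M : Matrix (Fin d) (Fin d) ℝ)
    (x : EuclideanSpace ℝ (Fin d)) :
    ‖Matrix.toEuclideanLin M x‖ ≤ matSingularValue M 0 * ‖x‖ := by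
  obtain ⟨b, hb⟩ := exists_norm_sq_eq_sum_matSingularValue M
  refine le_of_sq_le_sq ?_ (mul_nonneg (matSingularValue_nonneg M 0) (norm_nonneg x))
  rw [hb, mul_pow, ← b.repr.norm_map x, EuclideanSpace.norm_sq_eq, Finset.mul_sum]
  refine Finset.sum_le_sum fun i _ => ?_
  rw [Real.norm_eq_abs, sq_abs]
  exact mul_le_mul_of_nonneg_right (pow_le_pow_left₀ (matSingularValue_nonneg M i)
    (LinearMap.singularValues_antitone _ (Nat.zero_le i)) 2) (sq_nonneg _)

lemma matSingularValue_last_mul_norm_le (M : Matrix (Fin (d + 1)) (Fin (d + 1)) ℝ)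
    (x : EuclideanSpace ℝ (Fin (d + 1))) :
    matSingularValue M d * ‖x‖ ≤ ‖Matrix.toEuclideanLin M x‖ := by
  obtain ⟨b, hb⟩ := exists_norm_sq_eq_sum_matSingularValue M
  refine le_of_sq_le_sq ?_ (norm_nonneg _)
  rw [hb, mul_pow, ← b.repr.norm_map x, EuclideanSpace.norm_sq_eq, Finset.mul_sum]
  refine Finset.sum_le_sum fun i _ => ?_
  rw [Real.norm_eq_abs, sq_abs]
  exact mul_le_mul_of_nonneg_right (pow_le_pow_left₀ (matSingularValue_nonneg M d)
    (LinearMap.singularValues_antitone _ (Nat.le_of_lt_succ i.2)) 2) (sq_nonneg _)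

lemma exists_norm_eq_matSingularValue (M : Matrix (Fin d) (Fin d) ℝ) (i : Fin d) :
    ∃ x : EuclideanSpace ℝ (Fin d), ‖x‖ = 1 ∧ ‖Matrix.toEuclideanLin M x‖ = matSingularValue M i := by
  obtain ⟨b, hb⟩ := exists_norm_sq_eq_sum_matSingularValue M
  refine ⟨b i, b.norm_eq_one i, ?_⟩
  refine (sq_eq_sq₀ (norm_nonneg _) (matSingularValue_nonneg M i)).1 ?_
  rw [hb, Finset.sum_eq_single i]
  · simp
  · intro j _ hj
    simp [hj]
  · simp

variable (X : ℕ → EuclideanSpace ℝ (Fin d)) (T : ℕ)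

lemma toEuclideanLin_gramMat (x : EuclideanSpace ℝ (Fin d)) :
    Matrix.toEuclideanLin (gramMat X T) x
      = ∑ t ∈ Finset.range (T + 1), (inner ℝ (X t) x : ℝ) • X t := by
  rw [gramMat, map_sum, LinearMap.sum_apply]
  refine Finset.sum_congr rfl fun t _ => ?_
  ext i
  simp only [Matrix.toLpLin_apply, Matrix.vecMulVec_mulVec, PiLp.smul_apply, smul_eq_mul,
    PiLp.inner_apply, RCLike.inner_apply, conj_trivial, Pi.smul_apply, dotProduct, op_smul_eq_smul]
  simp only [mul_comm]

lemma matSingularValue_gramMat_zero_le [NeZero d] :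
    matSingularValue (gramMat X T) 0 ≤ ∑ t ∈ Finset.range (T + 1), ‖X t‖ ^ 2 := by
  obtain ⟨x, hx, h⟩ := exists_norm_eq_matSingularValue (gramMat X T) 0
  rw [Fin.val_zero] at h
  rw [← h, toEuclideanLin_gramMat]
  refine (norm_sum_le _ _).trans (Finset.sum_le_sum fun t _ => ?_)
  rw [norm_smul, sq]
  refine mul_le_mul_of_nonneg_right ?_ (norm_nonneg _)
  simpa [hx] using norm_inner_le_norm (𝕜 := ℝ) (X t) x

lemma norm_sq_le_matSingularValue_gramMat_zero {s : ℕ} (hs : s ≤ T) :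
    ‖X s‖ ^ 2 ≤ matSingularValue (gramMat X T) 0 := by
  rcases eq_or_ne (X s) 0 with h0 | h0
  · rw [h0, norm_zero, zero_pow two_ne_zero]
    exact matSingularValue_nonneg _ _
  have hpos : 0 < ‖X s‖ ^ 2 := by
    have := norm_pos_iff.2 h0
    positivity
  refine le_of_mul_le_mul_right ?_ hpos
  calc ‖X s‖ ^ 2 * ‖X s‖ ^ 2 = inner ℝ (X s) (X s) * inner ℝ (X s) (X s) := by
        rw [real_inner_self_eq_norm_sq]
    _ ≤ ∑ t ∈ Finset.range (T + 1), inner ℝ (X t) (X s) * inner ℝ (X t) (X s) :=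
        Finset.single_le_sum (f := fun t => (inner ℝ (X t) (X s) * inner ℝ (X t) (X s) : ℝ))
          (fun t _ => mul_self_nonneg _) (Finset.mem_range.2 (by omega))
    _ = inner ℝ (Matrix.toEuclideanLin (gramMat X T) (X s)) (X s) := by
        simp only [toEuclideanLin_gramMat, sum_inner, inner_smul_left, conj_trivial]
    _ ≤ ‖Matrix.toEuclideanLin (gramMat X T) (X s)‖ * ‖X s‖ := real_inner_le_norm _ _
    _ ≤ matSingularValue (gramMat X T) 0 * ‖X s‖ * ‖X s‖ :=
        mul_le_mul_of_nonneg_right (norm_le_matSingularValue_zero_mul _ _) (norm_nonneg _)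
    _ = _ := by ring

end SingularValues

/-- The smaller singular value of a planar Gram matrix is at most the quadratic form in any
direction, here the one orthogonal to `Z`. -/
lemma matSingularValue_gramMat_one_mul_le (X : ℕ → 𝔼₂) (T : ℕ) {Z : 𝔼₂} (hZ : Z ≠ 0) :
    matSingularValue (gramMat X T) 1 * ‖Z‖ ^ 2 ≤ ∑ t ∈ Finset.range (T + 1), cross2 Z (X t) ^ 2 := by
  have hZ2 : ‖Z‖ ^ 2 = Z 0 ^ 2 + Z 1 ^ 2 := by
    rw [EuclideanSpace.norm_sq_eq, Fin.sum_univ_two, Real.norm_eq_abs, Real.norm_eq_abs, sq_abs,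
      sq_abs]
  have hZpos : 0 < ‖Z‖ := norm_pos_iff.2 hZ
  set S := gramMat X T with hS
  have hsym : S 1 0 = S 0 1 := by
    simp only [hS, gramMat_apply, mul_comm]
  have hq : ∑ t ∈ Finset.range (T + 1), cross2 Z (X t) ^ 2
      = Z 0 ^ 2 * S 1 1 - 2 * Z 0 * Z 1 * S 0 1 + Z 1 ^ 2 * S 0 0 := by
    simp only [hS, gramMat_apply, cross2, Finset.mul_sum, ← Finset.sum_sub_distrib,
      ← Finset.sum_add_distrib]
    exact Finset.sum_congr rfl fun t _ => by ring
  have hdet0 : 0 ≤ S.det := by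
    have h := two_mul_det_gramMat X T
    have : 0 ≤ ∑ s ∈ Finset.range (T + 1), ∑ t ∈ Finset.range (T + 1), cross2 (X s) (X t) ^ 2 := by
      positivity
    linarith
  rcases hdet0.eq_or_lt with hdet | hdet
  · obtain ⟨v, hv, hSv⟩ := Matrix.exists_mulVec_eq_zero_iff.2 hdet.symm
    have h1 := matSingularValue_last_mul_norm_le S (WithLp.toLp 2 v)
    rw [Matrix.toLpLin_toLp, Matrix.toLin'_apply, hSv, WithLp.toLp_zero, norm_zero] at h1
    have h2 : 0 < ‖WithLp.toLp 2 v‖ := norm_pos_iff.2 (by simpa using hv)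
    have h3 : matSingularValue S 1 = 0 :=
      le_antisymm (nonpos_of_mul_nonpos_left h1 h2) (matSingularValue_nonneg S 1)
    rw [h3, zero_mul]
    positivity
  -- test the smaller singular value with `x = adj(S) J Z`, where `S x = det S • J Z`
  set x : 𝔼₂ := !₂[-S 1 1 * Z 1 - S 0 1 * Z 0, S 0 1 * Z 1 + S 0 0 * Z 0] with hx
  set J : 𝔼₂ := !₂[-Z 1, Z 0] with hJ
  have hJn : ‖J‖ = ‖Z‖ := by
    refine (sq_eq_sq₀ (norm_nonneg _) (norm_nonneg _)).1 ?_
    rw [hZ2, EuclideanSpace.norm_sq_eq, Fin.sum_univ_two, Real.norm_eq_abs, Real.norm_eq_abs,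
      sq_abs, sq_abs]
    simp [hJ]
    ring
  have hSx : Matrix.toEuclideanLin S x = S.det • J := by
    ext i
    fin_cases i
    · simp [hx, hJ, Matrix.det_fin_two, hsym]
      ring
    · simp [hx, hJ, Matrix.det_fin_two, hsym]
      ring
  set w : ℝ := Z 0 ^ 2 * S 0 0 + 2 * Z 0 * Z 1 * S 0 1 + Z 1 ^ 2 * S 1 1 with hw
  have hJx : inner ℝ J x = w := by
    simp only [PiLp.inner_apply, Fin.sum_univ_two, RCLike.inner_apply, conj_trivial, hx, hJ, hw]
    simp
    ring
  have h1 : matSingularValue S 1 * ‖x‖ ≤ S.det * ‖Z‖ := by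
    refine (matSingularValue_last_mul_norm_le S x).trans_eq ?_
    rw [hSx, norm_smul, Real.norm_of_nonneg hdet0, hJn]
  have h2 : w ≤ ‖Z‖ * ‖x‖ := by
    rw [← hJx, ← hJn]
    exact real_inner_le_norm _ _
  have h3 : S.det * (‖Z‖ ^ 2) ^ 2 ≤ w * ∑ t ∈ Finset.range (T + 1), cross2 Z (X t) ^ 2 := by
    rw [hq, hZ2, Matrix.det_fin_two, hsym, hw]
    nlinarith [sq_nonneg (Z 0 * Z 1 * (S 1 1 - S 0 0) + (Z 0 ^ 2 - Z 1 ^ 2) * S 0 1)]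
  have h4 : 0 < w := by
    have h5 : 0 < w * ∑ t ∈ Finset.range (T + 1), cross2 Z (X t) ^ 2 :=
      lt_of_lt_of_le (by positivity) h3
    exact pos_of_mul_pos_left h5 (by positivity)
  refine le_of_mul_le_mul_left ?_ h4
  calc w * (matSingularValue S 1 * ‖Z‖ ^ 2)
      ≤ ‖Z‖ * ‖x‖ * (matSingularValue S 1 * ‖Z‖ ^ 2) :=
        mul_le_mul_of_nonneg_right h2 (mul_nonneg (matSingularValue_nonneg S 1) (by positivity))
    _ = matSingularValue S 1 * ‖x‖ * ‖Z‖ ^ 3 := by ring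
    _ ≤ S.det * ‖Z‖ * ‖Z‖ ^ 3 := mul_le_mul_of_nonneg_right h1 (by positivity)
    _ = S.det * (‖Z‖ ^ 2) ^ 2 := by ring
    _ ≤ _ := h3

/-! ### Growth of a trajectory with tame noise -/

lemma aRate_pos : 0 < aRate := by norm_num [aRate]

lemma sum_aRate_pow_le (T : ℕ) : ∑ t ∈ Finset.range (T + 1), aRate ^ t ≤ 11 * aRate ^ T := by
  induction T with
  | zero => norm_num
  | succ T ih =>
    rw [Finset.sum_range_succ, pow_succ]
    have := pow_pos aRate_pos T
    unfold aRate at *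
    linarith

lemma sum_aRate_pow_two_mul_le (T : ℕ) :
    ∑ t ∈ Finset.range (T + 1), aRate ^ (2 * t) ≤ 6 * aRate ^ (2 * T) := by
  induction T with
  | zero => norm_num
  | succ T ih =>
    rw [Finset.sum_range_succ, Nat.mul_succ, pow_add]
    have := pow_pos aRate_pos (2 * T)
    unfold aRate at *
    linarith

/-- The squared norms of the noise vectors grow slower than linearly. -/
def SublinearNoise (η : ℕ → 𝔼₂) : Prop :=
  ∀ ε : ℝ, 0 < ε → ∃ C : ℝ, 0 ≤ C ∧ ∀ t : ℕ, ‖η (t + 1)‖ ^ 2 ≤ C + ε * (t + 1)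

/-- Tame noise is dominated by a slow exponential. The base `26 / 25` is chosen below `√1.1`, so that
the squares of such errors stay below `1.1 ^ t`. -/
lemma SublinearNoise.exists_norm_le {η : ℕ → 𝔼₂} (h : SublinearNoise η) :
    ∃ W : ℝ, 0 ≤ W ∧ ∀ t, ‖η (t + 1)‖ ≤ W * (26 / 25 : ℝ) ^ (t + 1) := by
  obtain ⟨C, hC, h⟩ := h 1 one_pos
  refine ⟨√(C + 25), Real.sqrt_nonneg _, fun t => ?_⟩
  have hb : (1 : ℝ) + (t + 1 : ℕ) * (1 / 25) ≤ (1 + 1 / 25) ^ (t + 1) :=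
    one_add_mul_le_pow (by norm_num) _
  have hb1 : (1 : ℝ) ≤ (26 / 25 : ℝ) ^ (t + 1) := one_le_pow₀ (by norm_num)
  norm_num at hb
  refine le_of_sq_le_sq ?_ (by positivity)
  rw [mul_pow, Real.sq_sqrt (by positivity)]
  have h1 := h t
  calc ‖η (t + 1)‖ ^ 2 ≤ (C + 25) * (26 / 25 : ℝ) ^ (t + 1) := by
        nlinarith
    _ ≤ (C + 25) * ((26 / 25 : ℝ) ^ (t + 1)) ^ 2 := by
        refine mul_le_mul_of_nonneg_left ?_ (by positivity)
        nlinarith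

/-- The normalized trajectory converges, geometrically fast. -/
lemma SublinearNoise.exists_limit {η : ℕ → 𝔼₂} (h : SublinearNoise η) :
    ∃ (Z : 𝔼₂) (K : ℝ), 0 ≤ K ∧
      Tendsto (fun t => (aRate ^ t)⁻¹ • scalarTraj aRate η t) atTop (𝓝 Z) ∧
      ∀ t, ‖scalarTraj aRate η t - aRate ^ t • Z‖ ≤ K * (26 / 25 : ℝ) ^ t := by
  obtain ⟨W, hW, hη⟩ := h.exists_norm_le
  set f : ℕ → 𝔼₂ := fun t => (aRate ^ t)⁻¹ • scalarTraj aRate η t with hf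
  have ha := aRate_pos
  have hstep : ∀ t, dist (f t) (f (t + 1)) ≤ W * (52 / 55) * (52 / 55 : ℝ) ^ t := by
    intro t
    have h1 : f (t + 1) - f t = (aRate ^ (t + 1))⁻¹ • η (t + 1) := by
      simp only [hf, scalarTraj, smul_add, smul_smul]
      rw [show (aRate ^ (t + 1))⁻¹ * aRate = (aRate ^ t)⁻¹ by rw [pow_succ]; field_simp]
      abel
    rw [dist_comm, dist_eq_norm, h1, norm_smul, Real.norm_of_nonneg (by positivity)]
    calc (aRate ^ (t + 1))⁻¹ * ‖η (t + 1)‖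
        ≤ (aRate ^ (t + 1))⁻¹ * (W * (26 / 25 : ℝ) ^ (t + 1)) :=
          mul_le_mul_of_nonneg_left (hη t) (by positivity)
      _ = W * (52 / 55 : ℝ) ^ (t + 1) := by
          rw [show (52 / 55 : ℝ) = (26 / 25) / aRate by norm_num [aRate],
            div_pow (26 / 25 : ℝ) aRate, div_eq_mul_inv]
          ring
      _ = _ := by ring
  obtain ⟨Z, hZ⟩ := cauchySeq_tendsto_of_complete
    (cauchySeq_of_le_geometric _ _ (by norm_num) hstep)
  refine ⟨Z, W * (52 / 55) / (1 - 52 / 55), by positivity, hZ, fun t => ?_⟩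
  have h2 := dist_le_of_le_geometric_of_tendsto _ _ (by norm_num) hstep hZ t
  have h3 : scalarTraj aRate η t - aRate ^ t • Z = aRate ^ t • (f t - Z) := by
    simp only [hf, smul_sub, smul_smul]
    rw [mul_inv_cancel₀ (by positivity), one_smul]
  rw [h3, norm_smul, Real.norm_of_nonneg (by positivity), ← dist_eq_norm]
  calc aRate ^ t * dist (f t) Z
      ≤ aRate ^ t * (W * (52 / 55) * (52 / 55 : ℝ) ^ t / (1 - 52 / 55)) :=
        mul_le_mul_of_nonneg_left h2 (by positivity)
    _ = W * (52 / 55) / (1 - 52 / 55) * (aRate * (52 / 55)) ^ t := by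
        rw [mul_pow]
        ring
    _ = _ := by norm_num [aRate]

lemma norm_le_of_norm_sub_pow_smul_le {X : ℕ → 𝔼₂} {Z : 𝔼₂} {K : ℝ} (hK : 0 ≤ K)
    (h : ∀ t, ‖X t - aRate ^ t • Z‖ ≤ K * (26 / 25 : ℝ) ^ t) (t : ℕ) :
    ‖X t‖ ≤ (K + ‖Z‖) * aRate ^ t := by
  have h1 : ‖X t‖ ≤ ‖X t - aRate ^ t • Z‖ + ‖aRate ^ t • Z‖ := norm_le_norm_sub_add _ _
  have h2 : (26 / 25 : ℝ) ^ t ≤ aRate ^ t :=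
    pow_le_pow_left₀ (by norm_num) (by norm_num [aRate]) t
  rw [norm_smul, Real.norm_of_nonneg (pow_nonneg aRate_pos.le t)] at h1
  have h3 := mul_le_mul_of_nonneg_left h2 hK
  have h4 := h t
  linarith

lemma eventually_le_norm_scalarTraj {X : ℕ → 𝔼₂} {Z : 𝔼₂} (hZ : Z ≠ 0)
    (h : Tendsto (fun t => (aRate ^ t)⁻¹ • X t) atTop (𝓝 Z)) :
    ∀ᶠ t in atTop, ‖Z‖ / 2 * aRate ^ t ≤ ‖X t‖ := by
  have h1 : ‖Z‖ / 2 < ‖Z‖ := half_lt_self (norm_pos_iff.2 hZ)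
  filter_upwards [h.norm.eventually (lt_mem_nhds h1)] with t ht
  have hp := pow_pos aRate_pos t
  rw [norm_smul, norm_inv, Real.norm_of_nonneg hp.le] at ht
  rw [← le_inv_mul_iff₀' hp]
  exact ht.le

lemma sum_norm_sq_le {X : ℕ → 𝔼₂} {W : ℝ} (hX : ∀ t, ‖X t‖ ≤ W * aRate ^ t) (T : ℕ) :
    ∑ t ∈ Finset.range (T + 1), ‖X t‖ ^ 2 ≤ 6 * W ^ 2 * aRate ^ (2 * T) := by
  calc _ ≤ ∑ t ∈ Finset.range (T + 1), W ^ 2 * aRate ^ (2 * t) :=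
        Finset.sum_le_sum fun t _ => (pow_le_pow_left₀ (norm_nonneg _) (hX t) 2).trans_eq (by ring)
    _ ≤ W ^ 2 * (6 * aRate ^ (2 * T)) := by
        rw [← Finset.mul_sum]
        exact mul_le_mul_of_nonneg_left (sum_aRate_pow_two_mul_le T) (sq_nonneg _)
    _ = _ := by ring

lemma sq_cross2_le (u v : 𝔼₂) : cross2 u v ^ 2 ≤ 4 * ‖u‖ ^ 2 * ‖v‖ ^ 2 := by
  have := pow_le_pow_left₀ (abs_nonneg _) (abs_cross2_le u v) 2
  rw [sq_abs] at this
  linarith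

lemma noiseEnergy_le {X η : ℕ → 𝔼₂} {W C ε : ℝ} (hX : ∀ t, ‖X t‖ ≤ W * aRate ^ t) (hC : 0 ≤ C)
    (hε : 0 ≤ ε) (hη : ∀ t : ℕ, ‖η (t + 1)‖ ^ 2 ≤ C + ε * (t + 1)) (T : ℕ) :
    noiseEnergy X η T ≤ 144 * W ^ 2 * (C + ε * (T + 1)) * aRate ^ (2 * T) := by
  unfold noiseEnergy
  rw [Finset.sum_comm]
  have hrow : ∀ t ∈ Finset.range (T + 1), ∑ s ∈ Finset.range (T + 1),
      (if s < t then cross2 (X s) (η (t + 1)) ^ 2 else 0)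
        ≤ 24 * W ^ 2 * (C + ε * (T + 1)) * aRate ^ (2 * t) := by
    intro t ht
    have htT : (t : ℝ) ≤ T := by exact_mod_cast Nat.le_of_lt_succ (Finset.mem_range.1 ht)
    have hηT : ‖η (t + 1)‖ ^ 2 ≤ C + ε * (T + 1) := (hη t).trans (by gcongr)
    have hsub : (Finset.range (T + 1)).filter (· < t) ⊆ Finset.range (t + 1) := by
      intro s hs
      simp only [Finset.mem_filter, Finset.mem_range] at hs ⊢
      omega
    rw [← Finset.sum_filter]
    calc _ ≤ ∑ s ∈ Finset.range (t + 1), cross2 (X s) (η (t + 1)) ^ 2 :=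
          Finset.sum_le_sum_of_subset_of_nonneg hsub fun _ _ _ => sq_nonneg _
      _ ≤ ∑ s ∈ Finset.range (t + 1), 4 * (C + ε * (T + 1)) * ‖X s‖ ^ 2 :=
          Finset.sum_le_sum fun s _ => (sq_cross2_le _ _).trans (by
            nlinarith [mul_le_mul_of_nonneg_left hηT (sq_nonneg ‖X s‖)])
      _ ≤ 4 * (C + ε * (T + 1)) * (6 * W ^ 2 * aRate ^ (2 * t)) := by
          rw [← Finset.mul_sum]
          exact mul_le_mul_of_nonneg_left (sum_norm_sq_le hX t) (by positivity)
      _ = _ := by ring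
  refine (Finset.sum_le_sum hrow).trans ?_
  rw [← Finset.mul_sum]
  refine (mul_le_mul_of_nonneg_left (sum_aRate_pow_two_mul_le T) (by positivity)).trans_eq ?_
  ring

/-- Differences of consecutive states recover the noise, so the last state spans a parallelogram
with each noise vector that the Gram determinant controls. -/
lemma sum_sq_cross2_noise_le {X η : ℕ → 𝔼₂} (h0 : X 0 = 0)
    (hX : ∀ t, X (t + 1) = aRate • X t + η (t + 1)) (T : ℕ) :
    ∑ s ∈ Finset.range T, cross2 (X T) (η (s + 1)) ^ 2 ≤ 5 * (gramMat X T).det := by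
  have hlast : ∑ t ∈ Finset.range T, cross2 (X T) (X t) ^ 2 ≤ (gramMat X T).det := by
    rw [det_gramMat_eq_sum_lt]
    refine le_trans ?_ (Finset.single_le_sum (f := fun s => ∑ t ∈ Finset.range (T + 1),
      if t < s then cross2 (X s) (X t) ^ 2 else 0) (fun s _ => Finset.sum_nonneg fun t _ => by
        split_ifs <;> positivity) (Finset.mem_range.2 T.lt_succ_self))
    rw [Finset.sum_range_succ, if_neg (lt_irrefl T), add_zero]
    refine (Finset.sum_congr rfl fun t ht => ?_).le
    rw [if_pos (Finset.mem_range.1 ht)]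
  have hshift : ∑ t ∈ Finset.range T, cross2 (X T) (X (t + 1)) ^ 2
      = ∑ t ∈ Finset.range T, cross2 (X T) (X t) ^ 2 := by
    have h1 := Finset.sum_range_succ' (fun t => cross2 (X T) (X t) ^ 2) T
    have h2 := Finset.sum_range_succ (fun t => cross2 (X T) (X t) ^ 2) T
    simp only [h0, cross2_self, cross2_zero_right] at h1 h2
    linarith
  have hterm : ∀ s, cross2 (X T) (η (s + 1)) ^ 2
      ≤ 2 * cross2 (X T) (X (s + 1)) ^ 2 + 2 * aRate ^ 2 * cross2 (X T) (X s) ^ 2 := by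
    intro s
    rw [hX s, cross2_add_right, cross2_smul_right]
    nlinarith [sq_nonneg (cross2 (X T) (η (s + 1)) + 2 * (aRate * cross2 (X T) (X s)))]
  refine (Finset.sum_le_sum fun s _ => hterm s).trans ?_
  rw [Finset.sum_add_distrib, ← Finset.mul_sum, ← Finset.mul_sum, hshift]
  have hnn : 0 ≤ ∑ t ∈ Finset.range T, cross2 (X T) (X t) ^ 2 := by positivity
  unfold aRate
  linarith

/-- The empirical second moments of the noise are eventually at least half of the identity. -/
def ExcitingNoise (η : ℕ → 𝔼₂) : Prop :=
  ∀ᶠ T : ℕ in atTop, ∀ u : 𝔼₂, T * ‖u‖ ^ 2 / 2 ≤ ∑ s ∈ Finset.range T, cross2 u (η (s + 1)) ^ 2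

/-- Along a trajectory with tame noise and nonzero direction of escape, the interaction with the
noise is eventually negligible against the Gram determinant. -/
theorem eventually_noiseEnergy_le {η : ℕ → 𝔼₂} (hsub : SublinearNoise η) (hexc : ExcitingNoise η)
    (hlim : ∀ Z, Tendsto (fun t => (aRate ^ t)⁻¹ • scalarTraj aRate η t) atTop (𝓝 Z) → Z ≠ 0) :
    ∀ᶠ T in atTop, noiseEnergy (scalarTraj aRate η) η T
      ≤ (1 / 20) ^ 2 * (gramMat (scalarTraj aRate η) T).det := by
  obtain ⟨Z, K, hK, hZ, hXZ⟩ := hsub.exists_limit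
  have hZ0 := hlim Z hZ
  set W := K + ‖Z‖ with hW
  have hX := norm_le_of_norm_sub_pow_smul_le hK hXZ
  have hZpos : 0 < ‖Z‖ ^ 2 := by
    have := norm_pos_iff.2 hZ0
    positivity
  -- `ε` makes the linear part of the noise energy, at most `144 W² ε T a^{2T}`, small against the
  -- lower bound `T ‖Z‖² a^{2T} / 40` for the Gram determinant
  set ε : ℝ := ‖Z‖ ^ 2 / (16000 * 4 * 144 * (W ^ 2 + 1)) with hε
  have hε0 : 0 < ε := by positivity
  have hεW : 144 * W ^ 2 * ε ≤ ‖Z‖ ^ 2 / 64000 := by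
    rw [hε, mul_div_assoc', div_le_div_iff₀ (by positivity) (by positivity)]
    nlinarith
  obtain ⟨C, hC, hη⟩ := hsub ε hε0
  obtain ⟨T₁, hT₁⟩ := exists_nat_ge (144 * W ^ 2 * C / (‖Z‖ ^ 2 / 32000))
  filter_upwards [hexc, eventually_le_norm_scalarTraj hZ0 hZ, eventually_ge_atTop T₁,
    eventually_ge_atTop 1] with T h1 h2 h3 h4
  have h5 := sum_sq_cross2_noise_le (X := scalarTraj aRate η) (η := η) rfl (fun _ => rfl) T
  have h6 := (h1 (scalarTraj aRate η T)).trans h5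
  have h7 := noiseEnergy_le hX hC hε0.le hη T
  have hT : (1 : ℝ) ≤ T := by exact_mod_cast h4
  have hp := pow_pos aRate_pos (2 * T)
  have h8 : ‖Z‖ ^ 2 / 4 * aRate ^ (2 * T) ≤ ‖scalarTraj aRate η T‖ ^ 2 := by
    refine le_trans (le_of_eq ?_) (pow_le_pow_left₀ (mul_nonneg (by positivity)
      (pow_nonneg aRate_pos.le T)) h2 2)
    ring
  have h9 : 144 * W ^ 2 * C ≤ T * (‖Z‖ ^ 2 / 32000) := by
    rw [← div_le_iff₀ (by positivity)]
    exact hT₁.trans (by exact_mod_cast h3)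
  have h10 : 144 * W ^ 2 * (C + ε * (T + 1)) ≤ T * (‖Z‖ ^ 2 / 16000) := by
    have : 144 * W ^ 2 * ε * (T + 1) ≤ ‖Z‖ ^ 2 / 64000 * (T + 1) :=
      mul_le_mul_of_nonneg_right hεW (by positivity)
    nlinarith
  have h11 := mul_le_mul_of_nonneg_right h10 hp.le
  have h12 := mul_le_mul_of_nonneg_left h8 (show (0 : ℝ) ≤ T by positivity)
  nlinarith

/-- Two-sided bounds for the singular values of the sample covariance along a trajectory with tame
noise and nonzero direction of escape. -/
theorem exists_matSingularValue_bounds {η : ℕ → 𝔼₂} (hsub : SublinearNoise η) (h1 : η 1 ≠ 0)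
    (hlim : ∀ Z, Tendsto (fun t => (aRate ^ t)⁻¹ • scalarTraj aRate η t) atTop (𝓝 Z) → Z ≠ 0) :
    ∃ c C : ℝ, 0 < c ∧ 0 < C ∧ ∀ T : ℕ, 1 ≤ T →
      c * aRate ^ (2 * T) ≤ matSingularValue (sampleCov (scalarTraj aRate η) T) 0 ∧
      matSingularValue (sampleCov (scalarTraj aRate η) T) 0 ≤ C * aRate ^ (2 * T) ∧
      matSingularValue (sampleCov (scalarTraj aRate η) T) 1 ≤ C * √(T : ℝ) * aRate ^ T := by
  obtain ⟨Z, K, hK, hZ, hXZ⟩ := hsub.exists_limit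
  have hZ0 := hlim Z hZ
  have hZpos : 0 < ‖Z‖ := norm_pos_iff.2 hZ0
  set X := scalarTraj aRate η with hXdef
  have hX := norm_le_of_norm_sub_pow_smul_le hK hXZ
  obtain ⟨T₀, hT₀⟩ := eventually_atTop.1 (eventually_le_norm_scalarTraj hZ0 hZ)
  have hX1 : X 1 = η 1 := by simp [hXdef, scalarTraj]
  have hη1 : 0 < ‖η 1‖ := norm_pos_iff.2 h1
  have ha := aRate_pos
  have ha1 : 1 ≤ aRate := by norm_num [aRate]
  refine ⟨min (‖Z‖ ^ 2 / 4) (‖η 1‖ ^ 2 / aRate ^ (2 * T₀)),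
    6 * (K + ‖Z‖) ^ 2 + 44 * K ^ 2, by positivity, by positivity, fun T hT => ?_⟩
  rw [sampleCov_eq_gramMat X rfl T]
  have hp : 0 < aRate ^ (2 * T) := by positivity
  refine ⟨?_, ?_, ?_⟩
  · rcases le_total T₀ T with h | h
    · refine le_trans ?_ (norm_sq_le_matSingularValue_gramMat_zero X T le_rfl)
      refine (mul_le_mul_of_nonneg_right (min_le_left _ _) hp.le).trans ?_
      refine le_trans (le_of_eq ?_) (pow_le_pow_left₀ (by positivity) (hT₀ T h) 2)
      ring
    · refine le_trans ?_ (norm_sq_le_matSingularValue_gramMat_zero X T hT)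
      refine (mul_le_mul_of_nonneg_right (min_le_right _ _) hp.le).trans ?_
      rw [hX1, div_mul_eq_mul_div, div_le_iff₀ (by positivity)]
      exact mul_le_mul_of_nonneg_left (pow_le_pow_right₀ ha1 (by omega)) (by positivity)
  · refine (matSingularValue_gramMat_zero_le X T).trans ((sum_norm_sq_le hX T).trans ?_)
    refine mul_le_mul_of_nonneg_right ?_ hp.le
    linarith [show 0 ≤ 44 * K ^ 2 by positivity]
  · have hq : ∑ t ∈ Finset.range (T + 1), cross2 Z (X t) ^ 2
        ≤ 44 * K ^ 2 * aRate ^ T * ‖Z‖ ^ 2 := by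
      have hterm : ∀ t, cross2 Z (X t) ^ 2 ≤ 4 * ‖Z‖ ^ 2 * K ^ 2 * aRate ^ t := by
        intro t
        have h2 : cross2 Z (X t) = cross2 Z (X t - aRate ^ t • Z) := by
          rw [sub_eq_add_neg, ← neg_smul, cross2_add_right, cross2_smul_right, cross2_self,
            mul_zero, add_zero]
        rw [h2]
        refine (sq_cross2_le _ _).trans ?_
        rw [mul_assoc (4 * ‖Z‖ ^ 2)]
        refine mul_le_mul_of_nonneg_left ?_ (by positivity)
        refine (pow_le_pow_left₀ (norm_nonneg _) (hXZ t) 2).trans ?_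
        rw [mul_pow, ← pow_mul, mul_comm t 2, pow_mul]
        refine mul_le_mul_of_nonneg_left ?_ (by positivity)
        exact pow_le_pow_left₀ (by positivity) (by norm_num [aRate]) t
      refine (Finset.sum_le_sum fun t _ => hterm t).trans ?_
      rw [← Finset.mul_sum]
      refine (mul_le_mul_of_nonneg_left (sum_aRate_pow_le T) (by positivity)).trans_eq ?_
      ring
    have h3 : matSingularValue (gramMat X T) 1 ≤ 44 * K ^ 2 * aRate ^ T :=
      le_of_mul_le_mul_right ((matSingularValue_gramMat_one_mul_le X T hZ0).trans hq)
        (by positivity)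
    refine h3.trans (mul_le_mul_of_nonneg_right ?_ (by positivity))
    have h4 : (1 : ℝ) ≤ √(T : ℝ) := Real.one_le_sqrt.2 (by exact_mod_cast hT)
    nlinarith [show 0 ≤ 6 * (K + ‖Z‖) ^ 2 by positivity, show 0 ≤ 44 * K ^ 2 by positivity]

/-! ### Almost sure properties of the noise -/

lemma tendsto_div_of_tendsto_average {x : ℕ → ℝ} {m : ℝ}
    (h : Tendsto (fun n : ℕ => (∑ i ∈ Finset.range n, x i) / n) atTop (𝓝 m)) :
    Tendsto (fun n : ℕ => x n / n) atTop (𝓝 0) := by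
  have h1 : Tendsto (fun n : ℕ => ((n : ℝ) + 1) / n) atTop (𝓝 1) := by
    have h2 : Tendsto (fun n : ℕ => 1 + 1 / (n : ℝ)) atTop (𝓝 (1 + 0)) :=
      tendsto_const_nhds.add tendsto_one_div_atTop_nhds_zero_nat
    rw [add_zero] at h2
    refine h2.congr' ?_
    filter_upwards [eventually_gt_atTop 0] with n hn
    have : (n : ℝ) ≠ 0 := by positivity
    field_simp
  have h3 := ((h.comp (tendsto_add_atTop_nat 1)).mul h1).sub h
  rw [mul_one, sub_self] at h3
  refine h3.congr' ?_
  filter_upwards [eventually_gt_atTop 0] with n hn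
  have : (n : ℝ) ≠ 0 := by positivity
  simp only [Function.comp_apply, Finset.sum_range_succ, Nat.cast_add, Nat.cast_one]
  field_simp
  ring

section AlmostSure

variable {Ω : Type*} [MeasurableSpace Ω] {μ : Measure Ω}

section Average

variable {E : Type*} [NormedAddCommGroup E] [InnerProductSpace ℝ E] [FiniteDimensional ℝ E]
  [MeasurableSpace E] [BorelSpace E] {η : ℕ → Ω → E}

lemma integral_inner_sq_stdGaussian (w : E) :
    ∫ x, (inner ℝ w x : ℝ) ^ 2 ∂(stdGaussian E) = ‖w‖ ^ 2 := by
  have h1 := variance_dual_stdGaussian (innerSL ℝ w)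
  rw [variance_of_integral_eq_zero (by fun_prop) (integral_strongDual_stdGaussian _),
    innerSL_apply_norm] at h1
  simpa using h1

/-- The law of large numbers for the second moments of the noise. -/
lemma ae_tendsto_average_inner_sq (hind : iIndepFun (fun t => η (t + 1)) μ)
    (hlaw : ∀ t : ℕ, HasLaw (η (t + 1)) (stdGaussian E) μ) (w : E) :
    ∀ᵐ ω ∂μ, Tendsto (fun n : ℕ => (∑ t ∈ Finset.range n, (inner ℝ w (η (t + 1) ω) : ℝ) ^ 2) / n)
      atTop (𝓝 (‖w‖ ^ 2)) := by
  have hm : Measurable fun x : E => (inner ℝ w x : ℝ) ^ 2 :=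
    Continuous.measurable (by fun_prop)
  have hi : Integrable (fun x : E => (inner ℝ w x : ℝ) ^ 2) (stdGaussian E) :=
    (IsGaussian.memLp_dual (stdGaussian E) (innerSL ℝ w) 2 (by norm_num)).integrable_sq
  have hint : Integrable (fun ω => (inner ℝ w (η 1 ω) : ℝ) ^ 2) μ := by
    rw [← (hlaw 0).map_eq] at hi
    exact hi.comp_aemeasurable (hlaw 0).aemeasurable
  have h := strong_law_ae_real (fun t ω => (inner ℝ w (η (t + 1) ω) : ℝ) ^ 2) hint
    (fun s t hst => (hind.indepFun hst).comp hm hm) (fun t =>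
      (IdentDistrib.mk (hlaw t).aemeasurable (hlaw 0).aemeasurable
        ((hlaw t).map_eq.trans (hlaw 0).map_eq.symm)).comp hm)
  have hmean : ∫ ω, (inner ℝ w (η (0 + 1) ω) : ℝ) ^ 2 ∂μ = ‖w‖ ^ 2 := by
    rw [← integral_inner_sq_stdGaussian w, ← (hlaw 0).map_eq,
      integral_map (hlaw 0).aemeasurable hm.aestronglyMeasurable]
  rw [hmean] at h
  exact h

variable [IsProbabilityMeasure μ]

/-- An independent Gaussian summand spreads the mass of a sum. -/
lemma integral_exp_neg_norm_sq_add_le {ξ W : Ω → E} (hind : IndepFun W ξ μ)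
    (hW : AEMeasurable W μ) (hξ : HasLaw ξ (stdGaussian E) μ) (r : ℝ) {e : E} (he : ‖e‖ = 1) :
    ∫ ω, Real.exp (-‖r • ξ ω + W ω‖ ^ 2 / 2) ∂μ ≤ (1 + r ^ 2) ^ (-(1 / 2) : ℝ) := by
  have hlaw := (indepFun_iff_map_prod_eq_prod_map_map hW hξ.aemeasurable).1 hind
  rw [hξ.map_eq] at hlaw
  have := Measure.isProbabilityMeasure_map (μ := μ) hW
  have hc : Continuous fun p : E × E => Real.exp (-‖r • p.2 + p.1‖ ^ 2 / 2) := by fun_prop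
  have hle : ∀ v : E, Real.exp (-‖v‖ ^ 2 / 2) ≤ 1 := fun v =>
    Real.exp_le_one_iff.2 (by have := sq_nonneg ‖v‖; linarith)
  have h1 : ∫ ω, Real.exp (-‖r • ξ ω + W ω‖ ^ 2 / 2) ∂μ
      = ∫ w, ∫ x, Real.exp (-‖r • x + w‖ ^ 2 / 2) ∂(stdGaussian E) ∂(μ.map W) := by
    rw [← integral_map (φ := fun ω => (W ω, ξ ω)) (hW.prodMk hξ.aemeasurable)
      hc.aestronglyMeasurable, hlaw, integral_prod]
    refine Integrable.of_bound (C := 1) hc.aestronglyMeasurable (ae_of_all _ fun p => ?_)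
    rw [Real.norm_eq_abs, Real.abs_exp]
    exact hle _
  rw [h1]
  have h2 : ∀ w : E, ∫ x, Real.exp (-‖r • x + w‖ ^ 2 / 2) ∂(stdGaussian E)
      ≤ (1 + r ^ 2) ^ (-(1 / 2) : ℝ) := by
    intro w
    have h3 := integral_exp_neg_norm_sq_affine_le (r • ContinuousLinearMap.id ℝ E) 0 w e he.le
      (r • e) (Or.inl rfl)
    rw [norm_smul, he, mul_one, Real.norm_eq_abs, sq_abs] at h3
    simpa using h3
  calc _ ≤ ∫ _, (1 + r ^ 2) ^ (-(1 / 2) : ℝ) ∂(μ.map W) := by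
        refine integral_mono_of_nonneg (ae_of_all _ fun w => integral_nonneg fun x => by positivity)
          (integrable_const _) (ae_of_all _ h2)
    _ = _ := by simp

end Average

variable {η : ℕ → Ω → 𝔼₂}

lemma norm_sq_eq_inner_single (v : 𝔼₂) : ‖v‖ ^ 2
    = (inner ℝ (EuclideanSpace.single 0 (1 : ℝ)) v : ℝ) ^ 2
      + (inner ℝ (EuclideanSpace.single 1 (1 : ℝ)) v : ℝ) ^ 2 := by
  rw [EuclideanSpace.norm_sq_eq, Fin.sum_univ_two]
  simp [EuclideanSpace.inner_single_left]

lemma ae_sublinearNoise (hind : iIndepFun (fun t => η (t + 1)) μ)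
    (hlaw : ∀ t : ℕ, HasLaw (η (t + 1)) (stdGaussian 𝔼₂) μ) :
    ∀ᵐ ω ∂μ, SublinearNoise fun t => η t ω := by
  filter_upwards [ae_tendsto_average_inner_sq hind hlaw (EuclideanSpace.single 0 (1 : ℝ)),
    ae_tendsto_average_inner_sq hind hlaw (EuclideanSpace.single 1 (1 : ℝ))] with ω h0 h1 ε hε
  have h2 := (tendsto_div_of_tendsto_average h0).add (tendsto_div_of_tendsto_average h1)
  simp only [← add_div, ← norm_sq_eq_inner_single, add_zero] at h2
  obtain ⟨N, hN⟩ := eventually_atTop.1 ((h2.eventually (gt_mem_nhds hε)).and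
    (eventually_gt_atTop 0))
  refine ⟨∑ t ∈ Finset.range N, ‖η (t + 1) ω‖ ^ 2, by positivity, fun t => ?_⟩
  rcases lt_or_ge t N with ht | ht
  · have h3 := Finset.single_le_sum (f := fun t => ‖η (t + 1) ω‖ ^ 2) (fun _ _ => by positivity)
      (Finset.mem_range.2 ht)
    have : 0 ≤ ε * ((t : ℝ) + 1) := by positivity
    linarith
  · obtain ⟨h4, h5⟩ := hN t ht
    have h6 : (0 : ℝ) < t := by exact_mod_cast h5
    rw [div_lt_iff₀ h6] at h4
    have : 0 ≤ ∑ t ∈ Finset.range N, ‖η (t + 1) ω‖ ^ 2 := by positivity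
    linarith

lemma ae_excitingNoise (hind : iIndepFun (fun t => η (t + 1)) μ)
    (hlaw : ∀ t : ℕ, HasLaw (η (t + 1)) (stdGaussian 𝔼₂) μ) :
    ∀ᵐ ω ∂μ, ExcitingNoise fun t => η t ω := by
  -- the second moments in three directions determine the quadratic form
  filter_upwards [ae_tendsto_average_inner_sq hind hlaw (EuclideanSpace.single 0 (1 : ℝ)),
    ae_tendsto_average_inner_sq hind hlaw (EuclideanSpace.single 1 (1 : ℝ)),
    ae_tendsto_average_inner_sq hind hlaw
      (EuclideanSpace.single 0 (1 : ℝ) + EuclideanSpace.single 1 (1 : ℝ))] with ω h0 h1 h2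
  have hn2 : ‖(EuclideanSpace.single 0 (1 : ℝ) + EuclideanSpace.single 1 (1 : ℝ) : 𝔼₂)‖ ^ 2 = 2 := by
    rw [EuclideanSpace.norm_sq_eq, Fin.sum_univ_two]
    norm_num
  rw [hn2] at h2
  simp only [PiLp.norm_single, norm_one, one_pow, inner_add_left, EuclideanSpace.inner_single_left,
    map_one, one_mul] at h0 h1 h2
  filter_upwards [h0.eventually (Icc_mem_nhds (show (0.9 : ℝ) < 1 by norm_num)
      (show (1 : ℝ) < 1.1 by norm_num)),
    h1.eventually (Icc_mem_nhds (show (0.9 : ℝ) < 1 by norm_num) (show (1 : ℝ) < 1.1 by norm_num)),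
    h2.eventually (Icc_mem_nhds (show (1.9 : ℝ) < 2 by norm_num) (show (2 : ℝ) < 2.1 by norm_num)),
    eventually_gt_atTop 0] with T g0 g1 g2 hT u
  have hT' : (0 : ℝ) < T := by exact_mod_cast hT
  rw [le_div_iff₀ hT', div_le_iff₀ hT'] at g0 g1 g2
  have hexp : ∑ s ∈ Finset.range T, ((η (s + 1) ω) 0 + (η (s + 1) ω) 1) ^ 2
      = ∑ s ∈ Finset.range T, (η (s + 1) ω) 0 ^ 2 + ∑ s ∈ Finset.range T, (η (s + 1) ω) 1 ^ 2
        + 2 * ∑ s ∈ Finset.range T, (η (s + 1) ω) 0 * (η (s + 1) ω) 1 := by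
    simp only [Finset.mul_sum, ← Finset.sum_add_distrib]
    exact Finset.sum_congr rfl fun s _ => by ring
  have hq : ∑ s ∈ Finset.range T, cross2 u (η (s + 1) ω) ^ 2
      = u 0 ^ 2 * ∑ s ∈ Finset.range T, (η (s + 1) ω) 1 ^ 2
        + u 1 ^ 2 * ∑ s ∈ Finset.range T, (η (s + 1) ω) 0 ^ 2
        - 2 * (u 0 * u 1) * ∑ s ∈ Finset.range T, (η (s + 1) ω) 0 * (η (s + 1) ω) 1 := by
    simp only [cross2, Finset.mul_sum, ← Finset.sum_add_distrib, ← Finset.sum_sub_distrib]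
    exact Finset.sum_congr rfl fun s _ => by ring
  rw [hexp] at g2
  rw [hq, EuclideanSpace.norm_sq_eq, Fin.sum_univ_two, Real.norm_eq_abs, Real.norm_eq_abs, sq_abs,
    sq_abs]
  set A := ∑ s ∈ Finset.range T, (η (s + 1) ω) 0 ^ 2
  set B := ∑ s ∈ Finset.range T, (η (s + 1) ω) 1 ^ 2
  set D := ∑ s ∈ Finset.range T, (η (s + 1) ω) 0 * (η (s + 1) ω) 1
  have hD1 : 2 * D ≤ 0.3 * T := by linarith [g0.1, g1.1, g2.2]
  have hD2 : -(0.3 * T) ≤ 2 * D := by linarith [g0.2, g1.2, g2.1]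
  have hA := mul_le_mul_of_nonneg_left g0.1 (sq_nonneg (u 1))
  have hB := mul_le_mul_of_nonneg_left g1.1 (sq_nonneg (u 0))
  have hD : 2 * (u 0 * u 1) * D ≤ 0.3 * T * ((u 0 ^ 2 + u 1 ^ 2) / 2) := by
    have h3 : u 0 * u 1 * (2 * D) ≤ |u 0 * u 1| * |2 * D| := by
      rw [← abs_mul]
      exact le_abs_self _
    have h4 : |u 0 * u 1| ≤ (u 0 ^ 2 + u 1 ^ 2) / 2 :=
      abs_le.2 ⟨by nlinarith [sq_nonneg (u 0 + u 1)], by nlinarith [sq_nonneg (u 0 - u 1)]⟩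
    have h5 : |2 * D| ≤ 0.3 * T := abs_le.2 ⟨hD2, hD1⟩
    have h6 := mul_le_mul h4 h5 (abs_nonneg _) (by positivity)
    linarith
  nlinarith [mul_nonneg hT'.le (sq_nonneg (u 0)), mul_nonneg hT'.le (sq_nonneg (u 1))]

lemma inv_pow_smul_scalarTraj {E : Type*} [NormedAddCommGroup E] [InnerProductSpace ℝ E] {a : ℝ}
    (ha : a ≠ 0) (η : ℕ → E) (T : ℕ) : (a ^ T)⁻¹ • scalarTraj a η T
      = ∑ j ∈ Finset.range T, (a ^ (j + 1))⁻¹ • η (j + 1) := by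
  induction T with
  | zero => simp [scalarTraj]
  | succ T ih =>
    rw [Finset.sum_range_succ, ← ih, scalarTraj, smul_add, smul_smul]
    congr 2
    rw [pow_succ]
    field_simp

variable [IsProbabilityMeasure μ]

/-- The limit of the normalized trajectory is almost surely nonzero: it is the sum of a multiple of
the first noise vector and a function of the later ones. -/
theorem ae_limit_ne_zero (hind : iIndepFun (fun t => η (t + 1)) μ)
    (hlaw : ∀ t : ℕ, HasLaw (η (t + 1)) (stdGaussian 𝔼₂) μ) :
    ∀ᵐ ω ∂μ, ∀ Z, Tendsto (fun t => (aRate ^ t)⁻¹ • scalarTraj aRate (fun s => η s ω) t) atTop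
      (𝓝 Z) → Z ≠ 0 := by
  have ha := aRate_pos
  set Y : ℕ → Ω → 𝔼₂ := fun t ω => (aRate ^ t)⁻¹ • scalarTraj aRate (fun s => η s ω) t with hY
  have hYsum : ∀ T ω, Y T ω = ∑ j ∈ Finset.range T, (aRate ^ (j + 1))⁻¹ • η (j + 1) ω := fun T ω =>
    inv_pow_smul_scalarTraj ha.ne' _ T
  have hYm : ∀ T, AEMeasurable (Y T) μ := fun T => by
    have : Y T = fun ω => ∑ j ∈ Finset.range T, (aRate ^ (j + 1))⁻¹ • η (j + 1) ω :=
      funext (hYsum T)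
    rw [this]
    exact Finset.aemeasurable_fun_sum _ fun j _ => (hlaw j).aemeasurable.const_smul (aRate ^ (j + 1))⁻¹
  obtain ⟨Z, hZm, hZ⟩ := measurable_limit_of_tendsto_metrizable_ae hYm
    ((ae_sublinearNoise hind hlaw).mono fun ω hω =>
      let ⟨Z, _, _, hZ, _⟩ := hω.exists_limit
      ⟨Z, hZ⟩)
  have hbound : ∀ (r : ℝ) (T : ℕ), ∫ ω, Real.exp (-‖(aRate * r) • Y (T + 1) ω‖ ^ 2 / 2) ∂μ
      ≤ (1 + r ^ 2) ^ (-(1 / 2) : ℝ) := by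
    intro r T
    let φ : ℕ → 𝔼₂ → 𝔼₂ := fun j v =>
      if j = 0 then v else (aRate * r) • (aRate ^ (j + 1))⁻¹ • v
    have hφ : ∀ j, Measurable (φ j) := fun j => by
      simp only [φ]
      split_ifs <;> fun_prop
    have hcomp := hind.comp φ hφ
    have hi := hcomp.indepFun_finsetSum_of_notMem₀
      (fun j => (hφ j).comp_aemeasurable (hlaw j).aemeasurable)
      (s := Finset.Ico 1 (T + 1)) (i := 0) (by simp)
    have h := integral_exp_neg_norm_sq_add_le (e := EuclideanSpace.single 0 (1 : ℝ)) hi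
      (Finset.aemeasurable_sum _ fun j _ => (hφ j).comp_aemeasurable (hlaw j).aemeasurable)
      (by simpa [φ, Function.comp_def] using hlaw 0) r (by simp)
    refine le_trans (le_of_eq ?_) h
    refine integral_congr_ae (ae_of_all _ fun ω => ?_)
    have hsplit : (aRate * r) • Y (T + 1) ω = r • (φ 0 ∘ η (0 + 1)) ω
        + (∑ j ∈ Finset.Ico 1 (T + 1), φ j ∘ η (j + 1)) ω := by
      rw [hYsum, Finset.range_eq_Ico, Finset.sum_eq_sum_Ico_succ_bot (Nat.succ_pos T), smul_add,
        Finset.sum_apply, Finset.smul_sum]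
      refine congrArg₂ (· + ·) ?_ (Finset.sum_congr rfl fun j hj => ?_)
      · simp only [φ, Function.comp_apply, if_true, smul_smul]
        rw [show aRate * r * (aRate ^ (0 + 1))⁻¹ = r by rw [zero_add, pow_one]; field_simp]
      · have hj0 : j ≠ 0 := by have := (Finset.mem_Ico.1 hj).1; omega
        simp only [φ, Function.comp_apply, if_neg hj0]
    simp only [hsplit]
  have hlim : ∀ r : ℝ, ∫ ω, Real.exp (-‖(aRate * r) • Z ω‖ ^ 2 / 2) ∂μ
      ≤ (1 + r ^ 2) ^ (-(1 / 2) : ℝ) := by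
    intro r
    have hc : Continuous fun v : 𝔼₂ => Real.exp (-‖(aRate * r) • v‖ ^ 2 / 2) := by fun_prop
    have ht : Tendsto (fun T : ℕ => ∫ ω, Real.exp (-‖(aRate * r) • Y (T + 1) ω‖ ^ 2 / 2) ∂μ) atTop
        (𝓝 (∫ ω, Real.exp (-‖(aRate * r) • Z ω‖ ^ 2 / 2) ∂μ)) := by
      refine tendsto_integral_of_dominated_convergence (fun _ => 1)
        (fun T => (hc.measurable.comp_aemeasurable (hYm (T + 1))).aestronglyMeasurable)
        (integrable_const 1) (fun T => ae_of_all _ fun ω => ?_) ?_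
      · rw [Real.norm_eq_abs, Real.abs_exp]
        exact Real.exp_le_one_iff.2 (by
          have := sq_nonneg ‖(aRate * r) • Y (T + 1) ω‖
          linarith)
      · filter_upwards [hZ] with ω hω
        exact (hc.tendsto (Z ω)).comp (hω.comp (tendsto_add_atTop_nat 1))
    exact le_of_tendsto ht (Eventually.of_forall (hbound r))
  have hnull : μ.real {ω | Z ω = 0} = 0 := by
    by_contra hne
    have hpos : 0 < μ.real {ω | Z ω = 0} := lt_of_le_of_ne measureReal_nonneg (Ne.symm hne)
    set m := μ.real {ω | Z ω = 0} with hm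
    -- the average over the atom is `m`, while the decay at `r = 2 / m` bounds it by `m / 2`
    have hms : MeasurableSet {ω | Z ω = 0} := hZm (measurableSet_singleton 0)
    have h1 : m ≤ ∫ ω, Real.exp (-‖(aRate * (2 / m)) • Z ω‖ ^ 2 / 2) ∂μ := by
      refine (integral_indicator_one hms).symm.le.trans ?_
      refine integral_mono_of_nonneg (ae_of_all _ fun ω => ?_) ?_ (ae_of_all _ fun ω => ?_)
      · exact Set.indicator_nonneg (fun _ _ => zero_le_one) ω
      · refine Integrable.of_bound (C := 1) ?_ (ae_of_all _ fun ω => ?_)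
        · exact (Continuous.measurable (f := fun v : 𝔼₂ =>
            Real.exp (-‖(aRate * (2 / m)) • v‖ ^ 2 / 2)) (by fun_prop)).comp hZm
              |>.aestronglyMeasurable
        · rw [Real.norm_eq_abs, Real.abs_exp]
          exact Real.exp_le_one_iff.2 (by
            have := sq_nonneg ‖(aRate * (2 / m)) • Z ω‖
            linarith)
      · by_cases hω : Z ω = 0
        · simp [hω]
        · rw [Set.indicator_of_notMem (by exact hω)]
          positivity
    have h2 := h1.trans (hlim (2 / m))
    have h3 : (1 + (2 / m) ^ 2) ^ (-(1 / 2) : ℝ) ≤ ((2 / m) ^ 2) ^ (-(1 / 2) : ℝ) :=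
      Real.rpow_le_rpow_of_nonpos (by positivity) (by linarith) (by norm_num)
    rw [← Real.rpow_natCast (2 / m), ← Real.rpow_mul (by positivity)] at h3
    norm_num at h3
    rw [Real.rpow_neg_one, inv_div] at h3
    linarith
  have hZ0 : ∀ᵐ ω ∂μ, Z ω ≠ 0 := by
    rw [ae_iff]
    simp only [ne_eq, not_not]
    exact (measureReal_eq_zero_iff (measure_ne_top _ _)).1 hnull
  filter_upwards [hZ, hZ0] with ω h1 h2 Z' hZ'
  rwa [tendsto_nhds_unique hZ' h1]

end AlmostSure

/-! ### Inconsistency and high-probability bounds -/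

/-- A property that holds eventually, almost surely, has probability tending to one. No
measurability is needed. -/
lemma tendsto_measure_of_ae_eventually {Ω : Type*} [MeasurableSpace Ω] {μ : Measure Ω}
    [IsProbabilityMeasure μ] {p : ℕ → Ω → Prop} (h : ∀ᵐ ω ∂μ, ∀ᶠ n in atTop, p n ω) :
    Tendsto (fun n => μ {ω | p n ω}) atTop (𝓝 1) := by
  let U : ℕ → Set Ω := fun n => {ω | ∀ m ≥ n, p m ω}
  have hU : Monotone U := fun m n hmn ω hω k hk => hω k (hmn.trans hk)
  have hmem : (⋃ n, U n) ∈ ae μ := h.mono fun ω hω =>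
    let ⟨n, hn⟩ := eventually_atTop.1 hω
    Set.mem_iUnion.2 ⟨n, hn⟩
  have hunion : μ (⋃ n, U n) = 1 := by
    rw [measure_congr (eventuallyEq_univ.2 hmem), measure_univ]
  have ht := tendsto_measure_iUnion_atTop (μ := μ) hU
  rw [hunion] at ht
  exact tendsto_of_tendsto_of_tendsto_of_le_of_le ht tendsto_const_nhds
    (fun n => measure_mono fun ω hω => hω n le_rfl) (fun n => prob_le_one)

theorem mainTheorem4 {Ω : Type*} [MeasurableSpace Ω] (μ : Measure Ω) [IsProbabilityMeasure μ]
    (η : ℕ → Ω → EuclideanSpace ℝ (Fin 2))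
    (hη_indep : iIndepFun (fun t => η (t + 1)) μ)
    (hη_law : ∀ t : ℕ, HasLaw (η (t + 1)) (stdGaussian (EuclideanSpace ℝ (Fin 2))) μ)
    (X : ℕ → Ω → EuclideanSpace ℝ (Fin 2))
    (hX : ∀ t ω, X t ω = ltiState Ao (fun s => η s ω) t)
    (Ahat : ℕ → Ω → Matrix (Fin 2) (Fin 2) ℝ)
    (hAhat : ∀ T : ℕ, ∀ᵐ ω ∂μ, IsOLS (fun t => X t ω) T (Ahat T ω)) :
    -- the least squares estimate is unique and its error has a continuous density
    (∀ T : ℕ, 2 ≤ T → (T : ℝ) ^ 2 ≤ aRate ^ T →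
      (∀ᵐ ω ∂μ, ∃! B : Matrix (Fin 2) (Fin 2) ℝ, IsOLS (fun t => X t ω) T B) ∧
      ∃ f : ℝ → ℝ, Continuous f ∧ (∀ x, 0 ≤ f x) ∧
        HasLaw (fun ω => opNorm2 (Ahat T ω - Ao))
          (volume.withDensity (fun x => ENNReal.ofReal (f x))) μ) ∧
    -- the error does not decay to zero
    (∃ ε : ℝ, 0 < ε ∧
      Tendsto (fun T : ℕ => μ {ω | ε ≤ opNorm2 (Ahat T ω - Ao)}) atTop (𝓝 1)) ∧
    -- least squares is inconsistent
    (¬ TendstoInMeasure μ (fun (T : ℕ) ω => opNorm2 (Ahat T ω - Ao)) atTop (fun _ => 0)) ∧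
    -- the singular values of the sample covariance matrix, with high probability
    (∀ δ : ℝ, 0 < δ → δ < 1 → ∃ c C : ℝ, 0 < c ∧ 0 < C ∧
      ENNReal.ofReal (1 - δ) ≤ μ {ω | ∀ T : ℕ, 1 ≤ T → (T : ℝ) ^ 2 ≤ aRate ^ T →
        c * aRate ^ (2 * T) ≤ matSingularValue (sampleCov (fun t => X t ω) T) 0 ∧
        matSingularValue (sampleCov (fun t => X t ω) T) 0 ≤ C * aRate ^ (2 * T) ∧
        matSingularValue (sampleCov (fun t => X t ω) T) 1 ≤ C * √(T : ℝ) * aRate ^ T}) := by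
  have hXtraj : ∀ ω, (fun t => X t ω) = scalarTraj aRate fun s => η s ω := fun ω =>
    funext fun t => (hX t ω).trans (ltiState_Ao _ t)
  have hdet := ae_det_gramMat_pos aRate hη_indep hη_law
  have hsub := ae_sublinearNoise hη_indep hη_law
  have hlim := ae_limit_ne_zero hη_indep hη_law
  have hOLS : ∀ᵐ ω ∂μ, ∀ T, IsOLS (scalarTraj aRate fun s => η s ω) T (Ahat T ω) := by
    filter_upwards [ae_all_iff.2 hAhat] with ω hω T
    rw [← hXtraj]
    exact hω T
  have hlower : ∃ ε : ℝ, 0 < ε ∧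
      Tendsto (fun T : ℕ => μ {ω | ε ≤ opNorm2 (Ahat T ω - Ao)}) atTop (𝓝 1) := by
    refine ⟨1 / 40, by norm_num, tendsto_measure_of_ae_eventually ?_⟩
    filter_upwards [hOLS, hdet, hsub, ae_excitingNoise hη_indep hη_law, hlim]
      with ω h1 h2 h3 h4 h5
    filter_upwards [eventually_noiseEnergy_le h3 h4 h5, eventually_ge_atTop 2] with T h6 h7
    exact (h1 T).le_opNorm2_sub rfl (fun _ => rfl) (h2 T h7) h6
  refine ⟨fun T hT2 hT => ⟨?_, ?_⟩, hlower, ?_, fun δ hδ hδ1 => ?_⟩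
  · filter_upwards [hOLS, hdet] with ω h1 h2
    rw [hXtraj]
    exact ⟨Ahat T ω, h1 T, fun B hB => hB.eq_of_det_ne_zero (h2 T hT2).ne' (h1 T)⟩
  · obtain ⟨f, hf, hf0, hlaw⟩ := exists_continuous_density_norm_errVec aRate aRate_pos.le hη_indep
      hη_law T (le_of_sq_le_aRate_pow hT2 hT)
    refine ⟨f, hf, hf0, hlaw.congr ?_⟩
    filter_upwards [hOLS, hdet] with ω h1 h2
    exact (norm_entryOp_errVec (h2 T hT2).ne' (h1 T)).symm
  · intro hcons
    obtain ⟨ε, hε, ht⟩ := hlower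
    have h0 := hcons (ENNReal.ofReal ε) (by simpa using hε)
    refine zero_ne_one (tendsto_nhds_unique (h0.congr fun T => ?_) ht)
    congr 1
    ext ω
    have hn : 0 ≤ opNorm2 (Ahat T ω - Ao) := norm_nonneg _
    simp only [Set.mem_ofPred_eq, edist_dist, Real.dist_eq, sub_zero, abs_of_nonneg hn]
    exact ENNReal.ofReal_le_ofReal_iff hn
  · -- the random constants are at least `1 / n` and at most `n` with probability tending to one
    have hev : ∀ᵐ ω ∂μ, ∀ᶠ n : ℕ in atTop, ∀ T : ℕ, 1 ≤ T → (T : ℝ) ^ 2 ≤ aRate ^ T →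
        1 / ((n : ℝ) + 1) * aRate ^ (2 * T) ≤ matSingularValue (sampleCov (fun t => X t ω) T) 0 ∧
        matSingularValue (sampleCov (fun t => X t ω) T) 0 ≤ ((n : ℝ) + 1) * aRate ^ (2 * T) ∧
        matSingularValue (sampleCov (fun t => X t ω) T) 1
          ≤ ((n : ℝ) + 1) * √(T : ℝ) * aRate ^ T := by
      filter_upwards [hsub, hlim, ae_ne_zero_of_hasLaw_stdGaussian (hη_law 0)] with ω h1 h2 h3
      obtain ⟨c, C, hc, hC, h⟩ := exists_matSingularValue_bounds h1 h3 h2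
      obtain ⟨N, hN⟩ := exists_nat_ge (max C (1 / c))
      filter_upwards [eventually_ge_atTop N] with n hn T hT _
      have hnN : (N : ℝ) ≤ n := by exact_mod_cast hn
      have hCn : C ≤ (n : ℝ) + 1 := by linarith [le_max_left C (1 / c)]
      have hcn : 1 / ((n : ℝ) + 1) ≤ c := by
        rw [one_div_le (by positivity) hc]
        linarith [le_max_right C (1 / c)]
      have ha := aRate_pos
      rw [hXtraj]
      obtain ⟨b1, b2, b3⟩ := h T hT
      exact ⟨(mul_le_mul_of_nonneg_right hcn (by positivity)).trans b1,
        b2.trans (mul_le_mul_of_nonneg_right hCn (by positivity)),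
        b3.trans (by gcongr)⟩
    have ht := tendsto_measure_of_ae_eventually hev
    have hlt : ENNReal.ofReal (1 - δ) < 1 := by
      rw [ENNReal.ofReal_lt_one]
      linarith
    obtain ⟨n, hn⟩ := (ht.eventually (lt_mem_nhds hlt)).exists
    exact ⟨1 / ((n : ℝ) + 1), (n : ℝ) + 1, by positivity, by positivity, hn.le⟩
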